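/- **Theorem (Tournament Runtime).** *Ledgers.* Let $\lambda$ be the security parameter. Honest parties $P$ of a lazy blockchain hold at each round $r$ a dirty ledger $\mathbb L^P_r$ (a finite sequence of transactions, pairwise distinct and different from the empty string $\epsilon$), and $\mathbb L^\cup_r$ is the longest of them. The consensus protocol is safe ($\mathbb L^{P_1}_{r_1}\preceq\mathbb L^{P_2}_{r_2}$ for all honest $P_1,P_2$ and $r_1<r_2$), live with parameter $u\ge 1$ (a transaction which honest $P$ attempts to write at round $r$ is in $\mathbb L^P_{r+u}$), and Lipschitz with parameter $\alpha\in\mathbb N$ ($|\mathbb L^P_{r_2}|-|\mathbb L^P_{r_1}|<\alpha(r_2-r_1)$ for $r_1<r_2$). Write $(tx,tx')\mid \mathbb L$ if $tx'$ immediately follows $tx$ in the sequence $\epsilon,\mathbb L[0],\mathbb L[1],\dots$. States evolve by a transition function $\delta$ from a genesis state $st_0$, and $\langle\cdot\rangle$ is a state commitment. The $i$-th entry of the augmented dirty ledger of $P$ is $(\epsilon,\langle st_0\rangle)$ for $i=0$, and the $i$-th transaction of $\mathbb L^P_r$ with the commitment to the state after the first $i$ transactions for $1\le i\le|\mathbb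 L^P_r|$. Its entries are the leaves of a Merkle mountain range (MMR) built with a keyed collision-resistant hash function. *Oracles.* The consensus oracle $\mathcal{CO}_r(tx,tx')$ is complete ($(tx,tx')\mid\mathbb L^\cup_r$ implies that it returns true) and sound with delay $\nu$ (no PPT adversary finds, except with probability negligible in $\lambda$, a pair with $\mathcal{CO}_r(tx,tx')$ true but $(tx,tx')\nmid\mathbb L^\cup_{r+\nu}$). The execution oracle, given by a succinct transition function $\langle\delta\rangle$ that may return an error, is complete (some efficient machine $M$ always outputs $\pi=M(st,tx)$ with $\langle\delta\rangle(\langle st\rangle,tx,\pi)=\langle\delta(st,tx)\rangle$) and sound (no PPT adversary finds, except with negligible probability, $st,tx,\pi$ such that $\langle\delta\rangle(\langle st\rangle,tx,\pi)$ is a commitment different from $\langle\delta(st,tx)\rangle$). A query at round $r$ costs $f(r)$ resp. $g(r)$ words, with $f(r)+g(r)\ge1$. All algorithms of honest parties are polynomial-time, $\delta$ increases the size of the state at most linearly in the size of the transaction, and a hash value, a state commitment, a transaction, a ledger length each fit into one word. All adversaries are given the public view (parameters, hash key and header chain, ledgers of the honest provers), whose size is polynomial in $\lambda$. *Tournament.*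 It is started at round $r=r(\lambda)$ with $n=n(\lambda)$ provers, each of which is an honest party or controlled by a PPT adversary $\mathcal A$ that sees all messages. In one round all provers claim sizes $\ell$ of their augmented dirty ledgers (honestly, $\ell=|\mathbb L^P_r|+1$). The provers enter in increasing order of claimed size. The verifier keeps a set $\mathcal S$ of provers, each having sent the peaks of its MMR and its last entry with a valid Merkle proof. The entering prover challenges the member of $\mathcal S$ with the largest size (the latest, if several). If that member loses, it is removed and the entering prover challenges the next one; if no member is left, the entering prover sends its claim (one round), and it becomes the only member if the claim is valid; if the entering prover loses, it is discarded; if both win, it joins $\mathcal S$. *Challenge game.* Given the responder's size $\ell^*$ and peaks, the challenger either names one of these peaks or starts the suffix monologue. (An honest challenger names the first peak that differs from the node at the same position of its own tree; if there is none, it starts the monologue.) In the first case the *bisection game* is played: starting from the named peak, the responder reveals the two children of the current node, whose joint hash must be that node, and the challenger picks one of them (an honest one the left child iff it differs from its own), until a leaf $j$ is reached. The responder then reveals leaf $j$, which must have the right hash. If $j=0$, the leaf must be $(\epsilon,\langle st_0\rangle)$; if $j\ge1$, the responder also reveals leaf $j-1$ with a Merkle proof, and the consensus oracle on the two transactions and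 the execution oracle on the transition must accept. The responder loses iff a check fails or it does not answer while the challenger's queries are valid; otherwise the challenger loses. In the *suffix monologue* the challenger (of size $\ell$) presents the $\min(\ell-\ell^*,\alpha(u+\nu))$ entries that follow the responder's last entry, and each transition is checked with both oracles. If a check fails, the challenger loses. Otherwise, if $\ell-\ell^*>\alpha(u+\nu)$, the responder loses; else both win, provided that the challenger sends along a valid claim whose last entry is the last one presented (and, if $\ell=\ell^*$, whose peaks are the responder's). *Rounds and communication.* Naming a peak and the reply to it, picking a child and the reply to it, a suffix monologue, and a separately sent claim each take one round of communication; oracle queries take place within the round that causes them. Communication is the total number of words of all messages between the verifier and the provers, including the oracle queries. *Conclusion.* There is an absolute constant $C$ such that the following holds. Suppose that at least one prover is honest and that $|\mathbb L^\cup_r|+\alpha(u+\nu)\ge 3$. Then for every PPT adversary $\mathcal A$, except with probability negligible in $\lambda$, the tournament ends within $$2n\log_2\bigl(|\mathbb L^\cup_r|+\alpha(u+\nu)\bigr)$$ rounds of communication, and its total communication is at most $$C\cdot\Bigl(2n\log_2\bigl(|\mathbb L^\cup_r|+\alpha(u+\nu)\bigr)+2n\,\alpha(u+\nu)\,(f(r)+g(r))\Bigr)\text{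 words.}$$ -/

import Mathlib

open Filter Topology

namespace LightClient

/-! ### Data, programs and polynomial time -/

/-- Finite binary trees: the data on which programs run. Strings, numbers, lists, transactions,
states, hash values and messages are all represented by such trees. -/
inductive Data where
  | nil : Data
  | cons : Data → Data → Data
  deriving DecidableEq

namespace Data

/-- The number of nodes, leaves included. -/
def size : Data → ℕ
  | nil => 1
  | cons a b => a.size + b.size + 1

def hd : Data → Data
  | nil => nil
  | cons a _ => a

def tl : Data → Data
  | nil => nil
  | cons _ b => b

def ofList : List Data → Data
  | [] => nil
  | a :: l => cons a (ofList l)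

def toList : Data → List Data
  | nil => []
  | cons a b => a :: toList b

/-- The `i`-th entry of a list (`nil` if there is none). -/
def nth (d : Data) (i : ℕ) : Data := d.toList.getD i nil

def ofBool (b : Bool) : Data := if b then cons nil nil else nil

/-- Binary representation, least significant bit first. -/
def ofNat (m : ℕ) : Data := ofList (m.bits.map ofBool)

def toNat : Data → ℕ
  | nil => 0
  | cons b d => 2 * toNat d + (if b = nil then 0 else 1)

/-- The string `1^m`. -/
def unary (m : ℕ) : Data := ofList (List.replicate m nil)

def ofOption : Option Data → Data
  | none => nil
  | some d => cons nil d

end Data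

open Data

/-- Structured programs on binary trees. `loop p` is `while hd x ≠ nil do x := p x`. -/
inductive Prog where
  | id | nil | hd | tl | eq
  | pair (p q : Prog)
  | comp (p q : Prog)
  | ite (c p q : Prog)
  | loop (p : Prog)

/-- `Run p x y t`: on input `x` the program `p` halts with output `y` in exactly `t` steps.
Copying a tree costs its size, so that an output is never larger than the running time. -/
inductive Run : Prog → Data → Data → ℕ → Prop
  | id (x) : Run .id x x x.size
  | nil (x) : Run .nil x .nil 1
  | hd (x) : Run .hd x x.hd x.hd.size
  | tl (x) : Run .tl x x.tl x.tl.size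
  | eq (x) : Run .eq x (ofBool (decide (x.hd = x.tl))) (x.size + 3)
  | pair {p q x y z s t} : Run p x y s → Run q x z t → Run (.pair p q) x (.cons y z) (s + t + 1)
  | comp {p q x y z s t} : Run q x y s → Run p y z t → Run (.comp p q) x z (s + t + 1)
  | ite_true {c p q x b y s t} : Run c x b s → b ≠ .nil → Run p x y t →
      Run (.ite c p q) x y (s + t + 1)
  | ite_false {c p q x y s t} : Run c x .nil s → Run q x y t → Run (.ite c p q) x y (s + t + 1)
  | loop_done {p x} : x.hd = .nil → Run (.loop p) x x x.size
  | loop_step {p x y z s t} : x.hd ≠ .nil → Run p x y s → Run (.loop p) y z t →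
      Run (.loop p) x z (s + t + 1)

/-- `F` is computed by a program whose running time is polynomial in the size of the input. -/
def PolyTime (F : Data → Data) : Prop :=
  ∃ (p : Prog) (b : Polynomial ℕ), ∀ x, ∃ t, t ≤ b.eval x.size ∧ Run p x (F x) t

/-- A probabilistic polynomial-time algorithm: a polynomial-time function of the input and of
polynomially many (in the security parameter) uniform coins. -/
structure PPT where
  next : Data → Data
  polyTime : PolyTime next
  coins : Polynomial ℕ

/-- The coin sequences at security parameter `k`. -/
abbrev PPT.Coins (A : PPT) (k : ℕ) : Type := Fin (A.coins.eval k) → Bool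

def encodeCoins {m : ℕ} (c : Fin m → Bool) : Data := ofList ((List.ofFn c).map ofBool)

def Negligible (e : ℕ → ℝ) : Prop :=
  Asymptotics.SuperpolynomialDecay atTop (fun k : ℕ => (k : ℝ)) e

/-! ### The blockchain, the primitives and their axioms -/

/-- One execution of the underlying consensus protocol. -/
structure World (Party : Type) where
  /-- the public string: hash key, header chain, and so on -/
  pub : Data
  /-- the dirty ledger of an honest party at a round -/
  ledger : Party → ℕ → List Data
  /-- the attempts of honest parties to write a transaction to the ledger -/
  write : Party → ℕ → Data → Prop

open Classical in
/-- The longest dirty ledger held by an honest party at round `r`. -/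
noncomputable def World.union {Party : Type} (ω : World Party) (r : ℕ) : List Data :=
  if h : ∃ P, ∀ Q, (ω.ledger Q r).length ≤ (ω.ledger P r).length then ω.ledger h.choose r else []

/-- `tx'` immediately follows `tx` on `L`, where the empty string is taken to precede the first
transaction (as it does in augmented dirty ledgers). -/
def Follows (L : List Data) (tx tx' : Data) : Prop := [tx, tx'] <:+: (nil :: L)

/-- The lazy blockchain, the cryptographic primitives, and the tournament's parameters. -/
structure System (Party : Type) where
  /-- the distribution of executions, for each security parameter -/
  setup : ℕ → PMF (World Party)
  /-- keyed hash function -/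
  hash : Data → Data → Data
  /-- transition function -/
  δ : Data → Data → Data
  /-- genesis state -/
  st0 : Data
  /-- state commitment -/
  commit : Data → Data → Data
  /-- succinct transition function: commitment, transaction, proof to commitment or error -/
  sδ : Data → Data → Data → Data → Option Data
  /-- the machine that computes proofs for the execution oracle -/
  prove : Data → Data → Data → Data
  /-- answer of the consensus oracle at a round on two transactions, where the last argument is
  what the corrupted provers send during the query -/
  co : Data → ℕ → Data → Data → Data → Bool
  /-- Lipschitz, liveness and delay parameters -/
  α : ℕ
  u : ℕ
  ν : ℕ
  /-- communication complexity of a consensus and of an execution oracle query -/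
  f : ℕ → ℕ
  g : ℕ → ℕ
  /-- word length, number of provers and starting round, for each security parameter -/
  w : ℕ → ℕ
  n : ℕ → ℕ
  r : ℕ → ℕ
  /-- a prover is either corrupted (`none`) or an honest party -/
  role : (k : ℕ) → Fin (n k) → Option Party

namespace System

variable {Party : Type} (S : System Party)

/-- The number of extra entries that the verifier checks. -/
def window : ℕ := S.α * (S.u + S.ν)

/-- The state after the given transactions. -/
def run (L : List Data) : Data := L.foldl S.δ S.st0

/-- The dirty ledger of the `i`-th prover when the tournament starts (`none` if corrupted). -/
def proverLedger (k : ℕ) (ω : World Party) (i : Fin (S.n k)) : Option (List Data) :=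
  (S.role k i).map fun P => ω.ledger P (S.r k)

/-- Everything that is public when the tournament starts: the parameters, the public string, and
who is honest with which ledger. It is the input of all adversaries. -/
def view (k : ℕ) (ω : World Party) : Data :=
  ofList [unary k, unary (S.n k), unary (S.r k), unary (S.w k), unary (S.f (S.r k)),
    unary (S.g (S.r k)), ω.pub,
    ofList (List.ofFn fun i => ofOption ((S.proverLedger k ω i).map ofList))]

/-- Joint distribution of the execution and of the coins of `A`. -/
noncomputable def experiment (A : PPT) (k : ℕ) : PMF (World Party × A.Coins k) :=
  (S.setup k).bind fun ω => (PMF.uniformOfFintype (A.Coins k)).map fun c => (ω, c)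

/-- The probability of an event that depends on the execution and on the coins of `A`. -/
noncomputable def prob (A : PPT) (k : ℕ) (E : World Party → A.Coins k → Prop) : ℝ :=
  ((S.experiment A k).toOuterMeasure {z | E z.1 z.2}).toReal

/-- The output of the adversary in a non-interactive game. -/
def output (A : PPT) (k : ℕ) (ω : World Party) (c : A.Coins k) : Data :=
  A.next (ofList [S.view k ω, encodeCoins c])

/-- A property that holds in all executions. -/
def Always (E : ℕ → World Party → Prop) : Prop := ∀ k, ∀ ω ∈ (S.setup k).support, E k ω

def LedgerSafe : Prop := S.Always fun _ ω =>
  ∀ P₁ P₂ r₁ r₂, r₁ < r₂ → ω.ledger P₁ r₁ <+: ω.ledger P₂ r₂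

def LedgerLive : Prop := S.Always fun _ ω =>
  ∀ P r tx, ω.write P r tx → tx ∈ ω.ledger P (r + S.u)

def LedgerLipschitz : Prop := S.Always fun _ ω =>
  ∀ P r₁ r₂, r₁ < r₂ →
    ((ω.ledger P r₂).length : ℤ) - (ω.ledger P r₁).length < S.α * ((r₂ : ℤ) - r₁)

/-- No duplicate transactions, and no transaction is the empty string. -/
def LedgerUnique : Prop := S.Always fun _ ω => ∀ P r, (nil :: ω.ledger P r).Nodup

def ConsensusComplete : Prop := S.Always fun k ω =>
  ∀ tx tx' π, Follows (ω.union (S.r k)) tx tx' → S.co ω.pub (S.r k) tx tx' π = true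

def ConsensusSound : Prop := ∀ A : PPT, Negligible fun k => S.prob A k fun ω c =>
  S.co ω.pub (S.r k) ((S.output A k ω c).nth 0) ((S.output A k ω c).nth 1)
      ((S.output A k ω c).nth 2) = true ∧
    ¬ Follows (ω.union (S.r k + S.ν)) ((S.output A k ω c).nth 0) ((S.output A k ω c).nth 1)

def ExecutionComplete : Prop := S.Always fun _ ω => ∀ st tx,
  S.sδ ω.pub (S.commit ω.pub st) tx (S.prove ω.pub st tx) = some (S.commit ω.pub (S.δ st tx))

def ExecutionSound : Prop := ∀ A : PPT, Negligible fun k => S.prob A k fun ω c =>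
  ∃ com, S.sδ ω.pub (S.commit ω.pub ((S.output A k ω c).nth 0)) ((S.output A k ω c).nth 1)
      ((S.output A k ω c).nth 2) = some com ∧
    com ≠ S.commit ω.pub (S.δ ((S.output A k ω c).nth 0) ((S.output A k ω c).nth 1))

def CollisionResistant : Prop := ∀ A : PPT, Negligible fun k => S.prob A k fun ω c =>
  (S.output A k ω c).nth 0 ≠ (S.output A k ω c).nth 1 ∧
    S.hash ω.pub ((S.output A k ω c).nth 0) = S.hash ω.pub ((S.output A k ω c).nth 1)

/-- All algorithms run by honest parties are polynomial-time, the state grows at most linearly,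
and what is public has size polynomial in the security parameter. -/
structure Efficient : Prop where
  hash : ∃ F, PolyTime F ∧ ∀ s x, F (ofList [s, x]) = S.hash s x
  δ : ∃ F, PolyTime F ∧ ∀ st tx, F (ofList [st, tx]) = S.δ st tx
  commit : ∃ F, PolyTime F ∧ ∀ s st, F (ofList [s, st]) = S.commit s st
  sδ : ∃ F, PolyTime F ∧ ∀ s com tx π, F (ofList [s, com, tx, π]) = ofOption (S.sδ s com tx π)
  prove : ∃ F, PolyTime F ∧ ∀ s st tx, F (ofList [s, st, tx]) = S.prove s st tx
  co : ∃ F, PolyTime F ∧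
    ∀ s r tx tx' π, F (ofList [s, unary r, tx, tx', π]) = ofBool (S.co s r tx tx' π)
  growth : ∃ c : ℕ, ∀ st tx, (S.δ st tx).size ≤ st.size + c * tx.size
  view : ∃ b : Polynomial ℕ, S.Always fun k ω => (S.view k ω).size ≤ b.eval k

/-- Hash values, state commitments, transactions and ledger lengths fit into a word, and the
proofs of the execution oracle into `g r` words; oracle queries are not free. -/
structure ConstantSize : Prop where
  hash : S.Always fun k ω => ∀ x, (S.hash ω.pub x).size ≤ S.w k
  commit : S.Always fun k ω => ∀ st, (S.commit ω.pub st).size ≤ S.w k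
  tx : S.Always fun k ω => ∀ P, ∀ tx ∈ ω.ledger P (S.r k), tx.size ≤ S.w k
  length : S.Always fun k ω => ∀ P, (ofNat ((ω.ledger P (S.r k)).length + 1)).size ≤ S.w k
  proof : S.Always fun k ω => ∀ P L tx, L ++ [tx] <+: ω.ledger P (S.r k) →
    (S.prove ω.pub (S.run L) tx).size ≤ S.g (S.r k) * S.w k
  query : ∀ k, 1 ≤ S.f (S.r k) + S.g (S.r k)

end System

/-! ### Merkle mountain ranges -/

/-- With `D i` as the `i`-th leaf, the node of height `a` above the leaves
`j * 2 ^ a, …, (j + 1) * 2 ^ a - 1`. -/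
def node (H : Data → Data) (D : ℕ → Data) : ℕ → ℕ → Data
  | 0, j => H (D j)
  | a + 1, j => H (cons (node H D a (2 * j)) (node H D a (2 * j + 1)))

/-- The heights of the trees of a mountain range with `l` leaves, in decreasing order. -/
def heights (l : ℕ) : List ℕ := l.bitIndices.reverse

/-- The tree of height `a` of a mountain range with `l` leaves starts at leaf
`2 ^ a * peakPos l a`. -/
def peakPos (l a : ℕ) : ℕ := 2 * (l / 2 ^ (a + 1))

def peaks (H : Data → Data) (D : ℕ → Data) (l : ℕ) : List Data :=
  (heights l).map fun a => node H D a (peakPos l a)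

def siblingPos (j : ℕ) : ℕ := if j % 2 = 0 then j + 1 else j - 1

/-- The siblings on the way from leaf `i` up to height `a`. -/
def merklePath (H : Data → Data) (D : ℕ → Data) (a i : ℕ) : List Data :=
  (List.range a).map fun s => node H D s (siblingPos (i / 2 ^ s))

/-- The height of the tree that contains leaf `i` in a mountain range with `l` leaves. -/
def heightAt (l i : ℕ) : ℕ := ((heights l).find? fun a => i / 2 ^ a = peakPos l a).getD 0

/-- The root that a Merkle proof leads to from the node `h` at position `j`. -/
def pathRoot (H : Data → Data) : Data → ℕ → List Data → Data
  | h, _, [] => h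
  | h, j, s :: l => pathRoot H (if j % 2 = 0 then H (cons h s) else H (cons s h)) (j / 2) l

/-- The verification of a Merkle proof for `e` as leaf `i` of a mountain range with `l` leaves. -/
def merkleVerify (H : Data → Data) (l : ℕ) (pk : List Data) (i : ℕ) (e : Data)
    (path : List Data) : Bool :=
  ((heights l).zip pk).any fun z =>
    decide (i / 2 ^ z.1 = peakPos l z.1) && decide (path.length = z.1) &&
      decide (pathRoot H (H e) i path = z.2)

/-! ### The tournament -/

/-- What a single tournament depends on. -/
structure Setting where
  hash : Data → Data
  δ : Data → Data → Data
  st0 : Data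
  commit : Data → Data
  sδ : Data → Data → Data → Option Data
  prove : Data → Data → Data
  co : Data → Data → Data → Bool
  window : ℕ
  f : ℕ
  g : ℕ
  n : ℕ
  /-- ledgers of the honest provers -/
  ledger : Fin n → Option (List Data)
  /-- the message of the adversary, given how many words may be sent, the transcript so far and
  the current request -/
  adv : ℕ → Data → Data → Data

/-- The requests of the verifier. -/
inductive Query where
  /-- claim a size -/
  | size
  /-- send peaks, last entry and its Merkle proof -/
  | claim
  /-- as a challenger, react to the size and peaks of the responder: name a peak, or start the
  suffix monologue -/
  | move (l : ℕ) (pk : List Data)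
  /-- present `m` entries from index `i` on -/
  | suffix (i m : ℕ)
  /-- open the node of height `a + 1` at position `j` -/
  | children (a j : ℕ)
  /-- as a challenger, pick one of these children (of height `a`) of the responder's node at
  position `j` -/
  | pick (a j : ℕ) (hl hr : Data)
  /-- reveal leaf `j`, and leaf `j - 1` with a Merkle proof -/
  | leaf (j : ℕ)

def Query.encode : Query → Data
  | size => ofList [unary 0]
  | claim => ofList [unary 1]
  | move l pk => ofList [unary 2, ofNat l, ofList pk]
  | suffix i m => ofList [unary 3, ofNat i, ofNat m]
  | children a j => ofList [unary 4, ofNat a, ofNat j]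
  | pick a j hl hr => ofList [unary 5, ofNat a, ofNat j, hl, hr]
  | leaf j => ofList [unary 6, ofNat j]

/-- Transcript (latest message first), number of communication rounds, and total communication in
words. -/
structure Log where
  transcript : List Data
  rounds : ℕ
  words : ℕ

/-- A prover's claim that the verifier has accepted for the time being. -/
structure Claim (n : ℕ) where
  prover : Fin n
  size : ℕ
  peaks : List Data
  last : Data

inductive Outcome (n : ℕ) where
  | challengerLoses
  | responderLoses
  /-- both win, and the challenger has made a valid claim -/
  | nested (c : Claim n)

namespace Setting

variable (I : Setting)

/-! #### Honest provers -/

/-- The `i`-th state of the ledger `L`. -/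
def state (L : List Data) (i : ℕ) : Data := (L.take i).foldl I.δ I.st0

/-- The transaction of the `i`-th entry of the augmented dirty ledger. -/
def txAt (L : List Data) (i : ℕ) : Data := (nil :: L).getD i nil

/-- The `i`-th entry of the augmented dirty ledger: transaction and state commitment. -/
def entry (L : List Data) (i : ℕ) : Data := cons (txAt L i) (I.commit (I.state L i))

/-- Leaf `i` with what the oracles ask for: no message is needed for the consensus oracle, whose
answer does not depend on messages if the transactions do follow each other. -/
def justify (L : List Data) (i : ℕ) : Data :=
  ofList [I.entry L i, nil, I.prove (I.state L (i - 1)) (txAt L i)]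

/-- The messages of an honest prover with dirty ledger `L`. -/
def honest (L : List Data) : Query → Data
  | .size => ofNat (L.length + 1)
  | .claim => ofList [ofList (peaks I.hash (I.entry L) (L.length + 1)), I.entry L L.length,
      ofList (merklePath I.hash (I.entry L) (heightAt (L.length + 1) L.length) L.length)]
  | .move l pk =>
      match ((heights l).zip pk).findIdx? fun z =>
          decide (node I.hash (I.entry L) z.1 (peakPos l z.1) ≠ z.2) with
      | none => cons nil nil
      | some i => cons (cons nil nil) (ofNat i)
  | .suffix i m => ofList ((List.range m).map fun s => I.justify L (i + s))
  | .children a j => cons (node I.hash (I.entry L) a (2 * j)) (node I.hash (I.entry L) a (2 * j + 1))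
  | .pick a j hl _ => cons nil (ofBool (decide (node I.hash (I.entry L) a (2 * j) = hl)))
  | .leaf j => cons (I.entry L (j - 1)) (cons
      (ofList (merklePath I.hash (I.entry L) (heightAt (L.length + 1) (j - 1)) (j - 1)))
      (I.justify L j))

/-! #### The verifier -/

/-- Send a request to prover `p`. The exchange counts as `rounds` rounds and as `words` words, in
both directions together and including the oracle queries that it settles. -/
def ask (p : Fin I.n) (q : Query) (rounds words : ℕ) : StateM Log Data := do
  let s ← get
  let m := match I.ledger p with
    | some L => I.honest L q
    | none => I.adv words (ofList s.transcript) (ofList [ofNat p, q.encode])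
  set (Log.mk (ofList [ofNat p, q.encode, m] :: s.transcript) (s.rounds + rounds) (s.words + words))
  return m

/-- The check of a transition from entry `e` to the first entry of `d`, with the consensus and the
execution oracle. -/
def validStep (e d : Data) : Bool :=
  I.co e.hd (d.nth 0).hd (d.nth 1) &&
    decide (I.sδ e.tl (d.nth 0).hd (d.nth 2) = some (d.nth 0).tl)

/-- The check of a suffix that starts after entry `e`. -/
def validChain : Data → List Data → Bool
  | _, [] => true
  | e, d :: l => I.validStep e d && validChain (d.nth 0) l

/-- The last entry of a suffix that starts after entry `e`. -/
def lastEntry (e : Data) (l : List Data) : Data := (l.map fun d => d.nth 0).getLastD e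

/-- Obtain from prover `p` the peaks for the size `l`, the last entry, and its Merkle proof. -/
def getClaim (p : Fin I.n) (l rounds : ℕ) : StateM Log (Option (Claim I.n)) := do
  let m ← I.ask p .claim rounds ((heights l).length + 2 + heightAt l (l - 1))
  if 1 ≤ l ∧ (m.nth 0).toList.length = (heights l).length ∧
      merkleVerify I.hash l (m.nth 0).toList (l - 1) (m.nth 1) (m.nth 2).toList = true then
    return some ⟨p, l, (m.nth 0).toList, m.nth 1⟩
  else
    return none

/-- The check of a revealed leaf `j` whose hash must be `h`. -/
def leafOk (c : Claim I.n) (j : ℕ) (h m : Data) : Bool :=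
  decide (m ≠ nil) && decide (I.hash (m.nth 2) = h) &&
    if j = 0 then decide (m.nth 2 = cons nil (I.commit I.st0))
    else merkleVerify I.hash c.size c.peaks (j - 1) (m.nth 0) (m.nth 1).toList &&
      I.validStep (m.nth 0) m.tl.tl

/-- The bisection game below the responder's node `h` of height `a` at position `j`; returns
whether the responder wins. -/
def bisect (p : Fin I.n) (c : Claim I.n) : ℕ → ℕ → Data → StateM Log Bool
  | 0, j, h => do
      let m ← I.ask c.prover (.leaf j) 0 (4 + Nat.log 2 c.size + I.f + I.g)
      return I.leafOk c j h m
  | a + 1, j, h => do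
      let m ← I.ask c.prover (.children a j) 0 3
      if m = nil ∨ I.hash (cons m.hd m.tl) ≠ h then
        return false
      else
        let b ← I.ask p (.pick a j m.hd m.tl) 1 3
        if b = nil then
          return true
        else if b.tl = nil then
          bisect p c a (2 * j) m.hd
        else
          bisect p c a (2 * j + 1) m.tl

/-- The suffix monologue of the challenger `p`, who claims the size `l`. -/
def monologue (p : Fin I.n) (l : ℕ) (c : Claim I.n) : StateM Log (Outcome I.n) := do
  let m := min (l - c.size) I.window
  let d ← I.ask p (.suffix c.size m) 0 (m * (2 + I.f + I.g))
  if d.toList.length ≠ m ∨ I.validChain c.last d.toList = false then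
    return .challengerLoses
  else if I.window < l - c.size then
    return .responderLoses
  else
    match ← I.getClaim p l 0 with
    | none => return .challengerLoses
    | some c' =>
      if c'.last = lastEntry c.last d.toList ∧ (l = c.size → c'.peaks = c.peaks) then
        return .nested c'
      else
        return .challengerLoses

/-- The challenge game between the challenger `p`, who claims the size `l`, and the responder who
has made the claim `c`. -/
def challenge (p : Fin I.n) (l : ℕ) (c : Claim I.n) : StateM Log (Outcome I.n) := do
  let m ← I.ask p (.move c.size c.peaks) 1 (c.peaks.length + 3)
  if m = nil then
    return .challengerLoses
  else if m.hd = nil then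
    I.monologue p l c
  else
    match ((heights c.size).zip c.peaks)[m.tl.toNat]? with
    | none => return .challengerLoses
    | some z =>
      if ← I.bisect p c z.1 (peakPos c.size z.1) z.2 then
        return .challengerLoses
      else
        return .responderLoses

/-- One step of the tournament: prover `p` plays against the largest remaining claim until the
latter does not lose or no claim remains. Claims are kept in decreasing order of size. -/
def step (p : Fin I.n) (l : ℕ) : List (Claim I.n) → StateM Log (List (Claim I.n))
  | [] => do
      match ← I.getClaim p l 1 with
      | none => return []
      | some c => return [c]
  | c :: s => do
      match ← I.challenge p l c with
      | .challengerLoses => return c :: s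
      | .responderLoses => step p l s
      | .nested c' => return c' :: c :: s

/-- The tournament: sizes are requested in one round, and the provers enter in increasing order of
size. Returns the winner. -/
def tournament : StateM Log (Option (Claim I.n)) := do
  let sizes ← (List.finRange I.n).mapM fun p => do
    let m ← I.ask p .size 0 1
    return (p, m.toNat)
  modify fun s => { s with rounds := s.rounds + 1 }
  let s ← (sizes.insertionSort fun x y => x.2 ≤ y.2).foldlM (fun s x => I.step x.1 x.2 s) []
  return s.head?

/-- The log at the end of the tournament. -/
def finalLog : Log := (I.tournament.run ⟨[], 0, 0⟩).2

end Setting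

/-- The tournament at security parameter `k` in the execution `ω` against the adversary `A` with
coins `c`. The adversary controls all corrupted provers and sees all messages. A message longer
than its allotted number of words is dropped (with a margin of 4 nodes per word for the list
structure, so that well-formed messages always fit). -/
def System.setting {Party : Type} (S : System Party) (A : PPT) (k : ℕ) (ω : World Party)
    (c : A.Coins k) : Setting where
  hash := S.hash ω.pub
  δ := S.δ
  st0 := S.st0
  commit := S.commit ω.pub
  sδ := S.sδ ω.pub
  prove := S.prove ω.pub
  co := S.co ω.pub (S.r k)
  window := S.window
  f := S.f (S.r k)
  g := S.g (S.r k)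
  n := S.n k
  ledger := S.proverLedger k ω
  adv := fun words transcript query =>
    let m := A.next (ofList [S.view k ω, encodeCoins c, transcript, query])
    if m.size ≤ words * (S.w k + 4) then m else nil

end LightClient

namespace LightClient

open Data

-- The proof separates a deterministic analysis of one run from a reduction which shows that the
-- hypotheses of that analysis fail only with negligible probability.
--
-- Deterministic part. Fix an honest prover with ledger `L` and consider all subtrees of the
-- transcript. The run is unforged (`Setting.Unforged`) if they yield no hash collision, no accepted
-- wrong successor of a transaction of `L`, no accepted wrong transition from a state of `L`, and if
-- every chain of accepted transactions that starts at the end of `L` has fewer than `α (u + ν)`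
-- links. In such a run the honest prover never loses. As a challenger it steers the bisection to
-- the first disagreement: the leaf before it can only be opened honestly, so soundness of the two
-- oracles determines the disputed leaf, and the responder fails (`bisect_challenger`). If all peaks
-- agree, the responder's last entry is honest and the honest suffix is accepted. As a responder it
-- passes all checks of the bisection by completeness (`bisect_responder`), and a monologue that
-- beats it would contain too long an accepted chain (`monologue_spec`).
--
-- Therefore every game involves a responder of size at most `|L| + α (u + ν)`: until the honest
-- prover has entered, claims have size at most `|L| + 1`; afterwards its claim stays in the stack,
-- and everything above it continues `L` by an accepted chain. So a game takes at most `log + 1`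
-- rounds, with `log` the binary logarithm of that bound. Costs are amortized by letting each claim
-- in the stack carry the price of one game (`Cost`): a responder that loses is removed and pays for
-- its game, a game that ends in nesting takes one round and adds one claim, and each entering
-- prover loses at most once. This gives `log + 2` rounds per prover (`tournament_spec`), and
-- `log_add_two_le` compares this with `2 log₂`.
--
-- Probabilistic part. The whole tournament, honest provers included, can be simulated in polynomial
-- time from the public view and the coins (`Feasible.eff_transcript`). Hence a polynomial-time
-- search through the transcript turns a non-negligible probability of a forgery into an adversary
-- against one of the assumptions (`Rare.search`). Collisions and wrong transitions can be
-- recognized by the search. For the consensus oracle this is impossible, because correctness refers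
-- to the ledger `U` of the later round `r + ν`. The search therefore outputs the first accepted
-- candidate, and soundness says that it follows its predecessor on `U` except with negligible
-- probability. Since `U` has no duplicates, successors are unique, and a chain of accepted
-- transactions simply walks along `U` (`chainTx_succ`). Safety and the Lipschitz property give `|U|
-- < |L| + α (u + ν)` (`length_union_lt`), which bounds the chain. Only `α (u + ν)` links have to be
-- considered, a number independent of the security parameter, so finitely many reductions suffice.
--
-- Much of the length comes from the simulation: polynomial time is defined by programs on trees,
-- sizes are claimed in binary and may be exponentially large, and the sizes of all messages and
-- states must be bounded uniformly over the run.

attribute [fun_prop] PolyTime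

/-! ### Closure properties of polynomial time -/

/-- Every rule charges at least the size of what it produces. A time bound is thus an output bound,
and this is what keeps compositions polynomial. -/
theorem Run.size_le {p : Prog} {x y : Data} {t : ℕ} (h : Run p x y t) : y.size ≤ t := by
  induction h with
  | id | hd | tl | loop_done => exact le_rfl
  | nil => simp [size]
  | eq x =>
    by_cases h : x.hd = x.tl <;> simp [ofBool, size, h]
  | pair _ _ h₁ h₂ => simp only [size]; omega
  | comp _ _ _ h | loop_step _ _ _ _ h => omega
  | ite_true _ _ _ _ h | ite_false _ _ _ h => omega

theorem eval_nat_mono (b : Polynomial ℕ) : Monotone fun n : ℕ => b.eval n := by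
  intro m n h
  induction b using Polynomial.induction_on' with
  | add p q hp hq => simp only [Polynomial.eval_add]; exact add_le_add hp hq
  | monomial k a => simp only [Polynomial.eval_monomial]; gcongr

/-- A quantity bounded by a polynomial in the size of the input. -/
def PolyBound (m : Data → ℕ) : Prop := ∃ b : Polynomial ℕ, ∀ x, m x ≤ b.eval x.size

namespace PolyBound

theorem of_le {m m' : Data → ℕ} (h : PolyBound m) (hm : ∀ x, m' x ≤ m x) : PolyBound m' := by
  obtain ⟨b, hb⟩ := h
  exact ⟨b, fun x => (hm x).trans (hb x)⟩

theorem const (c : ℕ) : PolyBound fun _ => c := ⟨Polynomial.C c, fun _ => by simp⟩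

theorem size : PolyBound Data.size := ⟨Polynomial.X, fun _ => by simp⟩

theorem add {m m' : Data → ℕ} (h : PolyBound m) (h' : PolyBound m') :
    PolyBound fun x => m x + m' x := by
  obtain ⟨b, hb⟩ := h
  obtain ⟨b', hb'⟩ := h'
  exact ⟨b + b', fun x => by rw [Polynomial.eval_add]; exact add_le_add (hb x) (hb' x)⟩

theorem mul {m m' : Data → ℕ} (h : PolyBound m) (h' : PolyBound m') :
    PolyBound fun x => m x * m' x := by
  obtain ⟨b, hb⟩ := h
  obtain ⟨b', hb'⟩ := h'
  exact ⟨b * b', fun x => by rw [Polynomial.eval_mul]; exact Nat.mul_le_mul (hb x) (hb' x)⟩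

theorem eval (b : Polynomial ℕ) {m : Data → ℕ} (h : PolyBound m) :
    PolyBound fun x => b.eval (m x) := by
  obtain ⟨b', hb'⟩ := h
  exact ⟨b.comp b', fun x => by rw [Polynomial.eval_comp]; exact eval_nat_mono b (hb' x)⟩

end PolyBound

namespace PolyTime

theorem bound {F : Data → Data} (h : PolyTime F) : PolyBound fun x => (F x).size := by
  obtain ⟨p, b, h⟩ := h
  refine ⟨b, fun x => ?_⟩
  obtain ⟨t, ht, hr⟩ := h x
  exact hr.size_le.trans ht

theorem congr {F G : Data → Data} (h : PolyTime F) (hFG : ∀ x, F x = G x) : PolyTime G :=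
  funext hFG ▸ h

theorem of_polyBound {F : Data → Data} (p : Prog) {m : Data → ℕ} (hm : PolyBound m)
    (h : ∀ x, ∃ t, t ≤ m x ∧ Run p x (F x) t) : PolyTime F := by
  obtain ⟨b, hb⟩ := hm
  refine ⟨p, b, fun x => ?_⟩
  obtain ⟨t, ht, hr⟩ := h x
  exact ⟨t, ht.trans (hb x), hr⟩

@[fun_prop]
theorem id : PolyTime fun x => x :=
  of_polyBound .id PolyBound.size fun x => ⟨_, le_rfl, .id x⟩

theorem comp' {F G : Data → Data} (hF : PolyTime F) (hG : PolyTime G) :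
    PolyTime fun x => F (G x) := by
  obtain ⟨p, b, hp⟩ := hF
  have hG' := hG.bound
  obtain ⟨q, b', hq⟩ := hG
  refine of_polyBound (.comp p q)
    (((PolyBound.eval b' PolyBound.size).add (PolyBound.eval b hG')).add (.const 1)) fun x => ?_
  obtain ⟨s, hs, hs'⟩ := hq x
  obtain ⟨t, ht, ht'⟩ := hp (G x)
  exact ⟨s + t + 1, by omega, .comp hs' ht'⟩

@[fun_prop]
theorem comp {F G : Data → Data} (hF : PolyTime F) (hG : PolyTime G) :
    PolyTime fun x => F (G x) := comp' hF hG

@[fun_prop]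
theorem hd {F : Data → Data} (hF : PolyTime F) : PolyTime fun x => (F x).hd := by
  refine comp' (F := Data.hd) (of_polyBound .hd PolyBound.size fun x => ⟨_, ?_, .hd x⟩) hF
  cases x <;> simp [Data.hd, Data.size]; omega

@[fun_prop]
theorem tl {F : Data → Data} (hF : PolyTime F) : PolyTime fun x => (F x).tl := by
  refine comp' (F := Data.tl) (of_polyBound .tl PolyBound.size fun x => ⟨_, ?_, .tl x⟩) hF
  cases x <;> simp [Data.tl, Data.size]; omega

@[fun_prop]
theorem cons {F G : Data → Data} (hF : PolyTime F) (hG : PolyTime G) :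
    PolyTime fun x => Data.cons (F x) (G x) := by
  obtain ⟨p, b, hp⟩ := hF
  obtain ⟨q, b', hq⟩ := hG
  refine of_polyBound (.pair p q)
    (((PolyBound.eval b PolyBound.size).add (PolyBound.eval b' PolyBound.size)).add (.const 1))
    fun x => ?_
  obtain ⟨s, hs, hs'⟩ := hp x
  obtain ⟨t, ht, ht'⟩ := hq x
  exact ⟨s + t + 1, by omega, .pair hs' ht'⟩

@[fun_prop]
theorem const (d : Data) : PolyTime fun _ => d := by
  induction d with
  | nil => exact of_polyBound .nil (.const 1) fun x => ⟨_, le_rfl, .nil x⟩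
  | cons a b ha hb => exact ha.cons hb

open Classical in
@[fun_prop]
theorem ite {C F G : Data → Data} (hC : PolyTime C) (hF : PolyTime F) (hG : PolyTime G) :
    PolyTime fun x => if C x = Data.nil then F x else G x := by
  obtain ⟨c, b₀, hc⟩ := hC
  obtain ⟨p, b, hp⟩ := hF
  obtain ⟨q, b', hq⟩ := hG
  refine of_polyBound (.ite c q p)
    ((((PolyBound.eval b₀ PolyBound.size).add (PolyBound.eval b PolyBound.size)).add
      (PolyBound.eval b' PolyBound.size)).add (.const 1)) fun x => ?_
  obtain ⟨r, hr, hr'⟩ := hc x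
  obtain ⟨s, hs, hs'⟩ := hp x
  obtain ⟨t, ht, ht'⟩ := hq x
  by_cases h : C x = Data.nil
  · rw [if_pos h]
    exact ⟨r + s + 1, by omega, .ite_false (h ▸ hr') hs'⟩
  · rw [if_neg h]
    exact ⟨r + t + 1, by omega, .ite_true hr' h ht'⟩

theorem eq' {F G : Data → Data} (hF : PolyTime F) (hG : PolyTime G) :
    PolyTime fun x => ofBool (decide (F x = G x)) := by
  refine comp' (F := fun x => ofBool (decide (x.hd = x.tl))) (of_polyBound .eq
    (PolyBound.size.add (.const 3)) fun x => ⟨_, le_rfl, .eq x⟩) (hF.cons hG)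

/-- A polynomial-time body alone does not make a loop polynomial, since a state may double in every
round. Both the number `T` of rounds and a bound `B` for all intermediate states have to be
supplied. -/
theorem iterate {F G Z : Data → Data} (hF : PolyTime F) (hZ : PolyTime Z) {T B : Data → ℕ}
    (hT : PolyBound T) (hB : PolyBound B) (h₁ : ∀ x, ∀ i < T x, (F^[i] (Z x)).hd ≠ Data.nil)
    (h₂ : ∀ x, (F^[T x] (Z x)).hd = Data.nil) (h₃ : ∀ x, ∀ i ≤ T x, (F^[i] (Z x)).size ≤ B x)
    (h₄ : ∀ x, F^[T x] (Z x) = G x) : PolyTime G := by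
  obtain ⟨p, b, hp⟩ := hF
  obtain ⟨q, b', hq⟩ := hZ
  refine of_polyBound (.comp (.loop p) q)
    (((hT.mul ((PolyBound.eval b hB).add (.const 1))).add hB).add
      ((PolyBound.eval b' PolyBound.size).add (.const 1))) fun x => ?_
  -- Induction on the number `j` of remaining rounds, since a run of a loop is assembled from its
  -- last round backwards.
  have key : ∀ j ≤ T x, ∃ t, t ≤ j * (b.eval (B x) + 1) + B x ∧
      Run (.loop p) (F^[T x - j] (Z x)) (F^[T x] (Z x)) t := by
    intro j
    induction j with
    | zero => exact fun _ => ⟨_, by simpa using h₃ x _ le_rfl, .loop_done (h₂ x)⟩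
    | succ j ih =>
      intro hj
      obtain ⟨t, ht, hr⟩ := ih (by omega)
      obtain ⟨s, hs, hr'⟩ := hp (F^[T x - (j + 1)] (Z x))
      rw [← Function.iterate_succ_apply' F, show (T x - (j + 1)).succ = T x - j by omega] at hr'
      refine ⟨s + t + 1, ?_, .loop_step (h₁ x _ (by omega)) hr' hr⟩
      have := hs.trans (eval_nat_mono b (h₃ x (T x - (j + 1)) (by omega)))
      rw [add_mul]
      dsimp only at this
      omega
  obtain ⟨t, ht, hr⟩ := key (T x) le_rfl
  obtain ⟨s, hs, hr'⟩ := hq x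
  rw [Nat.sub_self, h₄] at hr
  exact ⟨s + t + 1, by omega, .comp hr' hr⟩

end PolyTime

namespace Data

@[simp] theorem hd_cons (a b : Data) : (cons a b).hd = a := rfl
@[simp] theorem tl_cons (a b : Data) : (cons a b).tl = b := rfl
@[simp] theorem hd_nil : nil.hd = nil := rfl
@[simp] theorem tl_nil : nil.tl = nil := rfl
@[simp] theorem size_nil : nil.size = 1 := rfl
@[simp] theorem size_cons (a b : Data) : (cons a b).size = a.size + b.size + 1 := rfl
@[simp] theorem toList_nil : nil.toList = [] := rfl
@[simp] theorem toList_cons (a b : Data) : (cons a b).toList = a :: b.toList := rfl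
@[simp] theorem ofList_nil : ofList [] = nil := rfl
@[simp] theorem ofList_cons (a : Data) (l : List Data) : ofList (a :: l) = cons a (ofList l) := rfl

@[simp] theorem toList_ofList (l : List Data) : (ofList l).toList = l := by
  induction l with
  | nil => rfl
  | cons a l ih => simp [ih]

@[simp] theorem ofList_toList (d : Data) : ofList d.toList = d := by
  induction d with
  | nil => rfl
  | cons a b _ ih => simp [ih]

theorem ofList_injective : Function.Injective ofList :=
  Function.LeftInverse.injective toList_ofList

theorem size_pos (d : Data) : 0 < d.size := by cases d <;> simp

theorem size_hd_le (d : Data) : d.hd.size ≤ d.size := by cases d <;> simp; omega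

theorem size_tl_le (d : Data) : d.tl.size ≤ d.size := by cases d <;> simp; omega

theorem length_toList_lt (d : Data) : d.toList.length < d.size := by
  induction d with
  | nil => simp
  | cons a b _ ih => simp; omega

theorem size_le_of_mem_toList {d e : Data} (h : e ∈ d.toList) : e.size ≤ d.size := by
  induction d with
  | nil => simp at h
  | cons a b _ ih =>
    rcases List.mem_cons.1 h with rfl | h
    · simp; omega
    · have := ih h; simp; omega

theorem size_ofList_le {l : List Data} {m : ℕ} (h : ∀ d ∈ l, d.size ≤ m) :
    (ofList l).size ≤ l.length * (m + 1) + 1 := by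
  induction l with
  | nil => simp
  | cons a l ih =>
    have h₁ := h a (by simp)
    have h₂ := ih fun d hd => h d (by simp [hd])
    simp only [ofList_cons, size_cons, List.length_cons, add_mul]
    omega

theorem size_ofList_append (l₁ l₂ : List Data) :
    (ofList (l₁ ++ l₂)).size + 1 = (ofList l₁).size + (ofList l₂).size := by
  induction l₁ with
  | nil => simp; omega
  | cons a l ih => simp only [List.cons_append, ofList_cons, size_cons]; omega

theorem size_ofList_le_of_prefix {l₁ l₂ : List Data} (h : l₁ <+: l₂) :
    (ofList l₁).size ≤ (ofList l₂).size := by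
  obtain ⟨l, rfl⟩ := h
  have := size_ofList_append l₁ l
  have := size_pos (ofList l)
  omega

/-- The truth value of a proposition, as data. -/
def ofProp (p : Prop) [Decidable p] : Data := ofBool (decide p)

@[simp] theorem ofBool_true : ofBool true = cons nil nil := rfl
@[simp] theorem ofBool_false : ofBool false = nil := rfl

@[simp] theorem ofBool_eq_nil (b : Bool) : ofBool b = nil ↔ b = false := by cases b <;> simp

/-- Conditional on data, where `nil` is false. -/
def cond (c a b : Data) : Data := if c = nil then b else a

@[simp] theorem cond_nil (a b : Data) : cond nil a b = b := rfl
@[simp] theorem cond_cons (c d a b : Data) : cond (cons c d) a b = a := rfl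
theorem cond_of_ne {c : Data} (h : c ≠ nil) (a b : Data) : cond c a b = a := if_neg h
@[simp] theorem cond_ofBool (c : Bool) (a b : Data) :
    cond (ofBool c) a b = if c = true then a else b := by cases c <;> rfl
@[simp] theorem cond_ofProp (p : Prop) [Decidable p] (a b : Data) :
    cond (ofProp p) a b = if p then a else b := by simp [ofProp]

/-- Fold over the entries of a list, with a parameter. -/
def fold (f : Data → Data → Data → Data) (x l s : Data) : Data := l.toList.foldl (f x) s

end Data

namespace PolyTime

@[fun_prop]
theorem cond {C F G : Data → Data} (hC : PolyTime C) (hF : PolyTime F) (hG : PolyTime G) :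
    PolyTime fun x => Data.cond (C x) (F x) (G x) := by
  unfold Data.cond
  simpa using ite hC hG hF

@[fun_prop]
theorem ofProp_eq {F G : Data → Data} (hF : PolyTime F) (hG : PolyTime G) :
    PolyTime fun x => ofProp (F x = G x) := eq' hF hG

/-- The loop state consists of the remaining list, the parameter and the accumulator. As the loop
tests the head of its state, it stops exactly when the list is used up. -/
theorem fold {f : Data → Data → Data → Data} {X L Z : Data → Data} {B : Data → ℕ}
    (hf : PolyTime fun y => f y.hd y.tl.hd y.tl.tl) (hX : PolyTime X) (hL : PolyTime L)
    (hZ : PolyTime Z) (hB : PolyBound B)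
    (h : ∀ y, ∀ l, l <+: (L y).toList → (l.foldl (f (X y)) (Z y)).size ≤ B y) :
    PolyTime fun y => Data.fold f (X y) (L y) (Z y) := by
  let F : Data → Data := fun s =>
    Data.cons s.hd.tl (Data.cons s.tl.hd (f s.tl.hd s.tl.tl s.hd.hd))
  have hF : PolyTime F := by
    have : PolyTime fun s : Data => f s.tl.hd s.tl.tl s.hd.hd :=
      comp' hf (G := fun s => Data.cons s.tl.hd (Data.cons s.tl.tl s.hd.hd)) (by fun_prop)
    exact .cons (by fun_prop) (.cons (by fun_prop) this)
  have hit : ∀ y i, i ≤ (L y).toList.length →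
      F^[i] (Data.cons (L y) (Data.cons (X y) (Z y))) =
        Data.cons (ofList ((L y).toList.drop i)) (Data.cons (X y)
          (((L y).toList.take i).foldl (f (X y)) (Z y))) := by
    intro y i hi
    induction i with
    | zero => simp
    | succ i ih =>
      rw [Function.iterate_succ_apply', ih (by omega), List.drop_eq_getElem_cons (by omega),
        List.take_succ_eq_append_getElem (by omega), List.foldl_append]
      rfl
  have hLb : PolyBound fun y => (L y).toList.length :=
    hL.bound.of_le fun y => (length_toList_lt _).le
  refine comp' (F := fun s : Data => s.tl.tl) (by fun_prop)
    (G := fun y => F^[(L y).toList.length] (Data.cons (L y) (Data.cons (X y) (Z y)))) ?_ |>.congr ?_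
  · refine iterate hF (hL.cons (hX.cons hZ)) hLb
      ((hL.bound.add (hX.bound.add hB)).add (.const 2)) ?_ ?_ ?_ (fun _ => rfl)
    · intro y i hi
      rw [hit y i hi.le, List.drop_eq_getElem_cons hi]
      exact fun h => Data.noConfusion h
    · intro y
      rw [hit y _ le_rfl]
      simp
    · intro y i hi
      rw [hit y i hi]
      have h₁ := h y _ (List.take_prefix i _)
      have h₂ : (ofList ((L y).toList.drop i)).size ≤ (L y).size := by
        have := size_ofList_append ((L y).toList.take i) ((L y).toList.drop i)
        rw [List.take_append_drop, ofList_toList] at this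
        have := size_pos (ofList ((L y).toList.take i))
        omega
      simp only [size_cons]
      omega
  · intro y
    rw [hit y _ le_rfl]
    simp [Data.fold]

/-- A fold whose steps increase the size of the state by a bounded amount. -/
theorem fold_add {f : Data → Data → Data → Data} {X L Z : Data → Data} {g : Data → ℕ}
    (hf : PolyTime fun y => f y.hd y.tl.hd y.tl.tl) (hg : PolyBound g)
    (h : ∀ x s e, (f x s e).size ≤ s.size + g (Data.cons x e))
    (hX : PolyTime X) (hL : PolyTime L) (hZ : PolyTime Z) :
    PolyTime fun y => Data.fold f (X y) (L y) (Z y) := by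
  obtain ⟨b, hb⟩ := hg
  refine fold hf hX hL hZ (B := fun y => (Z y).size +
    (L y).size * b.eval ((X y).size + (L y).size + 1)) (hZ.bound.add (hL.bound.mul
      (PolyBound.eval b ((hX.bound.add hL.bound).add (.const 1))))) fun y l hl => ?_
  -- The increment depends on the parameter and the entry but not on the accumulator, so the
  -- increments add up instead of compounding.
  have key : ∀ l : List Data, (∀ e ∈ l, e.size ≤ (L y).size) → ∀ s, (l.foldl (f (X y)) s).size ≤
      s.size + l.length * b.eval ((X y).size + (L y).size + 1) := by
    intro l
    induction l with
    | nil => simp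
    | cons e l ih =>
      intro he s
      have h₁ := ih (fun e' h' => he e' (by simp [h'])) (f (X y) s e)
      have h₂ := h (X y) s e
      have h₃ := (hb (Data.cons (X y) e)).trans (eval_nat_mono b
        (show _ ≤ (X y).size + (L y).size + 1 by have := he e (by simp); simp; omega))
      simp only [List.foldl_cons, List.length_cons, add_mul]
      dsimp only at h₃
      omega
  refine (key l (fun e he => size_le_of_mem_toList (hl.subset he)) _).trans ?_
  have := hl.length_le.trans (length_toList_lt (L y)).le
  gcongr

end PolyTime


/-! ### Polynomial-time functions on lists -/

namespace Data

theorem toList_eq_nil {d : Data} : d.toList = [] ↔ d = nil := by cases d <;> simp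

@[simp] theorem toList_tl (d : Data) : d.tl.toList = d.toList.tail := by cases d <;> simp

theorem hd_eq_getD (d : Data) : d.hd = d.toList.getD 0 nil := by cases d <;> simp

theorem ext_toList {d e : Data} (h : d.toList = e.toList) : d = e := by
  rw [← ofList_toList d, h, ofList_toList]

theorem unary_zero : unary 0 = nil := rfl
theorem unary_succ (n : ℕ) : unary (n + 1) = cons nil (unary n) := rfl

@[simp] theorem length_toList_unary (n : ℕ) : (unary n).toList.length = n := by simp [unary]

@[simp] theorem size_unary (n : ℕ) : (unary n).size = 2 * n + 1 := by
  induction n with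
  | zero => rfl
  | succ n ih => rw [unary_succ, size_cons, ih, size_nil]; omega

def rev (l : Data) : Data := fold (fun _ s e => cons e s) nil l nil

@[simp] theorem toList_rev (l : Data) : (rev l).toList = l.toList.reverse := by
  have : ∀ (l : List Data) s, (l.foldl (fun s e => cons e s) s).toList = l.reverse ++ s.toList := by
    intro l
    induction l with
    | nil => simp
    | cons a l ih => simp [ih]
  simpa [rev, fold] using this l.toList nil

def append (a b : Data) : Data := fold (fun _ s e => cons e s) nil (rev a) b

@[simp] theorem toList_append (a b : Data) : (append a b).toList = a.toList ++ b.toList := by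
  have : ∀ (l : List Data) s, (l.foldl (fun s e => cons e s) s).toList = l.reverse ++ s.toList := by
    intro l
    induction l with
    | nil => simp
    | cons a l ih => simp [ih]
  simpa [append, fold] using this (rev a).toList b

def map (f : Data → Data → Data) (x l : Data) : Data :=
  rev (fold (fun x s e => cons (f x e) s) x l nil)

@[simp] theorem toList_map (f : Data → Data → Data) (x l : Data) :
    (map f x l).toList = l.toList.map (f x) := by
  have : ∀ (l : List Data) s, (l.foldl (fun s e => cons (f x e) s) s).toList =
      (l.map (f x)).reverse ++ s.toList := by
    intro l
    induction l with
    | nil => simp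
    | cons a l ih => simp [ih]
  simp [map, fold, this]

def flatMap (f : Data → Data → Data) (x l : Data) : Data :=
  fold (fun x s e => append s (f x e)) x l nil

@[simp] theorem toList_flatMap (f : Data → Data → Data) (x l : Data) :
    (flatMap f x l).toList = l.toList.flatMap fun e => (f x e).toList := by
  have : ∀ (l : List Data) s, (l.foldl (fun s e => append s (f x e)) s).toList =
      s.toList ++ l.flatMap fun e => (f x e).toList := by
    intro l
    induction l with
    | nil => simp
    | cons a l ih => simp [ih]
  simpa [flatMap, fold] using this l.toList nil

/-- The length of a list, in unary. -/
def len (l : Data) : Data := map (fun _ _ => nil) nil l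

@[simp] theorem len_eq (l : Data) : len l = unary l.toList.length := by
  apply ext_toList
  simp [len, unary, List.map_const']

/-- The numbers below the length of a list in decreasing order, in unary. -/
def down (u : Data) : Data := fold (fun _ s _ => cons (cond s (cons nil s.hd) nil) s) nil u nil

theorem down_aux (l : List Data) :
    l.foldl (fun s _ => cons (cond s (cons nil s.hd) nil) s) nil =
      ofList ((List.range l.length).reverse.map unary) := by
  induction l using List.reverseRecOn with
  | nil => rfl
  | append_singleton l a ih =>
    rw [List.foldl_append, ih]
    rcases h : l.length with _ | m
    · simp [h, unary_zero]
    · simp [h, List.range_succ, unary_succ]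

@[simp] theorem down_eq (u : Data) :
    down u = ofList ((List.range u.toList.length).reverse.map unary) := by
  rw [down, fold, down_aux]

def range (u : Data) : Data := rev (down u)

@[simp] theorem range_eq (u : Data) :
    range u = ofList ((List.range u.toList.length).map unary) := by
  apply ext_toList
  simp [range]

def drop (u l : Data) : Data := fold (fun _ s _ => s.tl) nil u l

@[simp] theorem toList_drop (u l : Data) : (drop u l).toList = l.toList.drop u.toList.length := by
  have : ∀ (u : List Data) (s : Data), (u.foldl (fun s _ => s.tl) s).toList = s.toList.drop u.length := by
    intro u
    induction u with
    | nil => simp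
    | cons a u ih => simp [ih, ← List.drop_one, List.drop_drop, add_comm]
  simpa [drop, fold] using this u.toList l

/-- The entry at an index that is given in unary, with a default. -/
def getD (u l d : Data) : Data := cond (drop u l) (drop u l).hd d

@[simp] theorem getD_eq (u l d : Data) : getD u l d = l.toList.getD u.toList.length d := by
  unfold getD
  rcases lt_or_ge u.toList.length l.toList.length with h | h
  · have h' : (drop u l).toList = l.toList[u.toList.length] :: l.toList.drop (u.toList.length + 1) := by
      rw [toList_drop, List.drop_eq_getElem_cons h]
    have h₂ : drop u l ≠ nil := by
      intro h₃
      simp [h₃] at h'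
      omega
    rw [cond_of_ne h₂, hd_eq_getD, h']
    simp [h]
  · have h₂ : drop u l = nil := by
      rw [← toList_eq_nil, toList_drop, List.drop_eq_nil_iff]
      exact h
    rw [h₂, cond_nil, List.getD_eq_default _ _ h]

/-- The first entry with a property. -/
def find (p : Data → Data → Data) (x l : Data) : Data :=
  fold (fun x s e => cond s s (cond (p x e) (cons nil e) nil)) x l nil

@[simp] theorem find_eq (p : Data → Data → Data) (x l : Data) :
    find p x l = ofOption (l.toList.find? fun e => decide (p x e ≠ nil)) := by
  have h₁ : ∀ (l : List Data) a b, l.foldl (fun s e => cond s s (cond (p x e) (cons nil e) nil))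
      (cons a b) = cons a b := by
    intro l a b
    induction l with
    | nil => rfl
    | cons e l ih => simpa using ih
  unfold find fold
  induction l.toList with
  | nil => rfl
  | cons e l ih =>
    by_cases h : p x e = nil
    · simpa [h] using ih
    · simp [h, h₁, cond_of_ne, ofOption]

/-- All subtrees. -/
def subs : Data → List Data
  | nil => [nil]
  | cons a b => cons a b :: (subs a ++ subs b)

theorem length_subs (d : Data) : d.subs.length = d.size := by
  induction d with
  | nil => rfl
  | cons a b ha hb => simp [subs, ha, hb]

theorem self_mem_subs (d : Data) : d ∈ d.subs := by cases d <;> simp [subs]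

theorem subs_trans {d e f : Data} (h : d ∈ e.subs) (h' : e ∈ f.subs) : d ∈ f.subs := by
  induction f with
  | nil => simp [subs] at h'; rwa [h'] at h
  | cons a b ha hb =>
    simp only [subs, List.mem_cons, List.mem_append] at h' ⊢
    rcases h' with rfl | h' | h'
    · simpa [subs] using h
    · exact .inr (.inl (ha h'))
    · exact .inr (.inr (hb h'))

theorem hd_mem_subs {d e : Data} (h : d ∈ e.subs) : d.hd ∈ e.subs := by
  refine subs_trans ?_ h
  cases d <;> simp [subs, self_mem_subs]

theorem tl_mem_subs {d e : Data} (h : d ∈ e.subs) : d.tl ∈ e.subs := by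
  refine subs_trans ?_ h
  cases d <;> simp [subs, self_mem_subs]

def subtrees (d : Data) : Data := ofList d.subs.reverse

@[simp] theorem mem_subtrees {d e : Data} : d ∈ (subtrees e).toList ↔ d ∈ e.subs := by
  simp [subtrees]

/-- `d` if its size is at most the length of `u`, and `nil` otherwise. -/
def cap (u d : Data) : Data := cond (drop u (len (subtrees d))) nil d

@[simp] theorem cap_eq (u d : Data) :
    cap u d = if d.size ≤ u.toList.length then d else nil := by
  unfold cap cond
  have : drop u (len (subtrees d)) = nil ↔ d.size ≤ u.toList.length := by
    rw [← toList_eq_nil]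
    simp [subtrees, length_subs, List.drop_eq_nil_iff]
  simp only [this]

def mulUnary (u v : Data) : Data := flatMap (fun v _ => v) v u

@[simp] theorem mulUnary_eq (m n : ℕ) : mulUnary (unary m) (unary n) = unary (m * n) := by
  apply ext_toList
  simp only [mulUnary, toList_flatMap, unary, toList_ofList]
  induction m with
  | zero => simp
  | succ m ih =>
    rw [List.replicate_succ, List.flatMap_cons, ih, ← List.replicate_add]
    congr 1
    ring

@[simp] theorem append_unary (m n : ℕ) : append (unary m) (unary n) = unary (m + n) := by
  apply ext_toList
  simp [unary]

end Data

namespace PolyTime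

variable {F G K : Data → Data}

@[fun_prop]
theorem rev (hF : PolyTime F) : PolyTime fun y => Data.rev (F y) :=
  fold_add (g := fun x => x.size) (by fun_prop) PolyBound.size
    (fun x s e => by simp; omega) (const _) hF (const _)

@[fun_prop]
theorem append (hF : PolyTime F) (hG : PolyTime G) : PolyTime fun y => Data.append (F y) (G y) :=
  fold_add (g := fun x => x.size) (by fun_prop) PolyBound.size
    (fun x s e => by simp; omega) (const _) (by fun_prop) hG

theorem map {f : Data → Data → Data} (hf : PolyTime fun y => f y.hd y.tl) (hF : PolyTime F)
    (hG : PolyTime G) : PolyTime fun y => Data.map f (F y) (G y) := by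
  refine (fold_add (f := fun x s e => Data.cons (f x e) s) (g := fun x => (f x.hd x.tl).size + 1) ?_
    (hf.bound.add (.const 1)) (fun x s e => by simp; omega) hF hG (const _)).rev
  have : PolyTime fun y : Data => f y.hd y.tl.tl :=
    comp' hf (G := fun y => Data.cons y.hd y.tl.tl) (by fun_prop)
  exact this.cons (by fun_prop)

theorem flatMap {f : Data → Data → Data} (hf : PolyTime fun y => f y.hd y.tl) (hF : PolyTime F)
    (hG : PolyTime G) : PolyTime fun y => Data.flatMap f (F y) (G y) := by
  refine fold_add (f := fun x s e => Data.append s (f x e)) (g := fun x => (f x.hd x.tl).size) ?_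
    hf.bound (fun x s e => ?_) hF hG (const _)
  · have : PolyTime fun y : Data => f y.hd y.tl.tl :=
      comp' hf (G := fun y => Data.cons y.hd y.tl.tl) (by fun_prop)
    exact .append (by fun_prop) this
  · have := size_ofList_append s.toList (f x e).toList
    rw [← toList_append, ofList_toList, ofList_toList, ofList_toList] at this
    simp only [hd_cons, tl_cons]
    omega

@[fun_prop]
theorem len (hF : PolyTime F) : PolyTime fun y => Data.len (F y) :=
  map (const _) (const _) hF

@[fun_prop]
theorem down (hF : PolyTime F) : PolyTime fun y => Data.down (F y) := by
  refine fold (B := fun y => (F y).size * (2 * (F y).size + 2) + 1) (by fun_prop) (const _) hF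
    (const _) ((hF.bound.mul (((PolyBound.const 2).mul hF.bound).add (.const 2))).add (.const 1))
    fun y l hl => ?_
  have h₁ := hl.length_le.trans (length_toList_lt (F y)).le
  rw [down_aux]
  refine (size_ofList_le (m := 2 * (F y).size + 1) fun d hd => ?_).trans ?_
  · simp only [List.map_reverse, List.mem_reverse, List.mem_map, List.mem_range] at hd
    obtain ⟨i, hi, rfl⟩ := hd
    rw [size_unary]
    omega
  · simp only [List.length_map, List.length_reverse, List.length_range]
    gcongr

@[fun_prop]
theorem range (hF : PolyTime F) : PolyTime fun y => Data.range (F y) := (down hF).rev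

@[fun_prop]
theorem drop (hF : PolyTime F) (hG : PolyTime G) : PolyTime fun y => Data.drop (F y) (G y) :=
  fold_add (by fun_prop) (.const 0) (fun _ s _ => by simpa using size_tl_le s) (const _) hF hG

@[fun_prop]
theorem getD (hF : PolyTime F) (hG : PolyTime G) (hK : PolyTime K) :
    PolyTime fun y => Data.getD (F y) (G y) (K y) := by
  unfold Data.getD
  fun_prop

theorem find {p : Data → Data → Data} (hp : PolyTime fun y => p y.hd y.tl) (hF : PolyTime F)
    (hG : PolyTime G) : PolyTime fun y => Data.find p (F y) (G y) := by
  refine fold_add (f := fun x s e => Data.cond s s (Data.cond (p x e) (Data.cons Data.nil e) Data.nil))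
    (g := fun x => x.size + 1) ?_ (PolyBound.size.add (.const 1)) (fun x s e => ?_) hF hG (const _)
  · have : PolyTime fun y : Data => p y.hd y.tl.tl :=
      comp' hp (G := fun y => Data.cons y.hd y.tl.tl) (by fun_prop)
    exact .cond (by fun_prop) (by fun_prop) (.cond this (by fun_prop) (by fun_prop))
  · unfold Data.cond
    split_ifs <;> simp <;> omega

@[fun_prop]
theorem subtrees (hF : PolyTime F) : PolyTime fun y => Data.subtrees (F y) := by
  refine comp' (F := Data.subtrees) ?_ hF
  let f : Data → Data := fun s => Data.cons
    (Data.cond s.hd.hd (Data.cons s.hd.hd.hd (Data.cons s.hd.hd.tl s.hd.tl)) s.hd.tl)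
    (Data.cons s.hd.hd s.tl)
  have hf : PolyTime f := by
    show PolyTime fun s : Data => Data.cons (Data.cond s.hd.hd
      (Data.cons s.hd.hd.hd (Data.cons s.hd.hd.tl s.hd.tl)) s.hd.tl) (Data.cons s.hd.hd s.tl)
    fun_prop
  have hdfs : ∀ d w o, f^[d.size] (Data.cons (Data.cons d w) o) =
      Data.cons w (ofList (d.subs.reverse ++ o.toList)) := by
    intro d
    induction d with
    | nil => intro w o; simp [f, subs]
    | cons a b ha hb =>
      intro w o
      rw [size_cons, add_comm a.size, Function.iterate_succ_apply, Function.iterate_add_apply]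
      simp only [f, hd_cons, tl_cons, cond_cons] at ha hb ⊢
      rw [ha, hb]
      simp [subs]
  -- The total size of the pending subtrees drops by one in each step. Hence the stack is nonempty
  -- before step `d.size`, as the loop test requires, and all states have polynomial size.
  have hinv : ∀ d i, i ≤ d.size → ∃ (w : List Data) (o : Data),
      f^[i] (Data.cons (Data.cons d Data.nil) Data.nil) = Data.cons (ofList w) o ∧
      (w.map size).sum = d.size - i ∧ (ofList w).size ≤ d.size + 2 ∧
      o.size ≤ i * (d.size + 3) + 1 := by
    intro d i
    induction i with
    | zero => exact fun _ => ⟨[d], .nil, by simp⟩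
    | succ i ih =>
      intro hi
      obtain ⟨w, o, h₁, h₂, h₃, h₄⟩ := ih (by omega)
      rw [Function.iterate_succ_apply', h₁, add_mul]
      rcases w with _ | ⟨e | ⟨a, b⟩, w⟩
      · simp at h₂; omega
      · refine ⟨w, .cons .nil o, by simp [f], ?_, ?_, ?_⟩ <;> simp at * <;> omega
      · refine ⟨a :: b :: w, .cons (.cons a b) o, by simp [f], ?_, ?_, ?_⟩ <;> simp at * <;> omega
  refine (tl id).comp' (G := fun d => f^[d.size] (Data.cons (Data.cons d .nil) .nil)) ?_ |>.congr ?_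
  · refine iterate hf (Z := fun d => Data.cons (Data.cons d .nil) .nil) (by fun_prop)
      (B := fun d => d.size + 2 + d.size * (d.size + 3) + 2) PolyBound.size
      (((PolyBound.size.add (.const 2)).add (PolyBound.size.mul (PolyBound.size.add
        (.const 3)))).add (.const 2)) ?_ ?_ ?_ fun _ => rfl
    · intro d i hi
      obtain ⟨w, o, h₁, h₂, -⟩ := hinv d i hi.le
      rw [h₁, hd_cons]
      rcases w with _ | ⟨e, w⟩
      · simp at h₂; omega
      · exact fun h => Data.noConfusion h
    · intro d
      rw [hdfs, hd_cons]
    · intro d i hi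
      obtain ⟨w, o, h₁, h₂, h₃, h₄⟩ := hinv d i hi
      have : i * (d.size + 3) ≤ d.size * (d.size + 3) := by gcongr
      rw [h₁, size_cons]
      omega
  · intro d
    rw [hdfs]
    simp [Data.subtrees]

@[fun_prop]
theorem cap (hF : PolyTime F) (hG : PolyTime G) : PolyTime fun y => Data.cap (F y) (G y) := by
  unfold Data.cap
  fun_prop

@[fun_prop]
theorem mulUnary (hF : PolyTime F) (hG : PolyTime G) :
    PolyTime fun y => Data.mulUnary (F y) (G y) := flatMap (by fun_prop) hG hF

theorem unary_eval (b : Polynomial ℕ) (hF : PolyTime F) :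
    PolyTime fun y => unary (b.eval (F y).toList.length) := by
  induction b using Polynomial.induction_on' with
  | add p q hp hq => exact (hp.append hq).congr fun y => by simp
  | monomial k a =>
    induction k with
    | zero => exact (const (unary a)).congr fun y => by simp
    | succ k ih =>
      refine (ih.mulUnary hF.len).congr fun y => ?_
      simp [pow_succ, mul_assoc]

end PolyTime


/-! ### Binary arithmetic -/

namespace Data

/-- The double of a number. -/
def dbl (x : Data) : Data := cond x (cons nil x) nil

@[simp] theorem ofNat_zero : ofNat 0 = nil := by simp [ofNat]

theorem ofNat_two_mul (m : ℕ) : ofNat (2 * m) = dbl (ofNat m) := by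
  rcases eq_or_ne m 0 with rfl | h
  · simp [dbl]
  · have : ofNat m ≠ nil := by
      rw [Ne, ← toList_eq_nil, ofNat, toList_ofList]
      intro h'
      rw [List.map_eq_nil_iff] at h'
      exact h (by rw [← Nat.size_eq_zero, ← Nat.size_eq_bits_len, h', List.length_nil])
    rw [dbl, cond_of_ne this, ofNat, Nat.bit0_bits _ h]
    rfl

theorem ofNat_two_mul_add_one (m : ℕ) : ofNat (2 * m + 1) = cons (cons nil nil) (ofNat m) := by
  rw [ofNat, Nat.bit1_bits]
  rfl

@[simp] theorem toNat_dbl (x : Data) : (dbl x).toNat = 2 * x.toNat := by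
  cases x <;> simp [dbl, toNat]

theorem toNat_cons (b d : Data) :
    (cons b d).toNat = 2 * d.toNat + if b = nil then 0 else 1 := rfl

@[simp] theorem toNat_nil : nil.toNat = 0 := rfl

@[simp] theorem toNat_ofNat (m : ℕ) : (ofNat m).toNat = m := by
  induction m using Nat.strongRecOn with
  | ind m ih =>
    obtain ⟨k, rfl | rfl⟩ := m.even_or_odd'
    · rcases Nat.eq_zero_or_pos k with rfl | h
      · simp
      · rw [ofNat_two_mul, toNat_dbl, ih k (by omega)]
    · rw [ofNat_two_mul_add_one, toNat_cons, ih k (by omega)]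
      simp

theorem ofNat_injective : Function.Injective ofNat := Function.LeftInverse.injective toNat_ofNat

@[simp] theorem ofNat_inj {m n : ℕ} : ofNat m = ofNat n ↔ m = n := ofNat_injective.eq_iff

@[simp] theorem ofNat_eq_nil {m : ℕ} : ofNat m = nil ↔ m = 0 := by
  rw [← ofNat_zero, ofNat_inj]

@[simp] theorem tl_ofNat (m : ℕ) : (ofNat m).tl = ofNat (m / 2) := by
  obtain ⟨k, rfl | rfl⟩ := m.even_or_odd'
  · rcases Nat.eq_zero_or_pos k with rfl | h
    · simp
    · rw [ofNat_two_mul, dbl, cond_of_ne (by simpa using h.ne')]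
      simp
  · rw [ofNat_two_mul_add_one, show (2 * k + 1) / 2 = k by omega]
    rfl

@[simp] theorem hd_ofNat (m : ℕ) : (ofNat m).hd = ofBool (decide (m % 2 = 1)) := by
  obtain ⟨k, rfl | rfl⟩ := m.even_or_odd'
  · rcases Nat.eq_zero_or_pos k with rfl | h
    · simp
    · rw [ofNat_two_mul, dbl, cond_of_ne (by simpa using h.ne')]
      simp
  · rw [ofNat_two_mul_add_one]
    simp [Nat.add_mod]

@[simp] theorem drop_ofNat (u : Data) (m : ℕ) :
    drop u (ofNat m) = ofNat (m / 2 ^ u.toList.length) := by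
  have : ∀ (u : List Data) m, (u.foldl (fun s _ => s.tl) (ofNat m)) = ofNat (m / 2 ^ u.length) := by
    intro u
    induction u with
    | nil => simp
    | cons a u ih => intro m; simp [ih, Nat.div_div_eq_div_mul, pow_succ']
  exact this u.toList m

theorem size_ofNat_toNat_le (x : Data) : (ofNat x.toNat).size ≤ x.size := by
  induction x with
  | nil => simp
  | cons b d _ ih =>
    rw [toNat_cons]
    by_cases h : b = nil
    · rw [if_pos h, add_zero, ofNat_two_mul, dbl, cond, h]
      split_ifs <;> simp; omega
    · rw [if_neg h, ofNat_two_mul_add_one]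
      obtain ⟨b₁, b₂, rfl⟩ : ∃ b₁ b₂, b = cons b₁ b₂ := by
        cases b
        · exact absurd rfl h
        · exact ⟨_, _, rfl⟩
      have := size_pos b₁
      have := size_pos b₂
      simp only [size_cons, size_nil]
      omega

theorem length_toList_ofNat (m : ℕ) : (ofNat m).toList.length = m.size := by
  simp [ofNat, Nat.size_eq_bits_len]

theorem size_ofNat_le (m : ℕ) : (ofNat m).size ≤ 4 * m.size + 1 := by
  refine (size_ofList_le (m := 3) fun d hd => ?_).trans (by simp [Nat.size_eq_bits_len]; omega)
  obtain ⟨b, -, rfl⟩ := List.mem_map.1 hd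
  cases b <;> simp

theorem size_hd_add_size_tl_le (d : Data) : d.hd.size + d.tl.size ≤ d.size + 1 := by
  cases d
  · simp
  · simp; omega

/-- The canonical binary representation. -/
def norm (x : Data) : Data :=
  fold (fun _ s e => cond e (cons (cons nil nil) s) (dbl s)) nil (rev x) nil

@[simp] theorem norm_eq (x : Data) : norm x = ofNat x.toNat := by
  rw [norm, fold, toList_rev]
  induction x with
  | nil => simp
  | cons b d _ ih =>
    rw [toList_cons, List.reverse_cons, List.foldl_append, ih, toNat_cons, List.foldl_cons,
      List.foldl_nil, cond]
    split_ifs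
    · rw [add_zero, ofNat_two_mul]
    · rw [ofNat_two_mul_add_one]

theorem toNat_ofList_append (l₁ l₂ : List Data) : (ofList (l₁ ++ l₂)).toNat =
    (ofList l₁).toNat + 2 ^ l₁.length * (ofList l₂).toNat := by
  induction l₁ with
  | nil => simp
  | cons a l ih =>
    simp only [List.cons_append, ofList_cons, toNat_cons, ih, List.length_cons, pow_succ]
    ring

theorem toNat_lt (x : Data) : x.toNat < 2 ^ x.toList.length := by
  induction x with
  | nil => simp
  | cons b d _ ih =>
    rw [toNat_cons, toList_cons, List.length_cons, pow_succ]
    split_ifs <;> omega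

/-- Addition of one; the state is the carry and the reversed output. -/
def inc (x : Data) : Data :=
  let s := fold (fun _ s e => cons (cond e s.hd nil)
    (cons (cond e (cond s.hd nil (cons nil nil)) (cond s.hd (cons nil nil) nil)) s.tl)) nil x (cons (cons nil nil) nil)
  norm (append (rev s.tl) (cons s.hd nil))

@[simp] theorem inc_eq (x : Data) : inc x = ofNat (x.toNat + 1) := by
  -- Invariant: the final value is the value of the digits written so far plus `2 ^ o.length` times
  -- the sum of the unread number and the carry.
  have key : ∀ (l : List Data) (c : Bool) (o : List Data), ∃ (c' : Bool) (o' : List Data),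
      l.foldl (fun s e => cons (cond e s.hd nil)
        (cons (cond e (cond s.hd nil (cons nil nil)) (cond s.hd (cons nil nil) nil)) s.tl)) (cons (ofBool c) (ofList o)) =
      cons (ofBool c') (ofList o') ∧ (ofList (o'.reverse ++ [ofBool c'])).toNat =
        (ofList o.reverse).toNat + 2 ^ o.length * ((ofList l).toNat + c.toNat) := by
    intro l
    induction l with
    | nil =>
      intro c o
      refine ⟨c, o, rfl, ?_⟩
      rw [toNat_ofList_append]
      cases c <;> simp [toNat_cons]
    | cons e l ih =>
      intro c o
      by_cases he : e = nil
      · obtain ⟨c', o', h₁, h₂⟩ := ih false (ofBool c :: o)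
        refine ⟨c', o', ?_, ?_⟩
        · rw [← h₁]
          cases c <;> simp [he]
        · rw [h₂]
          simp only [List.reverse_cons, toNat_ofList_append]
          cases c <;> simp [toNat_cons, he, pow_succ] <;> ring
      · obtain ⟨c', o', h₁, h₂⟩ := ih c (ofBool (!c) :: o)
        refine ⟨c', o', ?_, ?_⟩
        · rw [← h₁]
          cases c <;> simp [cond_of_ne he]
        · rw [h₂]
          simp only [List.reverse_cons, toNat_ofList_append]
          cases c <;> simp [toNat_cons, he, pow_succ] <;> ring
  obtain ⟨c', o', h₁, h₂⟩ := key x.toList true []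
  simp only [ofBool_true, ofList_nil, ofList_toList] at h₁ h₂
  simp only [inc, fold, h₁, norm_eq]
  congr 1
  rw [← ofList_toList (append _ _)]
  simpa using h₂

theorem size_ofNat_add_one (m : ℕ) : (ofNat (m + 1)).size ≤ (ofNat m).size + 4 := by
  induction m using Nat.strongRecOn with
  | ind m ih =>
    obtain ⟨k, rfl | rfl⟩ := m.even_or_odd'
    · rw [ofNat_two_mul_add_one, ofNat_two_mul, dbl, cond]
      split_ifs with h
      · simp [h]
      · simp; omega
    · have := ih k (by omega)
      rw [ofNat_two_mul_add_one, show 2 * k + 1 + 1 = 2 * (k + 1) by ring, ofNat_two_mul, dbl, cond]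
      split_ifs <;> simp
      omega

/-- Subtraction of one; the state is the borrow and the reversed output. -/
def dec (x : Data) : Data :=
  let s := fold (fun _ s e => cons (cond e nil s.hd)
    (cons (cond e (cond s.hd nil (cons nil nil)) (cond s.hd (cons nil nil) nil)) s.tl)) nil x (cons (cons nil nil) nil)
  cond s.hd nil (norm (rev s.tl))

@[simp] theorem dec_eq (x : Data) : dec x = ofNat (x.toNat - 1) := by
  -- The incoming borrow stands on the left and the outgoing one on the right, which avoids
  -- truncated subtraction.
  have key : ∀ (l : List Data) (c : Bool) (o : List Data), ∃ (c' : Bool) (o' : List Data),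
      l.foldl (fun s e => cons (cond e nil s.hd)
        (cons (cond e (cond s.hd nil (cons nil nil)) (cond s.hd (cons nil nil) nil)) s.tl)) (cons (ofBool c) (ofList o)) =
      cons (ofBool c') (ofList o') ∧
      (ofList o'.reverse).toNat + 2 ^ o.length * c.toNat =
        (ofList o.reverse).toNat + 2 ^ o.length * (ofList l).toNat + 2 ^ o'.length * c'.toNat := by
    intro l
    induction l with
    | nil =>
      intro c o
      exact ⟨c, o, rfl, by simp⟩
    | cons e l ih =>
      intro c o
      by_cases he : e = nil
      · obtain ⟨c', o', h₁, h₂⟩ := ih c (ofBool c :: o)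
        refine ⟨c', o', ?_, ?_⟩
        · rw [← h₁]
          cases c <;> simp [he]
        · simp only [List.reverse_cons, toNat_ofList_append] at h₂
          cases c <;> simp [toNat_cons, he, pow_succ] at h₂ ⊢ <;> linarith
      · obtain ⟨c', o', h₁, h₂⟩ := ih false (ofBool (!c) :: o)
        refine ⟨c', o', ?_, ?_⟩
        · rw [← h₁]
          cases c <;> simp [cond_of_ne he]
        · simp only [List.reverse_cons, toNat_ofList_append] at h₂
          cases c <;> simp [toNat_cons, he, pow_succ] at h₂ ⊢ <;> linarith
  obtain ⟨c', o', h₁, h₂⟩ := key x.toList true []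
  simp only [ofBool_true, ofList_nil, ofList_toList, List.reverse_nil, toNat_nil, List.length_nil,
    pow_zero, one_mul, zero_add, Bool.toNat_true] at h₁ h₂
  have hlt := toNat_lt (ofList o'.reverse)
  simp only [toList_ofList, List.length_reverse] at hlt
  have hrev : rev (ofList o') = ofList o'.reverse := ext_toList (by simp)
  simp only [dec, fold, h₁, norm_eq, tl_cons, hd_cons, hrev]
  cases c' with
  | true =>
    simp only [Bool.toNat_true, mul_one] at h₂
    simp only [cond_ofBool, if_true]
    symm
    rw [ofNat_eq_nil]
    omega
  | false =>
    simp only [Bool.toNat_false, mul_zero, add_zero] at h₂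
    simp only [ofBool_false, cond_nil]
    congr 1
    omega

/-- The comparison of two numbers; the state is the verdict so far and the remaining digits. -/
def le (x y : Data) : Data :=
  (fold (fun _ s _ => cons (cond s.tl.hd.hd (cond s.tl.tl.hd s.hd nil)
    (cond s.tl.tl.hd (cons nil nil) s.hd)) (cons s.tl.hd.tl s.tl.tl.tl)) nil (append x y)
    (cons (cons nil nil) (cons x y))).hd

@[simp] theorem le_eq (x y : Data) : le x y = ofProp (x.toNat ≤ y.toNat) := by
  have hc : ∀ d : Data, d.toNat = 2 * d.tl.toNat + if d.hd = nil then 0 else 1 := by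
    intro d
    cases d
    · simp
    · exact toNat_cons _ _
  -- Digits are read from the least significant one on, so a difference at a later digit overrides
  -- the verdict `v` reached before. The list `l` is a mere counter, long enough for both numbers.
  have key : ∀ (l : List Data) (v : Bool) (x y : Data), x.toList.length ≤ l.length →
      y.toList.length ≤ l.length → ∃ d,
      l.foldl (fun s _ => cons (cond s.tl.hd.hd (cond s.tl.tl.hd s.hd nil)
        (cond s.tl.tl.hd (cons nil nil) s.hd)) (cons s.tl.hd.tl s.tl.tl.tl))
          (cons (ofBool v) (cons x y)) =
        cons (ofBool (decide (x.toNat < y.toNat ∨ x.toNat = y.toNat ∧ v = true))) d := by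
    intro l
    induction l with
    | nil =>
      intro v x y hx hy
      obtain rfl : x = nil := by rw [← toList_eq_nil]; exact List.length_eq_zero_iff.1 (by simpa using hx)
      obtain rfl : y = nil := by rw [← toList_eq_nil]; exact List.length_eq_zero_iff.1 (by simpa using hy)
      exact ⟨cons nil nil, by simp⟩
    | cons e l ih =>
      intro v x y hx hy
      obtain ⟨d, hd⟩ := ih (if x.hd = nil then (if y.hd = nil then v else true)
        else (if y.hd = nil then false else v)) x.tl y.tl (by simp at hx ⊢; omega)
        (by simp at hy ⊢; omega)
      refine ⟨d, ?_⟩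
      rw [List.foldl_cons]
      convert hd using 2
      · simp only [hd_cons, tl_cons, cond]
        by_cases hx : x.hd = nil <;> by_cases hy : y.hd = nil <;> simp [hx, hy]
      · have h₁ := hc x
        have h₂ := hc y
        congr 1
        rw [decide_eq_decide]
        by_cases hx : x.hd = nil <;> by_cases hy : y.hd = nil <;>
          simp only [hx, hy, if_true, if_false, Bool.false_eq_true, and_false, and_true] at h₁ h₂ ⊢ <;>
          rw [h₁, h₂] <;> cases v <;> simp <;> omega
  obtain ⟨d, hd⟩ := key (append x y).toList true x y (by simp) (by simp)
  rw [ofBool_true] at hd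
  rw [le, fold, hd, hd_cons, ofProp]
  congr 2
  simp [le_iff_lt_or_eq]

def countStep (y s : Data) : Data := cond (le y s.hd) s (cons (inc s.hd) (cons nil s.tl))

theorem countStep_cons (y x s : Data) : countStep y (cons x s) =
    if y.toNat ≤ x.toNat then cons x s else cons (ofNat (x.toNat + 1)) (cons nil s) := by
  simp [countStep]

/-- The difference `y - x`, capped at the length of `u`, in unary. -/
def countUp (x y u : Data) : Data := (fold (fun y s _ => countStep y s) y u (cons x nil)).tl

theorem foldl_countStep (u : List Data) (x y : Data) (n : ℕ) : ∃ d : Data,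
    d.size ≤ x.size + 4 * u.length ∧
    u.foldl (fun s _ => countStep y s) (cons x (unary n)) =
      cons d (unary (n + min (y.toNat - x.toNat) u.length)) := by
  induction u generalizing x n with
  | nil => exact ⟨x, by simp⟩
  | cons e u ih =>
    rw [List.foldl_cons, countStep_cons]
    split_ifs with h
    · obtain ⟨d, h₁, h₂⟩ := ih x n
      refine ⟨d, h₁.trans (by simp), ?_⟩
      rw [h₂]; congr 2; simp; omega
    · obtain ⟨d, h₁, h₂⟩ := ih (ofNat (x.toNat + 1)) (n + 1)
      have := size_ofNat_add_one x.toNat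
      have := size_ofNat_toNat_le x
      refine ⟨d, ?_, ?_⟩
      · rw [List.length_cons]; omega
      · rw [← unary_succ, h₂, toNat_ofNat]; congr 2; simp; omega

@[simp] theorem countUp_eq (x y u : Data) :
    countUp x y u = unary (min (y.toNat - x.toNat) u.toList.length) := by
  obtain ⟨d, -, h⟩ := foldl_countStep u.toList x y 0
  rw [zero_add, unary_zero] at h
  rw [countUp, fold, h, tl_cons]

/-- The binary representation of a number in unary. -/
def bin (u : Data) : Data := fold (fun _ s _ => inc s) nil u nil

@[simp] theorem bin_eq (u : Data) : bin u = ofNat u.toList.length := by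
  rw [bin, fold]
  induction u.toList using List.reverseRecOn with
  | nil => simp
  | append_singleton l a ih => simp only [List.foldl_append, ih]; simp

/-- The heights of the trees of a mountain range, in unary. -/
def heights (l : Data) : Data :=
  flatMap (fun l i => cond (drop i l).hd (cons i nil) nil) l (down l)

/-- Two sorted lists with the same members are equal. The right side exhibits the heights as the
result of scanning finitely many bits. -/
theorem heights_eq_filter (l n : ℕ) (h : l < 2 ^ n) :
    LightClient.heights l = (List.range n).reverse.filter fun i => l.testBit i := by
  rw [LightClient.heights, List.filter_reverse, List.reverse_inj]
  refine Nat.bitIndices_sorted.pairwise.eq_of_mem_iff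
    (List.pairwise_lt_range.filter _) fun i => ?_
  simp only [Nat.mem_bitIndices, List.mem_filter, List.mem_range]
  refine ⟨fun hi => ⟨?_, hi⟩, fun hi => hi.2⟩
  by_contra h'
  have : l < 2 ^ i := h.trans_le (Nat.pow_le_pow_right (by norm_num) (by omega))
  rw [Nat.testBit_eq_false_of_lt this] at hi
  exact absurd hi (by simp)

@[simp] theorem heights_ofNat (l : ℕ) :
    heights (ofNat l) = ofList ((LightClient.heights l).map unary) := by
  have hlt := toNat_lt (ofNat l)
  rw [toNat_ofNat] at hlt
  apply ext_toList
  rw [heights, toList_flatMap, down_eq, toList_ofList, toList_ofList, heights_eq_filter l _ hlt]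
  induction (List.range (ofNat l).toList.length).reverse with
  | nil => rfl
  | cons i t ih =>
    rw [List.map_cons, List.flatMap_cons, ih, List.filter_cons]
    have : (l.testBit i) = decide (l / 2 ^ i % 2 = 1) := by
      simp [Nat.testBit_eq_decide_div_mod_eq]
    simp only [drop_ofNat, length_toList_unary, hd_ofNat, cond_ofBool, this]
    split_ifs <;> simp

def sibling (j : Data) : Data := cond j.hd (dbl j.tl) (cons (cons nil nil) j.tl)

@[simp] theorem sibling_ofNat (j : ℕ) : sibling (ofNat j) = ofNat (siblingPos j) := by
  simp only [sibling, hd_ofNat, tl_ofNat, cond_ofBool, decide_eq_true_eq, siblingPos,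
    ← ofNat_two_mul, ← ofNat_two_mul_add_one]
  split_ifs <;> simp <;> omega

def peakPos (l a : Data) : Data := dbl (drop (cons nil a) l)

@[simp] theorem peakPos_ofNat (l : ℕ) (a : Data) :
    peakPos (ofNat l) a = ofNat (LightClient.peakPos l a.toList.length) := by
  simp [peakPos, LightClient.peakPos, ofNat_two_mul]

end Data

namespace PolyTime

variable {F G K : Data → Data}

@[fun_prop]
theorem dbl (hF : PolyTime F) : PolyTime fun y => Data.dbl (F y) := by
  unfold Data.dbl
  fun_prop

@[fun_prop]
theorem norm (hF : PolyTime F) : PolyTime fun y => Data.norm (F y) :=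
  fold_add (by fun_prop) (.const 4) (fun _ s e => by
    unfold Data.dbl Data.cond; split_ifs <;> simp <;> omega) (const _) (by fun_prop) (const _)

@[fun_prop]
theorem inc (hF : PolyTime F) : PolyTime fun y => Data.inc (F y) := by
  have : PolyTime fun y => Data.fold (fun _ s e => .cons (.cond e s.hd .nil)
      (.cons (.cond e (.cond s.hd .nil (.cons .nil .nil)) (.cond s.hd (.cons .nil .nil) .nil)) s.tl))
      .nil (F y)
      (.cons (.cons .nil .nil) .nil) := by
    refine fold_add (g := fun _ => 7) (by fun_prop) (.const _) (fun _ s e => ?_) (const _) hF (const _)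
    have := size_hd_add_size_tl_le s
    unfold Data.cond
    split_ifs <;> simp <;> omega
  exact ((tl this).rev.append ((hd this).cons (const _))).norm

@[fun_prop]
theorem dec (hF : PolyTime F) : PolyTime fun y => Data.dec (F y) := by
  have : PolyTime fun y => Data.fold (fun _ s e => .cons (.cond e .nil s.hd)
      (.cons (.cond e (.cond s.hd .nil (.cons .nil .nil)) (.cond s.hd (.cons .nil .nil) .nil)) s.tl))
      .nil (F y) (.cons (.cons .nil .nil) .nil) := by
    refine fold_add (g := fun _ => 7) (by fun_prop) (.const _) (fun _ s e => ?_) (const _) hF (const _)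
    have := size_hd_add_size_tl_le s
    unfold Data.cond
    split_ifs <;> simp <;> omega
  exact (hd this).cond (const _) (tl this).rev.norm

@[fun_prop]
theorem le (hF : PolyTime F) (hG : PolyTime G) : PolyTime fun y => Data.le (F y) (G y) := by
  refine hd (fold_add (g := fun _ => 7) (by fun_prop) (.const _) (fun _ s e => ?_) (const _)
    (by fun_prop) (by fun_prop))
  have := size_hd_add_size_tl_le s
  have := size_hd_add_size_tl_le s.tl
  have := size_tl_le s.tl.hd
  have := size_tl_le s.tl.tl
  unfold Data.cond
  split_ifs <;> simp <;> omega

@[fun_prop]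
theorem countUp (hF : PolyTime F) (hG : PolyTime G) (hK : PolyTime K) :
    PolyTime fun y => Data.countUp (F y) (G y) (K y) := by
  refine tl (fold (B := fun y => (F y).size + 6 * (K y).size + 2) (by unfold countStep; fun_prop)
    hG hK (by fun_prop) ((hF.bound.add ((PolyBound.const 6).mul hK.bound)).add (.const 2))
    fun y l hl => ?_)
  obtain ⟨d, h₁, h₂⟩ := foldl_countStep l (F y) (G y) 0
  rw [unary_zero] at h₂
  rw [h₂, size_cons, size_unary]
  have := hl.length_le.trans (length_toList_lt (K y)).le
  omega

@[fun_prop]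
theorem bin (hF : PolyTime F) : PolyTime fun y => Data.bin (F y) := by
  refine fold_add (by fun_prop) (.const 4) (fun _ s e => ?_) (const _) hF (const _)
  have := size_ofNat_add_one s.toNat
  have := size_ofNat_toNat_le s
  rw [inc_eq]
  omega

@[fun_prop]
theorem heights (hF : PolyTime F) : PolyTime fun y => Data.heights (F y) :=
  flatMap (by fun_prop) hF (by fun_prop)

@[fun_prop]
theorem sibling (hF : PolyTime F) : PolyTime fun y => Data.sibling (F y) := by
  unfold Data.sibling
  fun_prop

@[fun_prop]
theorem peakPos (hF : PolyTime F) (hG : PolyTime G) :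
    PolyTime fun y => Data.peakPos (F y) (G y) := by
  unfold Data.peakPos
  fun_prop

end PolyTime


/-! ### Mountain ranges -/

theorem mem_heights {l a : ℕ} : a ∈ heights l ↔ l.testBit a = true := by simp [heights]

theorem nodup_heights (l : ℕ) : (heights l).Nodup := List.nodup_reverse.2 Nat.bitIndices_nodup

theorem two_pow_le_of_mem_heights {l a : ℕ} (h : a ∈ heights l) : 2 ^ a ≤ l :=
  Nat.two_pow_le_of_mem_bitIndices (List.mem_reverse.1 h)

theorem le_log_of_mem_heights {l a : ℕ} (h : a ∈ heights l) : a ≤ Nat.log 2 l :=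
  Nat.le_log_of_pow_le (by norm_num) (two_pow_le_of_mem_heights h)

theorem length_heights_le (l : ℕ) : (heights l).length ≤ Nat.log 2 l + 1 := by
  rw [Data.heights_eq_filter l (Nat.log 2 l + 1) (Nat.lt_pow_succ_log_self (by norm_num) l)]
  exact (List.length_filter_le _ _).trans (by simp)

/-- The tree of height `a` contains leaf `i` if and only if `i` and `l` first differ at bit `a`. -/
theorem div_eq_peakPos_iff {l a i : ℕ} (ha : a ∈ heights l) :
    i / 2 ^ a = peakPos l a ↔ i / 2 ^ a < l / 2 ^ a ∧ i / 2 ^ (a + 1) = l / 2 ^ (a + 1) := by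
  rw [mem_heights, Nat.testBit_eq_decide_div_mod_eq, decide_eq_true_eq] at ha
  rw [peakPos, pow_succ, ← Nat.div_div_eq_div_mul, ← Nat.div_div_eq_div_mul]
  omega

/-- The height is the highest bit at which `i` and `l` differ. As `i < l`, this bit is set in `l`,
and so it belongs to a tree of the range. -/
theorem exists_height {l i : ℕ} (h : i < l) : ∃ a ∈ heights l, i / 2 ^ a = peakPos l a := by
  have hex : ∃ a, i / 2 ^ a = l / 2 ^ a :=
    ⟨l, by rw [Nat.div_eq_of_lt (h.trans Nat.lt_two_pow_self), Nat.div_eq_of_lt Nat.lt_two_pow_self]⟩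
  classical
  obtain ⟨a, ha⟩ : ∃ a, Nat.find hex = a + 1 := by
    refine Nat.exists_eq_succ_of_ne_zero fun h0 => ?_
    have := Nat.find_spec hex
    rw [h0] at this
    simp at this
    omega
  have h₁ := Nat.find_spec hex
  have h₂ := Nat.find_min hex (m := a) (by omega)
  rw [ha] at h₁
  have h₃ : i / 2 ^ a ≤ l / 2 ^ a := Nat.div_le_div_right h.le
  have h₄ : a ∈ heights l := by
    rw [mem_heights, Nat.testBit_eq_decide_div_mod_eq, decide_eq_true_eq]
    rw [pow_succ, ← Nat.div_div_eq_div_mul, ← Nat.div_div_eq_div_mul] at h₁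
    omega
  exact ⟨a, h₄, (div_eq_peakPos_iff h₄).2 ⟨by omega, h₁⟩⟩

theorem height_unique {l i a b : ℕ} (ha : a ∈ heights l) (hb : b ∈ heights l)
    (hia : i / 2 ^ a = peakPos l a) (hib : i / 2 ^ b = peakPos l b) : a = b := by
  rw [div_eq_peakPos_iff ha] at hia
  rw [div_eq_peakPos_iff hb] at hib
  have key : ∀ a b, a < b → i / 2 ^ (a + 1) = l / 2 ^ (a + 1) → i / 2 ^ b = l / 2 ^ b := by
    intro a b h h'
    obtain ⟨c, rfl⟩ := Nat.exists_eq_add_of_lt h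
    rw [show a + c + 1 = a + 1 + c by ring, pow_add, ← Nat.div_div_eq_div_mul, h',
      Nat.div_div_eq_div_mul]
  rcases lt_trichotomy a b with h | h | h
  · have := key a b h hia.2; omega
  · exact h
  · have := key b a h hib.2; omega

theorem heightAt_spec {l i : ℕ} (h : i < l) :
    heightAt l i ∈ heights l ∧ i / 2 ^ heightAt l i = peakPos l (heightAt l i) := by
  obtain ⟨a, ha, hia⟩ := exists_height h
  obtain ⟨b, hb⟩ : ∃ b, (heights l).find? (fun a => decide (i / 2 ^ a = peakPos l a)) = some b :=
    Option.isSome_iff_exists.1 (List.find?_isSome.2 ⟨a, ha, by simpa using hia⟩)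
  rw [heightAt, hb, Option.getD_some]
  exact ⟨List.mem_of_find?_eq_some hb, by simpa using List.find?_some hb⟩

theorem heightAt_le_log (l i : ℕ) : heightAt l i ≤ Nat.log 2 l := by
  rw [heightAt]
  rcases hb : (heights l).find? (fun a => decide (i / 2 ^ a = peakPos l a)) with _ | b
  · simp
  · simpa using le_log_of_mem_heights (List.mem_of_find?_eq_some hb)

theorem peakPos_lt {l a : ℕ} (ha : a ∈ heights l) : (peakPos l a + 1) * 2 ^ a ≤ l := by
  rw [mem_heights, Nat.testBit_eq_decide_div_mod_eq, decide_eq_true_eq] at ha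
  have : peakPos l a + 1 = l / 2 ^ a := by
    rw [peakPos, pow_succ, ← Nat.div_div_eq_div_mul]
    omega
  rw [this]
  exact Nat.div_mul_le_self l (2 ^ a)

section Paths

variable (H : Data → Data) (D : ℕ → Data)

@[simp] theorem length_peaks (l : ℕ) : (peaks H D l).length = (heights l).length := by simp [peaks]

theorem mem_zip_peaks {l a : ℕ} {h : Data} :
    (a, h) ∈ (heights l).zip (peaks H D l) ↔ a ∈ heights l ∧ h = node H D a (peakPos l a) := by
  rw [peaks, List.zip_map_right, List.mem_map]
  simp only [List.zip_eq_zipWith, List.zipWith_self, List.mem_map, Prod.exists, Prod.map_apply,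
    Prod.mk.injEq, id_eq]
  constructor
  · rintro ⟨_, _, ⟨a, ha, rfl, rfl⟩, rfl, rfl⟩
    exact ⟨ha, rfl⟩
  · rintro ⟨ha, rfl⟩
    exact ⟨_, _, ⟨a, ha, rfl, rfl⟩, rfl, rfl⟩

/-- The parent's preimage under the hash function, for a node `h` at position `j` with sibling `s`. -/
def joint (h : Data) (j : ℕ) (s : Data) : Data := if j % 2 = 0 then cons h s else cons s h

theorem pathRoot_cons (h : Data) (j : ℕ) (s : Data) (l : List Data) :
    pathRoot H h j (s :: l) = pathRoot H (H (joint h j s)) (j / 2) l := by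
  rw [pathRoot, joint, apply_ite H]

/-- All hash inputs in the verification of a Merkle path. -/
def pathInputs : Data → ℕ → List Data → List Data
  | _, _, [] => []
  | h, j, s :: l => joint h j s :: pathInputs (H (joint h j s)) (j / 2) l

theorem pathRoot_append (h : Data) (j : ℕ) (l : List Data) (s : Data) :
    pathRoot H h j (l ++ [s]) = H (joint (pathRoot H h j l) (j / 2 ^ l.length) s) := by
  induction l generalizing h j with
  | nil => simp [pathRoot_cons, pathRoot]
  | cons t l ih =>
    rw [List.cons_append, pathRoot_cons, ih, pathRoot_cons, List.length_cons, pow_succ',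
      Nat.div_div_eq_div_mul]

theorem joint_mem_pathInputs (h : Data) (j : ℕ) (l l' : List Data) (s : Data) :
    joint (pathRoot H h j l) (j / 2 ^ l.length) s ∈ pathInputs H h j (l ++ s :: l') := by
  induction l generalizing h j with
  | nil => simp [pathInputs, pathRoot]
  | cons t l ih =>
    rw [List.cons_append, pathRoot_cons, pathInputs, List.length_cons, pow_succ',
      ← Nat.div_div_eq_div_mul]
    exact List.mem_cons_of_mem _ (ih _ _)

/-- What is hashed to obtain the node of height `a + 1` at position `j`. -/
def nodeInput (a j : ℕ) : Data := cons (node H D a (2 * j)) (node H D a (2 * j + 1))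

theorem node_succ (a j : ℕ) : node H D (a + 1) j = H (nodeInput H D a j) := rfl

theorem joint_node (a j : ℕ) :
    joint (node H D a j) j (node H D a (siblingPos j)) = nodeInput H D a (j / 2) := by
  unfold joint siblingPos nodeInput
  split_ifs with h
  · rw [show 2 * (j / 2) = j by omega]
  · rw [show 2 * (j / 2) = j - 1 by omega, show j - 1 + 1 = j by omega]

theorem joint_eq_nodeInput {a j : ℕ} {h s : Data} (hj : joint h j s = nodeInput H D a (j / 2)) :
    h = node H D a j := by
  unfold joint nodeInput at hj
  split_ifs at hj with h'
  · rw [show 2 * (j / 2) = j by omega] at hj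
    exact (Data.cons.inj hj).1
  · rw [show 2 * (j / 2) + 1 = j by omega] at hj
    exact (Data.cons.inj hj).2

theorem pathRoot_node (a s j : ℕ) : pathRoot H (node H D s j) j
    ((List.range a).map fun t => node H D (s + t) (siblingPos (j / 2 ^ t))) =
      node H D (s + a) (j / 2 ^ a) := by
  induction a generalizing s j with
  | zero => simp [pathRoot]
  | succ a ih =>
    rw [List.range_succ_eq_map, List.map_cons, pow_zero, Nat.div_one, add_zero, pathRoot_cons,
      joint_node, ← node_succ H D, List.map_map, show s + (a + 1) = s + 1 + a by ring, pow_succ',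
      ← Nat.div_div_eq_div_mul, ← ih]
    congr 1
    refine List.map_congr_left fun t _ => ?_
    simp only [Function.comp, Nat.div_div_eq_div_mul, pow_succ', Nat.succ_eq_add_one]
    rw [show s + (t + 1) = s + 1 + t by ring]

theorem pathRoot_merklePath (a i : ℕ) :
    pathRoot H (H (D i)) i (merklePath H D a i) = node H D a (i / 2 ^ a) := by
  have := pathRoot_node H D a 0 i
  simp only [zero_add] at this
  exact this

theorem merkleVerify_iff {l i : ℕ} {pk path : List Data} {e : Data} :
    merkleVerify H l pk i e path = true ↔ ∃ a h, (a, h) ∈ (heights l).zip pk ∧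
      i / 2 ^ a = peakPos l a ∧ path.length = a ∧ pathRoot H (H e) i path = h := by
  simp [merkleVerify, and_assoc]

theorem merkleVerify_honest {l i : ℕ} (h : i < l) :
    merkleVerify H l (peaks H D l) i (D i) (merklePath H D (heightAt l i) i) = true := by
  rw [merkleVerify_iff]
  obtain ⟨h₁, h₂⟩ := heightAt_spec h
  refine ⟨_, _, (mem_zip_peaks H D).2 ⟨h₁, rfl⟩, h₂, by simp [merklePath], ?_⟩
  rw [pathRoot_merklePath, h₂]

/-- Without collisions, a path to an honest node starts at an honest node. -/
theorem eq_node_of_pathRoot_eq {N : Set Data} (hN : Set.InjOn H N) (path : List Data) (h : Data)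
    (j s : ℕ) (hp : ∀ d ∈ pathInputs H h j path, d ∈ N)
    (hn : ∀ t j, t < s + path.length → nodeInput H D t j ∈ N)
    (hr : pathRoot H h j path = node H D (s + path.length) (j / 2 ^ path.length)) :
    h = node H D s j := by
  induction path generalizing h j s with
  | nil => simpa [pathRoot] using hr
  | cons t l ih =>
    rw [pathInputs] at hp
    rw [pathRoot_cons, List.length_cons, pow_succ', ← Nat.div_div_eq_div_mul,
      show s + (l.length + 1) = s + 1 + l.length by ring] at hr
    have h₁ := ih _ _ _ (fun d hd => hp d (List.mem_cons_of_mem _ hd))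
      (fun t j ht => hn t j (by rw [List.length_cons]; omega)) hr
    rw [node_succ] at h₁
    exact joint_eq_nodeInput H D (hN (hp _ List.mem_cons_self)
      (hn _ _ (by rw [List.length_cons]; omega)) h₁)

end Paths


/-! ### Runs of the tournament without forgeries -/

/-- The transcript only grows. -/
class Mono {α : Type} (x : StateM Log α) : Prop where
  mono : ∀ s, ∀ d ∈ s.transcript, d ∈ (x.run s).2.transcript

instance {α : Type} (a : α) : Mono (Pure.pure a) := ⟨fun _ _ h => h⟩

instance {α β : Type} (x : StateM Log α) (f : α → StateM Log β) [hx : Mono x]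
    [hf : ∀ a, Mono (f a)] : Mono (x >>= f) :=
  ⟨fun s d h => (hf _).mono _ d (hx.mono s d h)⟩

instance {α : Type} (c : Prop) [Decidable c] (x y : StateM Log α) [hx : Mono x] [hy : Mono y] :
    Mono (if c then x else y) := by split_ifs <;> assumption

namespace Setting

variable (I : Setting)

instance (p q r w) : Mono (I.ask p q r w) := ⟨fun _ _ h => List.mem_cons_of_mem _ h⟩

instance (p l r) : Mono (I.getClaim p l r) := by unfold getClaim; infer_instance

instance (p c a j h) : Mono (I.bisect p c a j h) := by
  induction a generalizing j h with
  | zero => unfold bisect; infer_instance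
  | succ a ih => unfold bisect; infer_instance

theorem mono_monologue_aux (l : ℕ) (c : Claim I.n) (d : Data) (c' : Option (Claim I.n)) :
    Mono (α := Outcome I.n) (match c' with
      | none => pure Outcome.challengerLoses
      | some c' =>
        if c'.last = lastEntry c.last d.toList ∧ (l = c.size → c'.peaks = c.peaks) then
          pure (Outcome.nested c')
        else pure Outcome.challengerLoses) := by
  rcases c' with _ | c' <;> dsimp only <;> infer_instance

instance (p l c) : Mono (I.monologue p l c) := by
  unfold monologue
  have := I.mono_monologue_aux l c
  infer_instance

theorem mono_challenge_aux (p : Fin I.n) (c : Claim I.n) (z : Option (ℕ × Data)) :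
    Mono (α := Outcome I.n) (match z with
      | none => pure Outcome.challengerLoses
      | some z => do
        if ← I.bisect p c z.1 (peakPos c.size z.1) z.2 then
          pure Outcome.challengerLoses
        else
          pure Outcome.responderLoses) := by
  rcases z with _ | z <;> dsimp only <;> infer_instance

instance (p l c) : Mono (I.challenge p l c) := by
  unfold challenge
  have := I.mono_challenge_aux p c
  infer_instance

instance (p l st) : Mono (I.step p l st) := by
  induction st with
  | nil =>
    have : ∀ (c : Option (Claim I.n)), Mono (α := List (Claim I.n)) (match c with
        | none => pure []
        | some c => pure [c]) := by
      rintro (_ | c) <;> dsimp only <;> infer_instance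
    unfold step
    infer_instance
  | cons c st ih =>
    have : ∀ (o : Outcome I.n), Mono (α := List (Claim I.n)) (match o with
        | .challengerLoses => pure (c :: st)
        | .responderLoses => I.step p l st
        | .nested c' => pure (c' :: c :: st)) := by
      rintro (_ | _ | c') <;> dsimp only <;> infer_instance
    rw [step]
    infer_instance

end Setting

instance {α β : Type} (f : β → α → StateM Log β) [h : ∀ b a, Mono (f b a)] (l : List α) (b : β) :
    Mono (l.foldlM f b) := by
  induction l generalizing b with
  | nil => rw [List.foldlM_nil]; infer_instance
  | cons a l ih => rw [List.foldlM_cons]; infer_instance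

instance {α β : Type} (f : α → StateM Log β) [h : ∀ a, Mono (f a)] (l : List α) :
    Mono (l.mapM f) := by
  induction l with
  | nil => rw [List.mapM_nil]; infer_instance
  | cons a l ih => rw [List.mapM_cons]; infer_instance

/-- If all entries of the transcript at the end of `x` are in `G`, then `Q` holds at that time. -/
def Triple {α : Type} (G : Set Data) (s : Log) (x : StateM Log α) (Q : α → Log → Prop) : Prop :=
  (∀ d ∈ (x.run s).2.transcript, d ∈ G) → Q (x.run s).1 (x.run s).2

namespace Triple

variable {α β : Type} {G : Set Data} {s : Log}

theorem pure {a : α} {Q : α → Log → Prop} (h : Q a s) : Triple G s (Pure.pure a) Q := fun _ => h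

/-- The assumption on the transcript concerns the end of the whole program. Since messages are only
ever added, it also covers the end of the first part. -/
theorem bind {x : StateM Log α} {f : α → StateM Log β} {Q : α → Log → Prop} {R : β → Log → Prop}
    (hx : Triple G s x Q) (hm : ∀ a, Mono (f a)) (hf : ∀ a s', Q a s' → Triple G s' (f a) R) :
    Triple G s (x >>= f) R :=
  fun h => hf _ _ (hx fun d hd => h d ((hm _).mono _ d hd)) h

theorem mono {x : StateM Log α} {Q Q' : α → Log → Prop} (hx : Triple G s x Q)
    (h : ∀ a s', Q a s' → Q' a s') : Triple G s x Q' :=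
  fun hG => h _ _ (hx hG)

theorem and {x : StateM Log α} {Q Q' : α → Log → Prop} (hx : Triple G s x Q)
    (hx' : Triple G s x Q') : Triple G s x fun a s' => Q a s' ∧ Q' a s' :=
  fun hG => ⟨hx hG, hx' hG⟩

theorem ite {c : Prop} [Decidable c] {x y : StateM Log α} {Q : α → Log → Prop}
    (hx : c → Triple G s x Q) (hy : ¬ c → Triple G s y Q) : Triple G s (if c then x else y) Q := by
  split_ifs with h
  · exact hx h
  · exact hy h

end Triple

namespace Setting

variable (I : Setting)

/-- What is hashed in the Merkle tree of an honest prover with ledger `L`, and in the verification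
of the messages in `G`. -/
def hashInputs (L : List Data) (G : Set Data) : Set Data :=
  {d | d ∈ G ∨ (∃ i ≤ L.length, d = I.entry L i) ∨
    (∃ a ≤ L.length, ∃ j, d = nodeInput I.hash (I.entry L) a j) ∨
    ∃ i ≤ L.length, ∃ z ∈ G, d ∈ pathInputs I.hash (I.hash (z.nth 0)) i (z.nth 1).toList}

/-- The messages in `G` contain neither hash collisions nor wrong transitions that the oracles
accept. `R i` holds for the transactions that the consensus oracle accepts `i` places after the end
of the ledger `L` of the honest prover `P`. -/
structure Unforged (P : Fin I.n) (L : List Data) (G : Set Data) (R : ℕ → Data → Prop) : Prop where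
  ledger : I.ledger P = some L
  ne_nil : ∀ tx ∈ L, tx ≠ nil
  hd : ∀ d ∈ G, d.hd ∈ G
  tl : ∀ d ∈ G, d.tl ∈ G
  inj : Set.InjOn I.hash (I.hashInputs L G)
  prove : ∀ i < L.length, I.sδ (I.commit (I.state L i)) (txAt L (i + 1))
    (I.prove (I.state L i) (txAt L (i + 1))) = some (I.commit (I.state L (i + 1)))
  exec : ∀ i < L.length, ∀ z ∈ G, ∀ com,
    I.sδ (I.commit (I.state L i)) (txAt L (i + 1)) (z.nth 2) = some com →
      com = I.commit (I.state L (i + 1))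
  complete : ∀ i < L.length, ∀ π, I.co (txAt L i) (txAt L (i + 1)) π = true
  sound : ∀ i < L.length, ∀ z ∈ G,
    I.co (txAt L i) (z.nth 0).hd (z.nth 1) = true → (z.nth 0).hd = txAt L (i + 1)
  chain_zero : R 0 (txAt L L.length)
  chain_succ : ∀ i tx, R i tx → ∀ z ∈ G, I.co tx (z.nth 0).hd (z.nth 1) = true →
    R (i + 1) (z.nth 0).hd
  chain_lt : ∀ i tx, R i tx → i < I.window

end Setting

theorem lt_of_two_pow_le {a m : ℕ} (h : 2 ^ a ≤ m) : a < m := Nat.lt_two_pow_self.trans_le h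

theorem Data.nth_zero (d : Data) : d.nth 0 = d.hd := by cases d <;> rfl

theorem Data.nth_succ (d : Data) (i : ℕ) : d.nth (i + 1) = d.tl.nth i := by
  cases d <;> simp [nth]

theorem pathInputs_take (H : Data → Data) (h : Data) (j : ℕ) (path : List Data) (a : ℕ) :
    ∀ d ∈ pathInputs H h j (path.take a), d ∈ pathInputs H h j path := by
  induction path generalizing h j a with
  | nil => simp
  | cons t l ih =>
    cases a with
    | zero => simp [pathInputs]
    | succ a =>
      intro d hd
      rw [List.take_succ_cons, pathInputs, List.mem_cons] at hd
      rw [pathInputs, List.mem_cons]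
      exact hd.imp_right (ih _ _ _ d)

namespace Setting

variable {I : Setting} {P : Fin I.n} {L : List Data} {G : Set Data} {R : ℕ → Data → Prop}

/-- A message in `G` opens leaf `i` of the claim `c` as `e`. -/
def Opens (I : Setting) (G : Set Data) (c : Claim I.n) (i : ℕ) (e : Data) (path : List Data) :
    Prop :=
  (∃ z ∈ G, z.nth 0 = e ∧ (z.nth 1).toList = path) ∧
    merkleVerify I.hash c.size c.peaks i e path = true

/-- The verifier has checked the peaks and the last entry of the claim. -/
def ValidClaim (I : Setting) (G : Set Data) (c : Claim I.n) : Prop :=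
  1 ≤ c.size ∧ c.peaks.length = (heights c.size).length ∧
    ∃ path, Opens I G c (c.size - 1) c.last path

/-- The claim of an honest prover. -/
def trueClaim (I : Setting) (P : Fin I.n) (L : List Data) : Claim I.n :=
  ⟨P, L.length + 1, peaks I.hash (I.entry L) (L.length + 1), I.entry L L.length⟩

theorem nodeInput_mem {a : ℕ} (h : a ≤ L.length) (j : ℕ) :
    nodeInput I.hash (I.entry L) a j ∈ I.hashInputs L G := .inr (.inr (.inl ⟨a, h, j, rfl⟩))

namespace Unforged

variable (U : Unforged I P L G R)
include U

theorem nth_mem {d : Data} (h : d ∈ G) (i : ℕ) : d.nth i ∈ G := by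
  induction i generalizing d with
  | zero => rw [nth_zero]; exact U.hd d h
  | succ i ih => rw [nth_succ]; exact ih (U.tl d h)

theorem mem_of_mem_toList {d e : Data} (h : d ∈ G) (he : e ∈ d.toList) : e ∈ G := by
  induction d with
  | nil => simp at he
  | cons a b _ ih =>
    rcases List.mem_cons.1 he with rfl | he
    · exact U.hd _ h
    · exact ih (U.tl _ h) he

theorem ask (s : Log) (p : Fin I.n) (q : Query) (r w : ℕ) : Triple G s (I.ask p q r w) fun m s' =>
    m ∈ G ∧ (∀ L', I.ledger p = some L' → m = I.honest L' q) ∧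
      s'.rounds = s.rounds + r ∧ s'.words = s.words + w := by
  intro h
  refine ⟨?_, ?_, rfl, rfl⟩
  · exact U.hd _ (U.tl _ (U.tl _ (h _ List.mem_cons_self)))
  · intro L' hL'
    show (match I.ledger p with
      | some L => I.honest L q
      | none => I.adv w (ofList s.transcript) (ofList [ofNat p, q.encode])) = _
    rw [hL']

theorem txAt_succ_ne_nil {i : ℕ} (h : i < L.length) : txAt L (i + 1) ≠ nil := by
  rw [txAt, List.getD_cons_succ, List.getD_eq_getElem _ _ h]
  exact U.ne_nil _ (List.getElem_mem h)

/-- A path in a message that leads to an honest node starts at an honest leaf. -/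
theorem eq_entry {c : Claim I.n} {i : ℕ} {e : Data} {path : List Data} (hi : i ≤ L.length)
    (ho : Opens I G c i e path) {a : ℕ} (ha : a ≤ L.length) (hap : a ≤ path.length)
    (h : pathRoot I.hash (I.hash e) i (path.take a) = node I.hash (I.entry L) a (i / 2 ^ a)) :
    e = I.entry L i := by
  obtain ⟨⟨z, hz, rfl, rfl⟩, -⟩ := ho
  have hlen : ((z.nth 1).toList.take a).length = a := by simpa using hap
  have h₁ := eq_node_of_pathRoot_eq I.hash (I.entry L) U.inj ((z.nth 1).toList.take a)
    (I.hash (z.nth 0)) i 0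
    (fun d hd => .inr (.inr (.inr ⟨i, hi, z, hz, pathInputs_take _ _ _ _ _ d hd⟩)))
    (fun t j ht => nodeInput_mem (by omega) j) (by rw [h, hlen, zero_add])
  exact U.inj (.inl (U.nth_mem hz 0)) (.inr (.inl ⟨i, hi, rfl⟩)) h₁

/-- The Merkle proof must end in a peak above leaf `i`. If every such peak is honest, absence of
collisions makes the whole path honest, down to the leaf. -/
theorem eq_entry_of_peak {c : Claim I.n} (hc : c.size ≤ L.length + 1) {i : ℕ} (hi : i ≤ L.length)
    {e : Data} {path : List Data} (ho : Opens I G c i e path)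
    (h : ∀ a h, (a, h) ∈ (heights c.size).zip c.peaks → i / 2 ^ a = peakPos c.size a →
      h = node I.hash (I.entry L) a (peakPos c.size a)) : e = I.entry L i := by
  obtain ⟨a, h', hz, h₁, h₂, h₃⟩ := (merkleVerify_iff _).1 ho.2
  have h₄ := lt_of_two_pow_le (two_pow_le_of_mem_heights (List.of_mem_zip hz).1)
  refine U.eq_entry hi ho (a := a) (by omega) h₂.ge ?_
  rw [List.take_of_length_le h₂.le, h₃, h₁, h a h' hz h₁]

end Unforged

end Setting


/-! ### The bisection game against and by an honest prover. -/

namespace Setting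

variable {I : Setting} {P : Fin I.n} {L : List Data} {G : Set Data} {R : ℕ → Data → Prop}

theorem justify_nth_zero (L : List Data) (i : ℕ) : (I.justify L i).nth 0 = I.entry L i := rfl

/-- All opened leaves in the subtree of height `a` at position `j` have paths through `h`. -/
def Through (I : Setting) (G : Set Data) (c : Claim I.n) (a j : ℕ) (h : Data) : Prop :=
  ∀ i e path, i / 2 ^ a = j → Opens I G c i e path →
    a ≤ path.length ∧ pathRoot I.hash (I.hash e) i (path.take a) = h

/-- The leaf before the subtree of height `a` at position `j` can only be opened honestly. -/
def HonestBefore (I : Setting) (L : List Data) (G : Set Data) (c : Claim I.n) (a j : ℕ) : Prop :=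
  0 < j → ∀ e path, Opens I G c (j * 2 ^ a - 1) e path → e = I.entry L (j * 2 ^ a - 1)

theorem bisect_cost (U : Unforged I P L G R) (s : Log) (p : Fin I.n) (c : Claim I.n) (a j : ℕ)
    (h : Data) : Triple G s (I.bisect p c a j h) fun _ s' => s'.rounds ≤ s.rounds + a ∧
      s'.words ≤ s.words + (6 * a + 4 + Nat.log 2 c.size + I.f + I.g) := by
  induction a generalizing s j h with
  | zero =>
    refine .bind (U.ask _ _ _ _ _) inferInstance fun m s₁ ⟨_, _, hr, hw⟩ => .pure ?_
    omega
  | succ a ih =>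
    refine .bind (U.ask _ _ _ _ _) inferInstance fun m s₁ ⟨_, _, hr, hw⟩ => .ite (fun _ => .pure ?_) fun _ => ?_
    · omega
    refine .bind (U.ask _ _ _ _ _) inferInstance fun b s₂ ⟨_, _, hr₂, hw₂⟩ => .ite (fun _ => .pure ?_) fun _ =>
      .ite (fun _ => (ih _ _ _).mono ?_) fun _ => (ih _ _ _).mono ?_
    · omega
    · rintro _ s' ⟨h₁, h₂⟩; omega
    · rintro _ s' ⟨h₁, h₂⟩; omega

/-- In the bisection game an honest challenger finds a forgery of the responder. -/
theorem bisect_challenger (U : Unforged I P L G R) (s : Log) {c : Claim I.n}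
    (hc : c.size ≤ L.length + 1) {a j : ℕ} {h : Data} (hj : (j + 1) * 2 ^ a ≤ c.size)
    (hh : h ≠ node I.hash (I.entry L) a j) (ht : Through I G c a j h)
    (hb : HonestBefore I L G c a j) :
    Triple G s (I.bisect P c a j h) fun b _ => b = false := by
  -- Three invariants descend with the game: the current node is not the honest one, every opening
  -- of a leaf below it passes through it, and the leaf just before its subtree can only be opened
  -- honestly. At a leaf they contradict acceptance: from an honest predecessor, consensus soundness
  -- forces the transaction and execution soundness forces the commitment.
  induction a generalizing s j h with
  | zero =>
    refine .bind (U.ask _ _ _ _ _) inferInstance fun m s₁ ⟨hm, _⟩ => .pure ?_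
    by_contra hok
    rw [Bool.not_eq_false, leafOk, Bool.and_eq_true, Bool.and_eq_true, decide_eq_true_eq,
      decide_eq_true_eq] at hok
    obtain ⟨⟨-, hhash⟩, hok⟩ := hok
    have hne : m.nth 2 ≠ I.entry L j := fun h' => hh (by rw [← hhash, h']; rfl)
    rcases Nat.eq_zero_or_pos j with rfl | hj0
    · rw [if_pos rfl, decide_eq_true_eq] at hok
      exact hne hok
    obtain ⟨j, rfl⟩ := Nat.exists_eq_add_of_lt hj0
    rw [zero_add] at *
    rw [pow_zero, mul_one] at hj
    rw [if_neg (by omega), Bool.and_eq_true, validStep, Bool.and_eq_true, decide_eq_true_eq] at hok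
    obtain ⟨hv, hco, hex⟩ := hok
    rw [Nat.add_sub_cancel] at hv
    have h₁ := hb (by omega) (m.nth 0) (m.nth 1).toList
    rw [pow_zero, mul_one, Nat.add_sub_cancel] at h₁
    have h₂ := h₁ ⟨⟨m, hm, rfl, rfl⟩, hv⟩
    rw [h₂] at hco hex
    have hz : m.tl.tl ∈ G := U.tl _ (U.tl _ hm)
    have h₃ := U.sound j (by omega) _ hz hco
    rw [h₃] at hex
    have h₄ := U.exec j (by omega) _ hz _ hex
    refine hne ?_
    rw [nth_succ, nth_succ]
    have h₅ := U.txAt_succ_ne_nil (i := j) (by omega)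
    rw [← h₃] at h₅
    rw [entry, ← h₃, ← h₄]
    -- Head and tail determine the leaf only if it is a pair. The leaf `nil` is excluded because its
    -- transaction would be the empty string.
    cases h₆ : m.tl.tl.nth 0 with
    | nil => rw [h₆] at h₅; exact absurd rfl h₅
    | cons x y => rfl
  | succ a ih =>
    refine .bind (U.ask _ _ _ _ _) inferInstance fun m s₁ ⟨hm, _⟩ => .ite (fun _ => .pure rfl) fun hok => ?_
    rw [not_or, not_not] at hok
    obtain ⟨hm0, hhash⟩ := hok
    have hmc : cons m.hd m.tl ∈ G := by cases m <;> [exact absurd rfl hm0; exact hm]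
    refine .bind (U.ask _ _ _ _ _) inferInstance fun b s₂ ⟨_, hb', _⟩ => ?_
    rw [hb' L U.ledger, honest, tl_cons]
    refine .ite (fun h' => absurd h' (by simp)) fun _ => ?_
    have hpow : 2 ^ (a + 1) = 2 * 2 ^ a := pow_succ' 2 a
    -- `hashInputs` contains the honest nodes of these heights only. The bound holds because a
    -- subtree of height `a + 1` fits into at most `|L| + 1` leaves.
    have ha : a ≤ L.length := by
      have : 1 * 2 ^ (a + 1) ≤ (j + 1) * 2 ^ (a + 1) := by gcongr; omega
      have := lt_of_two_pow_le (a := a + 1) (m := L.length + 1) (by omega)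
      omega
    -- a path through the node continues through the revealed children
    have hstep : ∀ i e path, i / 2 ^ (a + 1) = j → Opens I G c i e path →
        a ≤ path.length ∧
          pathRoot I.hash (I.hash e) i (path.take a) = if i / 2 ^ a % 2 = 0 then m.hd else m.tl := by
      intro i e path hi ho
      obtain ⟨h₁, h₂⟩ := ht i e path hi ho
      have hil : i ≤ L.length := by
        have := Nat.lt_mul_div_succ i (b := 2 ^ (a + 1)) (by positivity)
        rw [hi, mul_comm] at this
        omega
      obtain ⟨⟨z, hz, rfl, rfl⟩, -⟩ := ho
      have ht₂ : (z.nth 1).toList.take (a + 1) = (z.nth 1).toList.take a ++ [(z.nth 1).toList[a]] :=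
        List.take_succ_eq_append_getElem (by omega)
      have hin := joint_mem_pathInputs I.hash (I.hash (z.nth 0)) i ((z.nth 1).toList.take a) []
        (z.nth 1).toList[a]
      rw [← ht₂] at hin
      rw [ht₂, pathRoot_append, ← hhash] at h₂
      have hlen : ((z.nth 1).toList.take a).length = a := by
        rw [List.length_take]; omega
      have h₃ := U.inj (.inr (.inr (.inr ⟨i, hil, z, hz, pathInputs_take _ _ _ _ _ _ hin⟩)))
        (.inl hmc) h₂
      rw [hlen, joint] at h₃
      refine ⟨by omega, ?_⟩
      split_ifs at h₃ ⊢
      · exact (Data.cons.inj h₃).1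
      · exact (Data.cons.inj h₃).2
    -- If the left child is honest, the disagreement is on the right, and the leaf before the right
    -- subtree lies below the honest left child, hence can only be opened honestly. Otherwise the
    -- game goes left and the preceding leaf stays the same.
    by_cases hl : node I.hash (I.entry L) a (2 * j) = m.hd
    · rw [decide_eq_true hl]
      refine .ite (fun h' => absurd h' (by simp)) fun _ => ih _ ?_ ?_ ?_ ?_
      · rw [hpow] at hj
        calc (2 * j + 1 + 1) * 2 ^ a = (j + 1) * (2 * 2 ^ a) := by ring
          _ ≤ _ := hj
      · intro h'
        refine hh ?_
        rw [← hhash, h', ← hl]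
        rfl
      · intro i e path hi ho
        obtain ⟨h₁, h₂⟩ := hstep i e path
          (by rw [pow_succ, ← Nat.div_div_eq_div_mul, hi]; omega) ho
        exact ⟨h₁, by rw [h₂, if_neg (by omega)]⟩
      · intro _ e path ho
        have hpos : 0 < 2 ^ a := by positivity
        have hdiv : ((2 * j + 1) * 2 ^ a - 1) / 2 ^ a = 2 * j := by
          rw [Nat.div_eq_iff hpos]
          have : (2 * j + 1) * 2 ^ a = 2 * j * 2 ^ a + 2 ^ a := by ring
          omega
        obtain ⟨h₁, h₂⟩ := hstep _ e path
          (by rw [pow_succ, ← Nat.div_div_eq_div_mul, hdiv]; omega) ho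
        refine U.eq_entry ?_ ho ha h₁ ?_
        · have : (2 * j + 1) * 2 ^ a ≤ (j + 1) * 2 ^ (a + 1) := by
            rw [hpow, ← mul_assoc]; gcongr; omega
          omega
        · rw [h₂, hdiv, if_pos (by omega), hl]
    · rw [decide_eq_false hl]
      refine .ite (fun _ => ih _ ?_ (Ne.symm hl) ?_ ?_) fun h' => absurd rfl h'
      · calc (2 * j + 1) * 2 ^ a ≤ (j + 1) * (2 * 2 ^ a) := by
              rw [← mul_assoc]; gcongr; omega
          _ = (j + 1) * 2 ^ (a + 1) := by rw [hpow]
          _ ≤ _ := hj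
      · intro i e path hi ho
        obtain ⟨h₁, h₂⟩ := hstep i e path
          (by rw [pow_succ, ← Nat.div_div_eq_div_mul, hi]; omega) ho
        exact ⟨h₁, by rw [h₂, if_pos (by omega)]⟩
      · intro h0 e path ho
        have : 2 * j * 2 ^ a = j * 2 ^ (a + 1) := by rw [hpow]; ring
        rw [this] at ho ⊢
        exact hb (by omega) e path ho

theorem validStep_honest (U : Unforged I P L G R) {i : ℕ} (hi : i < L.length) :
    I.validStep (I.entry L i) (I.justify L (i + 1)) = true := by
  rw [validStep, Bool.and_eq_true, decide_eq_true_eq]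
  exact ⟨U.complete i hi _, U.prove i hi⟩

/-- In the bisection game an honest responder wins. -/
theorem bisect_responder (U : Unforged I P L G R) (s : Log) (p : Fin I.n) {a j : ℕ}
    (hj : (j + 1) * 2 ^ a ≤ L.length + 1) :
    Triple G s (I.bisect p (trueClaim I P L) a j (node I.hash (I.entry L) a j))
      fun b _ => b = true := by
  induction a generalizing s j with
  | zero =>
    refine .bind (U.ask _ _ _ _ _) inferInstance fun m s₁ ⟨_, hm, _⟩ => .pure ?_
    rw [hm L U.ledger, leafOk, Bool.and_eq_true, Bool.and_eq_true, decide_eq_true_eq,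
      decide_eq_true_eq]
    refine ⟨⟨by simp [honest], rfl⟩, ?_⟩
    rw [pow_zero, mul_one] at hj
    split_ifs with h0
    · subst h0; exact decide_eq_true rfl
    · obtain ⟨j, rfl⟩ := Nat.exists_eq_succ_of_ne_zero h0
      rw [Bool.and_eq_true]
      refine ⟨?_, validStep_honest U (by omega)⟩
      have := merkleVerify_honest I.hash (I.entry L) (l := L.length + 1) (i := j) (by omega)
      rw [← toList_ofList (merklePath ..)] at this
      exact this
  | succ a ih =>
    refine .bind (U.ask _ _ _ _ _) inferInstance fun m s₁ ⟨_, hm, _⟩ => ?_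
    rw [hm L U.ledger]
    refine .ite (fun h => absurd h ?_) fun _ => ?_
    · simp [honest, node]
    refine .bind (U.ask _ _ _ _ _) inferInstance fun b s₂ _ => .ite (fun _ => .pure rfl) fun _ => ?_
    rw [pow_succ'] at hj
    refine .ite (fun _ => ih _ ?_) fun _ => ih _ ?_
    · calc (2 * j + 1) * 2 ^ a ≤ (j + 1) * (2 * 2 ^ a) := by rw [← mul_assoc]; gcongr; omega
        _ ≤ _ := hj
    · calc (2 * j + 1 + 1) * 2 ^ a = (j + 1) * (2 * 2 ^ a) := by ring
        _ ≤ _ := hj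

end Setting


/-! ### Claims, suffix monologues and challenge games. -/

namespace Setting

variable {I : Setting} {P : Fin I.n} {L : List Data} {G : Set Data} {R : ℕ → Data → Prop}

theorem getClaim_spec (U : Unforged I P L G R) (s : Log) (p : Fin I.n) (l r : ℕ) :
    Triple G s (I.getClaim p l r) fun c s' =>
      (∀ c', c = some c' → c'.prover = p ∧ c'.size = l ∧ ValidClaim I G c') ∧
        s'.rounds = s.rounds + r ∧
        s'.words = s.words + ((heights l).length + 2 + heightAt l (l - 1)) := by
  refine .bind (U.ask _ _ _ _ _) inferInstance fun m s₁ ⟨hm, _, hr, hw⟩ =>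
    .ite (fun h => .pure ⟨?_, hr, hw⟩) fun _ => .pure ⟨by simp, hr, hw⟩
  rintro _ ⟨⟩
  exact ⟨rfl, rfl, h.1, h.2.1, _, ⟨m.tl, U.tl _ hm, (nth_succ m 0).symm, by rw [← nth_succ]⟩, h.2.2⟩

theorem getClaim_honest (U : Unforged I P L G R) (s : Log) (r : ℕ) :
    Triple G s (I.getClaim P (L.length + 1) r) fun c _ => c = some (trueClaim I P L) := by
  refine .bind (U.ask _ _ _ _ _) inferInstance fun m s₁ ⟨_, hm, _⟩ => ?_
  rw [hm L U.ledger]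
  have h₁ : ((I.honest L .claim).nth 0).toList = peaks I.hash (I.entry L) (L.length + 1) :=
    toList_ofList _
  have h₂ : ((I.honest L .claim).nth 2).toList =
    merklePath I.hash (I.entry L) (heightAt (L.length + 1) L.length) L.length := toList_ofList _
  refine .ite (fun _ => .pure ?_) fun h => absurd ⟨by omega, by rw [h₁, length_peaks], ?_⟩ h
  · rw [h₁]; rfl
  · rw [h₁, h₂]
    exact merkleVerify_honest I.hash (I.entry L) (by omega)

theorem lastEntry_cons (e d : Data) (l : List Data) :
    lastEntry e (d :: l) = lastEntry (d.nth 0) l := by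
  simp only [lastEntry, List.map_cons, List.getLastD_cons]

theorem chain_of_validChain (U : Unforged I P L G R) {k : ℕ} {e : Data} {l : List Data}
    (hl : ∀ d ∈ l, d ∈ G) (he : R k e.hd) (h : I.validChain e l = true) :
    R (k + l.length) (lastEntry e l).hd := by
  induction l generalizing k e with
  | nil => simpa [lastEntry] using he
  | cons d l ih =>
    rw [validChain, Bool.and_eq_true, validStep, Bool.and_eq_true] at h
    rw [lastEntry_cons, List.length_cons, show k + (l.length + 1) = k + 1 + l.length by ring]
    exact ih (fun d' h' => hl d' (by simp [h']))
      (U.chain_succ k _ he d (hl d (by simp)) h.1.1) h.2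

theorem validChain_honest (U : Unforged I P L G R) {i m : ℕ} (h : i + m ≤ L.length) :
    I.validChain (I.entry L i) ((List.range m).map fun s => I.justify L (i + 1 + s)) = true ∧
      lastEntry (I.entry L i) ((List.range m).map fun s => I.justify L (i + 1 + s)) =
        I.entry L (i + m) := by
  induction m generalizing i with
  | zero => simp [validChain, lastEntry]
  | succ m ih =>
    rw [List.range_succ_eq_map, List.map_cons, List.map_map, validChain, lastEntry_cons, add_zero,
      justify_nth_zero, validStep_honest U (by omega), Bool.true_and]
    have := ih (i := i + 1) (by omega)
    rw [show i + (m + 1) = i + 1 + m by ring]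
    convert this using 4 <;>
    · funext s
      simp only [Function.comp, Nat.succ_eq_add_one]
      congr 1
      ring

/-- An upper bound on the size of the claims that the verifier accepts. -/
def maxSize (I : Setting) (L : List Data) : ℕ := L.length + I.window

/-- An upper bound on the communication in a challenge game. -/
def gameWords (I : Setting) (L : List Data) : ℕ :=
  10 * Nat.log 2 (I.maxSize L) + 11 + I.f + I.g + I.window * (2 + I.f + I.g)

theorem window_pos (U : Unforged I P L G R) : 0 < I.window := U.chain_lt 0 _ U.chain_zero

/-- The entries of the claim `c` continue the ledger `L`. -/
def Extends (L : List Data) (R : ℕ → Data → Prop) (c : Claim I.n) : Prop :=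
  L.length + 1 ≤ c.size ∧ R (c.size - (L.length + 1)) c.last.hd

theorem Extends.size_le (U : Unforged I P L G R) {c : Claim I.n} (h : Extends L R c) :
    c.size ≤ I.maxSize L := by
  have := U.chain_lt _ _ h.2
  have := h.1
  unfold maxSize
  omega

theorem extends_trueClaim (U : Unforged I P L G R) : Extends L R (trueClaim I P L) := by
  refine ⟨le_rfl, ?_⟩
  show R (L.length + 1 - (L.length + 1)) _
  rw [Nat.sub_self]
  exact U.chain_zero

theorem claimWords_le (I : Setting) {l : ℕ} (h : l ≤ I.maxSize L) :
    (heights l).length + 2 + heightAt l (l - 1) ≤ 2 * Nat.log 2 (I.maxSize L) + 3 := by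
  have h₁ := length_heights_le l
  have h₂ := heightAt_le_log l (l - 1)
  have h₃ := Nat.log_mono_right (b := 2) h
  omega

/-- If `c` continues `L`, an accepted suffix lengthens the accepted chain beyond the end of `L`. A
full window of further entries would violate `chain_lt`; this is why such a responder cannot lose
here, and why the new claim is again at most `maxSize`. The second alternative of `hl` is for games
before the honest prover has entered. -/
theorem monologue_spec (U : Unforged I P L G R) (s : Log) (p : Fin I.n) {l : ℕ} {c : Claim I.n}
    (hc : c.size ≤ l) (hl : Extends L R c ∨ l ≤ L.length + 1) :
    Triple G s (I.monologue p l c) fun o s' => s'.rounds = s.rounds ∧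
      s'.words ≤ s.words + (I.window * (2 + I.f + I.g) + 2 * Nat.log 2 (I.maxSize L) + 3) ∧
      (o = .responderLoses → ¬ Extends L R c) ∧
      (∀ c', o = .nested c' → c'.prover = p ∧ c'.size = l ∧ ValidClaim I G c' ∧
        (Extends L R c → Extends L R c')) := by
  have hm : min (l - c.size) I.window * (2 + I.f + I.g) ≤ I.window * (2 + I.f + I.g) := by
    gcongr; omega
  unfold monologue
  refine .bind (U.ask _ _ _ _ _) ?_ fun d s₁ ⟨hd, _, hr, hw⟩ => ?_
  · intro d
    have := fun l => I.mono_monologue_aux l c d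
    infer_instance
  refine .ite (fun _ => .pure ⟨by omega, by omega, by simp, by simp⟩) fun h => ?_
  rw [not_or, not_not, Bool.not_eq_false] at h
  obtain ⟨hlen, hv⟩ := h
  have hchain : Extends L R c →
      R (c.size - (L.length + 1) + min (l - c.size) I.window) (lastEntry c.last d.toList).hd := by
    intro he
    rw [← hlen]
    exact chain_of_validChain U (fun e he => U.mem_of_mem_toList hd he) he.2 hv
  refine .ite (fun h => .pure ⟨by omega, by omega, ?_, by simp⟩) fun h => ?_
  · intro _ he
    have := U.chain_lt _ _ (hchain he)
    omega
  -- This bounds the communication for the claim sent next. A claimed size is not bounded a priori;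
  -- in the first case the bound comes from the chain that has just been checked.
  have hl' : l ≤ I.maxSize L := by
    have := window_pos U
    unfold maxSize
    rcases hl with he | hl
    · have := U.chain_lt _ _ (hchain he)
      have := he.1
      omega
    · omega
  have := claimWords_le I hl'
  refine .bind (getClaim_spec U _ _ _ _) ?_ fun c' s₂ ⟨hc', hr', hw'⟩ => ?_
  · rintro (_ | c') <;> dsimp only <;> infer_instance
  rcases c' with _ | c'
  · exact .pure ⟨by omega, by omega, by simp, by simp⟩
  dsimp only
  refine .ite (fun h' => .pure ⟨by omega, by omega, by simp, ?_⟩)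
    fun _ => .pure ⟨by omega, by omega, by simp, by simp⟩
  rintro _ ⟨⟩
  obtain ⟨h₁, h₂, h₃⟩ := hc' _ rfl
  refine ⟨h₁, h₂, h₃, fun he => ⟨?_, ?_⟩⟩
  · have := he.1; omega
  · rw [h'.1, h₂]
    have := hchain he
    have := he.1
    rwa [show l - (L.length + 1) = c.size - (L.length + 1) + min (l - c.size) I.window by omega]

theorem monologue_honest (U : Unforged I P L G R) (s : Log) {c : Claim I.n}
    (hc : c.size ≤ L.length + 1) (hc₀ : 1 ≤ c.size) (hlast : c.last = I.entry L (c.size - 1))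
    (hp : c.peaks = peaks I.hash (I.entry L) c.size) :
    Triple G s (I.monologue P (L.length + 1) c) fun o _ =>
      o = .responderLoses ∨ o = .nested (trueClaim I P L) := by
  unfold monologue
  refine .bind (U.ask _ _ _ _ _) ?_ fun d s₁ ⟨_, hd, _⟩ => ?_
  · intro d
    have := fun l => I.mono_monologue_aux l c d
    infer_instance
  rw [hd L U.ledger]
  obtain ⟨i, hi⟩ : ∃ i, c.size = i + 1 := ⟨c.size - 1, by omega⟩
  rw [hi, Nat.add_sub_cancel] at hlast
  have htl : (I.honest L (.suffix c.size (min (L.length + 1 - c.size) I.window))).toList =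
      (List.range (min (L.length + 1 - c.size) I.window)).map fun s => I.justify L (i + 1 + s) := by
    rw [honest, toList_ofList, hi]
  obtain ⟨h₁, h₂⟩ := validChain_honest U (i := i)
    (m := min (L.length + 1 - c.size) I.window) (by omega)
  refine .ite (fun h => ?_) fun _ => .ite (fun _ => .pure (.inl rfl)) fun hw => ?_
  · rw [htl, hlast, h₁] at h
    simp at h
  refine .bind (getClaim_honest U _ _) ?_ fun c' s₂ hc' => ?_
  · rintro (_ | c') <;> dsimp only <;> infer_instance
  subst hc'
  dsimp only
  refine .ite (fun _ => .pure (.inr rfl)) fun h => absurd ⟨?_, fun h' => ?_⟩ h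
  · rw [htl, hlast, h₂]
    show I.entry L L.length = _
    congr 1
    omega
  · rw [hp, ← h']; rfl

/-- Games that end in nesting get a separate, much smaller bound for the rounds: they consist of a
monologue only. The rounds saved are invested in the new claim in `Cost`. -/
theorem challenge_spec (U : Unforged I P L G R) (s : Log) (p : Fin I.n) {l : ℕ} {c : Claim I.n}
    (hc : c.size ≤ l) (hl : Extends L R c ∨ l ≤ L.length + 1)
    (hp : c.peaks.length = (heights c.size).length) :
    Triple G s (I.challenge p l c) fun o s' =>
      s'.rounds ≤ s.rounds + (Nat.log 2 (I.maxSize L) + 1) ∧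
      s'.words ≤ s.words + I.gameWords L ∧
      (∀ c', o = .nested c' → s'.rounds ≤ s.rounds + 1 ∧ c'.prover = p ∧ c'.size = l ∧
        ValidClaim I G c' ∧ (Extends L R c → Extends L R c')) := by
  have hsz : c.size ≤ I.maxSize L := by
    rcases hl with he | hl
    · exact he.size_le U
    · have := window_pos U
      unfold maxSize
      omega
  have hlog := Nat.log_mono_right (b := 2) hsz
  have hph := length_heights_le c.size
  unfold challenge gameWords
  refine .bind (U.ask _ _ _ _ _) ?_ fun m s₁ ⟨_, _, hr, hw⟩ => ?_
  · intro m
    have := I.mono_challenge_aux p c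
    infer_instance
  refine .ite (fun _ => .pure ⟨by omega, by omega, by simp⟩) fun _ => .ite (fun _ => ?_) fun _ => ?_
  · refine (monologue_spec U s₁ p hc hl).mono ?_
    rintro o s' ⟨h₁, h₂, -, h₃⟩
    exact ⟨by omega, by omega, fun c' h => ⟨by omega, h₃ c' h⟩⟩
  · rcases hz : ((heights c.size).zip c.peaks)[m.tl.toNat]? with _ | ⟨a, h⟩
    · exact .pure ⟨by omega, by omega, by simp⟩
    · have ha := le_log_of_mem_heights (List.of_mem_zip (List.mem_of_getElem? hz)).1
      refine .bind (bisect_cost U _ _ _ _ _ _) inferInstance fun b s₂ ⟨h₁, h₂⟩ =>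
        .ite (fun _ => .pure ⟨?_, ?_, by simp⟩) fun _ => .pure ⟨?_, ?_, by simp⟩ <;>
      dsimp only at h₁ h₂ <;> omega

/-- An honest responder does not lose. -/
theorem challenge_responder (U : Unforged I P L G R) (s : Log) (p : Fin I.n) {l : ℕ}
    (hl : L.length + 1 ≤ l) :
    Triple G s (I.challenge p l (trueClaim I P L)) fun o _ => o ≠ .responderLoses := by
  unfold challenge
  refine .bind (U.ask _ _ _ _ _) ?_ fun m s₁ _ => ?_
  · intro m
    have := I.mono_challenge_aux p (trueClaim I P L)
    infer_instance
  refine .ite (fun _ => .pure (by simp)) fun _ => .ite (fun _ => ?_) fun _ => ?_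
  · refine (monologue_spec U s₁ p hl (.inl (extends_trueClaim U))).mono ?_
    rintro o s' ⟨-, -, h, -⟩ ho
    exact h ho (extends_trueClaim U)
  · rcases hz : ((heights (trueClaim I P L).size).zip (trueClaim I P L).peaks)[m.tl.toNat]?
      with _ | ⟨a, h⟩
    · exact .pure (by simp)
    · obtain ⟨ha, rfl⟩ := (mem_zip_peaks _ _).1 (List.mem_of_getElem? hz)
      refine .bind (bisect_responder U _ p (peakPos_lt ha)) inferInstance fun b s₂ hb =>
        .ite (fun _ => .pure (by simp)) fun h => absurd hb h

/-- The tree of height `a` starts at `l` with the bits `0, …, a` cleared, so lower trees start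
further to the right. -/
theorem peakPos_mul_le {l a b : ℕ} (h : b ≤ a) : peakPos l a * 2 ^ a ≤ peakPos l b * 2 ^ b := by
  have key : ∀ a, peakPos l a * 2 ^ a = l / 2 ^ (a + 1) * 2 ^ (a + 1) := by
    intro a; rw [peakPos, pow_succ]; ring
  rw [key, key]
  obtain ⟨c, rfl⟩ := Nat.exists_eq_add_of_le h
  rw [show b + c + 1 = b + 1 + c by ring, pow_add, ← Nat.div_div_eq_div_mul,
    mul_comm (2 ^ (b + 1)), ← mul_assoc]
  gcongr
  exact Nat.div_mul_le_self _ _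

/-- An honest challenger does not lose. -/
theorem challenge_challenger (U : Unforged I P L G R) (s : Log) {c : Claim I.n}
    (hc : c.size ≤ L.length + 1) (hv : ValidClaim I G c) :
    Triple G s (I.challenge P (L.length + 1) c) fun o _ =>
      o = .responderLoses ∨ o = .nested (trueClaim I P L) := by
  obtain ⟨hc₀, hlen, path, ho⟩ := hv
  unfold challenge
  refine .bind (U.ask _ _ _ _ _) ?_ fun m s₁ ⟨_, hm, _⟩ => ?_
  · intro m
    have := I.mono_challenge_aux P c
    infer_instance
  rw [hm L U.ledger, honest]
  rcases hf : ((heights c.size).zip c.peaks).findIdx? (fun z =>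
          decide (node I.hash (I.entry L) z.1 (peakPos c.size z.1) ≠ z.2)) with _ | k
  · have hall : ∀ z ∈ (heights c.size).zip c.peaks,
        z.2 = node I.hash (I.entry L) z.1 (peakPos c.size z.1) := by
      intro z hz
      exact (not_not.1 (of_decide_eq_false (List.findIdx?_eq_none_iff.1 hf z hz))).symm
    rw [hf]
    refine .ite (fun h => absurd h (by simp)) fun _ => .ite (fun _ => ?_) fun h => absurd rfl h
    refine monologue_honest U _ hc hc₀ ?_ ?_
    · exact U.eq_entry_of_peak hc (by omega) ho fun a h hz _ => hall _ hz
    · refine List.ext_getElem (by rw [hlen, length_peaks]) fun i h₁ h₂ => ?_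
      have h₃ : i < (heights c.size).length := by omega
      have := hall (((heights c.size).zip c.peaks)[i]'(by simp; omega)) (List.getElem_mem _)
      rw [List.getElem_zip] at this
      dsimp only at this
      rw [this]
      simp [peaks]
  · rw [hf]
    refine .ite (fun h => absurd h (by simp)) fun _ => .ite (fun h => absurd h (by simp)) fun _ => ?_
    obtain ⟨hk, hne, hbefore⟩ := List.findIdx?_eq_some_iff_getElem.1 hf
    have hk₁ : k < (heights c.size).length := by simp at hk; omega
    have hk₂ : k < c.peaks.length := by omega
    dsimp only
    rw [tl_cons, toNat_ofNat, List.getElem?_eq_getElem hk, List.getElem_zip]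
    dsimp only
    have ha : (heights c.size)[k] ∈ heights c.size := List.getElem_mem _
    have hidx : ∀ a h, (a, h) ∈ (heights c.size).zip c.peaks → ∃ (i : ℕ) (h₁ : i < (heights c.size).length)
        (h₂ : i < c.peaks.length), (heights c.size)[i] = a ∧ c.peaks[i] = h := by
      intro a h hz
      obtain ⟨i, hi, hz⟩ := List.mem_iff_getElem.1 hz
      rw [List.getElem_zip] at hz
      simp only [List.length_zip, lt_min_iff] at hi
      exact ⟨i, hi.1, hi.2, (Prod.mk.inj hz).1, (Prod.mk.inj hz).2⟩
    have hsorted : ∀ (i : ℕ) (h₁ : i < (heights c.size).length), k < i →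
        (heights c.size)[i] ≤ (heights c.size)[k] := by
      intro i h₁ hki
      have : (heights c.size).Pairwise (· > ·) :=
        List.pairwise_reverse.2 Nat.bitIndices_sorted.pairwise
      exact (List.pairwise_iff_getElem.1 this k i hk₁ h₁ hki).le
    -- The invariants hold at the named peak. It differs by choice. An opening of a leaf below it
    -- ends in it, because a leaf lies below one peak only. The leaf before it lies below an earlier
    -- peak, and earlier peaks are honest because the named one is the first that differs.
    refine .bind (bisect_challenger U _ hc (peakPos_lt ha) ?_ ?_ ?_) inferInstance
      fun b s₂ hb => .ite (fun h => absurd hb (by simp [h])) fun _ => .pure (.inl rfl)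
    · simp only [List.getElem_zip, decide_eq_true_eq] at hne
      exact Ne.symm hne
    · intro i e path hi ho
      obtain ⟨a, h, hz, h₁, h₂, h₃⟩ := (merkleVerify_iff _).1 ho.2
      obtain ⟨k', hk', hk'', rfl, rfl⟩ := hidx a h hz
      have h₄ := height_unique ha (List.getElem_mem hk') hi h₁
      have h₅ : k = k' := (nodup_heights _).getElem_inj_iff.1 h₄
      subst h₅
      exact ⟨h₂.ge, by rw [List.take_of_length_le h₂.le, h₃]⟩
    · intro hpos e path ho
      have hpow : 0 < 2 ^ (heights c.size)[k] := by positivity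
      have hlt := peakPos_lt ha
      rw [add_mul, one_mul] at hlt
      -- The subtree does not start at leaf `0`, so the index of the preceding leaf is not
      -- truncated.
      have hmul : 1 * 1 ≤ peakPos c.size (heights c.size)[k] * 2 ^ (heights c.size)[k] :=
        Nat.mul_le_mul hpos hpow
      refine U.eq_entry_of_peak hc (by omega) ho fun a h hz hdiv => ?_
      obtain ⟨k', hk', hk'', rfl, rfl⟩ := hidx a h hz
      have hkk : k' < k := by
        by_contra hge
        have hle : (heights c.size)[k'] ≤ (heights c.size)[k] := by
          rcases eq_or_lt_of_le (not_lt.1 hge) with rfl | hlt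
          · exact le_rfl
          · exact hsorted k' hk' hlt
        have h₁ := peakPos_mul_le (l := c.size) hle
        have h₂ := Nat.div_mul_le_self
          (peakPos c.size (heights c.size)[k] * 2 ^ (heights c.size)[k] - 1)
          (2 ^ (heights c.size)[k'])
        rw [hdiv] at h₂
        omega
      have := hbefore k' hkk
      simp only [List.getElem_zip, decide_eq_true_eq, not_not] at this
      exact this.symm

end Setting


/-! ### Amortized costs and invariants of the tournament. -/

namespace Setting

variable {I : Setting} {P : Fin I.n} {L : List Data} {G : Set Data} {R : ℕ → Data → Prop}

/-- The amortized costs of `k` steps of the tournament that lead from the claims `st` and the log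
`s` to the claims `st'` and the log `s'`: every remaining claim pays for a lost challenge game. -/
def Cost (I : Setting) (L : List Data) (k : ℕ) (s : Log) (st : List (Claim I.n)) (s' : Log)
    (st' : List (Claim I.n)) : Prop :=
  s'.rounds + (Nat.log 2 (I.maxSize L) + 1) * st'.length ≤
      s.rounds + (Nat.log 2 (I.maxSize L) + 1) * st.length + k * (Nat.log 2 (I.maxSize L) + 2) ∧
    s'.words + I.gameWords L * st'.length ≤
      s.words + I.gameWords L * st.length + k * (2 * I.gameWords L)

theorem Cost.trans {k k' : ℕ} {s s' s'' : Log} {st st' st'' : List (Claim I.n)}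
    (h : Cost I L k s st s' st') (h' : Cost I L k' s' st' s'' st'') :
    Cost I L (k + k') s st s'' st'' := by
  obtain ⟨h₁, h₂⟩ := h
  obtain ⟨h₃, h₄⟩ := h'
  constructor
  · rw [Nat.add_mul k k']; omega
  · rw [Nat.add_mul k k']; omega

/-- The claims before the honest prover enters. -/
def Before (I : Setting) (L : List Data) (G : Set Data) (l : ℕ) (st : List (Claim I.n)) : Prop :=
  l ≤ L.length + 1 ∧ ∀ c ∈ st, ValidClaim I G c ∧ c.size ≤ l

/-- The claims after the honest prover has entered. -/
def After (I : Setting) (P : Fin I.n) (L : List Data) (G : Set Data) (R : ℕ → Data → Prop) (l : ℕ)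
    (st : List (Claim I.n)) : Prop :=
  L.length + 1 ≤ l ∧ ∃ above below, st = above ++ trueClaim I P L :: below ∧
    ∀ c ∈ above, ValidClaim I G c ∧ Extends L R c ∧ c.size ≤ l

/-- The accounts balance as follows. A game that the challenger loses ends the step and is charged
to the entering prover. A game that the responder loses is paid for by the removed claim. Nesting,
or a claim on an empty stack, takes one round and must endow the new claim with `log + 1` rounds,
hence `log + 2` per step. -/
theorem step_before (U : Unforged I P L G R) (s : Log) (p : Fin I.n) {l : ℕ}
    {st : List (Claim I.n)} (h : Before I L G l st) :
    Triple G s (I.step p l st) fun st' s' => Before I L G l st' ∧ Cost I L 1 s st s' st' := by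
  obtain ⟨hl, hst⟩ := h
  induction st generalizing s with
  | nil =>
    have hm : l ≤ I.maxSize L := by
      have := window_pos U
      unfold maxSize; omega
    have := claimWords_le I hm
    unfold step
    refine .bind (getClaim_spec U _ _ _ _) ?_ fun c s₁ ⟨hc, hr, hw⟩ => ?_
    · rintro (_ | c) <;> dsimp only <;> infer_instance
    rcases c with _ | c
    · refine .pure ⟨⟨hl, hst⟩, ?_, ?_⟩
      · simp; omega
      · unfold gameWords; simp; omega
    · obtain ⟨h₁, h₂, h₃⟩ := hc _ rfl
      refine .pure ⟨⟨hl, ?_⟩, ?_, ?_⟩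
      · simp only [List.mem_singleton]
        rintro _ rfl
        exact ⟨h₃, h₂.le⟩
      · simp; omega
      · unfold gameWords; simp; omega
  | cons c st ih =>
    obtain ⟨hv, hc⟩ := hst c (by simp)
    rw [step]
    refine .bind (challenge_spec U s p hc (.inr hl) hv.2.1) ?_ fun o s₁ ⟨hr, hw, hn⟩ => ?_
    · rintro (_ | _ | c) <;> dsimp only <;> infer_instance
    rcases o with _ | _ | c'
    · refine .pure ⟨⟨hl, hst⟩, ?_, ?_⟩ <;> omega
    · refine (ih s₁ fun c hc => hst c (by simp [hc])).mono fun st' s' ⟨h₁, h₂, h₃⟩ => ⟨h₁, ?_, ?_⟩ <;>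
        rw [List.length_cons, mul_add] <;> omega
    · obtain ⟨h₁, -, h₂, h₃, -⟩ := hn c' rfl
      refine .pure ⟨⟨hl, ?_⟩, ?_, ?_⟩
      · intro d hd
        rcases List.mem_cons.1 hd with rfl | hd
        · exact ⟨h₃, h₂.le⟩
        · exact hst d hd
      · rw [List.length_cons (as := c :: st), mul_add]; omega
      · rw [List.length_cons (as := c :: st), mul_add]; omega

/-- The honest prover wins on entering. -/
theorem step_honest (U : Unforged I P L G R) (s : Log) {st : List (Claim I.n)}
    (h : Before I L G (L.length + 1) st) :
    Triple G s (I.step P (L.length + 1) st) fun st' _ => After I P L G R (L.length + 1) st' := by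
  obtain ⟨-, hst⟩ := h
  induction st generalizing s with
  | nil =>
    unfold step
    refine .bind (getClaim_honest U _ _) ?_ fun c s₁ hc => ?_
    · rintro (_ | c) <;> dsimp only <;> infer_instance
    subst hc
    exact .pure ⟨le_rfl, [], [], rfl, by simp⟩
  | cons c st ih =>
    obtain ⟨hv, hc⟩ := hst c (by simp)
    rw [step]
    refine .bind (challenge_challenger U s hc hv) ?_ fun o s₁ ho => ?_
    · rintro (_ | _ | c) <;> dsimp only <;> infer_instance
    rcases ho with rfl | rfl
    · exact ih s₁ fun c hc => hst c (by simp [hc])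
    · exact .pure ⟨le_rfl, [], c :: st, rfl, by simp⟩

theorem length_peaks_trueClaim :
    (trueClaim I P L).peaks.length = (heights (trueClaim I P L).size).length := length_peaks _ _ _

/-- A step never gets past the honest claim, since an honest responder does not lose. Nothing has to
be known about the claims below it, and those above it inherit `Extends` from the claim they were
nested on. -/
theorem step_after (U : Unforged I P L G R) (s : Log) (p : Fin I.n) {l : ℕ}
    {st : List (Claim I.n)} (h : After I P L G R l st) :
    Triple G s (I.step p l st) fun st' s' => After I P L G R l st' ∧ Cost I L 1 s st s' st' := by
  obtain ⟨hl, above, below, rfl, hst⟩ := h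
  induction above generalizing s with
  | nil =>
    rw [List.nil_append, step]
    refine .bind ((challenge_spec U s p hl (.inl (extends_trueClaim U)) length_peaks_trueClaim).and
      (challenge_responder U s p hl)) ?_ fun o s₁ ⟨⟨hr, hw, hn⟩, ho⟩ => ?_
    · rintro (_ | _ | c) <;> dsimp only <;> infer_instance
    rcases o with _ | _ | c'
    · refine .pure ⟨⟨hl, [], below, rfl, hst⟩, ?_, ?_⟩ <;> omega
    · exact absurd rfl ho
    · obtain ⟨h₁, -, h₂, h₃, h₄⟩ := hn c' rfl
      refine .pure ⟨⟨hl, [c'], below, rfl, ?_⟩, ?_, ?_⟩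
      · simp only [List.mem_singleton]
        rintro _ rfl
        exact ⟨h₃, h₄ (extends_trueClaim U), h₂.le⟩
      · rw [List.length_cons (a := c'), mul_add]; omega
      · rw [List.length_cons (a := c'), mul_add]; omega
  | cons c above ih =>
    obtain ⟨hv, he, hc⟩ := hst c (by simp)
    rw [List.cons_append, step]
    refine .bind (challenge_spec U s p hc (.inl he) hv.2.1) ?_ fun o s₁ ⟨hr, hw, hn⟩ => ?_
    · rintro (_ | _ | c) <;> dsimp only <;> infer_instance
    rcases o with _ | _ | c'
    · refine .pure ⟨⟨hl, c :: above, below, rfl, hst⟩, ?_, ?_⟩ <;> omega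
    · refine (ih s₁ fun c hc => hst c (by simp [hc])).mono fun st' s' ⟨h₁, h₂, h₃⟩ => ⟨h₁, ?_, ?_⟩ <;>
        rw [List.length_cons (a := c), mul_add] <;> omega
    · obtain ⟨h₁, -, h₂, h₃, h₄⟩ := hn c' rfl
      refine .pure ⟨⟨hl, c' :: c :: above, below, rfl, ?_⟩, ?_, ?_⟩
      · intro d hd
        rcases List.mem_cons.1 hd with rfl | hd
        · exact ⟨h₃, h₄ he, h₂.le⟩
        · exact hst d hd
      · rw [List.length_cons (a := c'), mul_add]; omega
      · rw [List.length_cons (a := c'), mul_add]; omega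

/-- This treats the phases before and after the entry of the honest prover alike: `J` is the
invariant, indexed by the latest claimed size, and `B` restricts the sizes claimed in the phase. -/
theorem foldlM_step {J : ℕ → List (Claim I.n) → Prop} {B : Fin I.n × ℕ → Prop}
    (hstep : ∀ s (x : Fin I.n × ℕ) l st, B x → l ≤ x.2 → J l st →
      Triple G s (I.step x.1 x.2 st) fun st' s' => J x.2 st' ∧ Cost I L 1 s st s' st')
    {xs : List (Fin I.n × ℕ)} (s : Log) {l : ℕ} {st : List (Claim I.n)} (hB : ∀ x ∈ xs, B x)
    (hs : xs.Pairwise fun x y => x.2 ≤ y.2) (hl : ∀ x ∈ xs, l ≤ x.2) (hJ : J l st) :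
    Triple G s (xs.foldlM (fun st x => I.step x.1 x.2 st) st) fun st' s' =>
      (∃ l', (l' = l ∨ ∃ x ∈ xs, l' = x.2) ∧ J l' st') ∧ Cost I L xs.length s st s' st' := by
  induction xs generalizing s l st with
  | nil =>
    rw [List.foldlM_nil]
    exact .pure ⟨⟨l, .inl rfl, hJ⟩, by constructor <;> simp⟩
  | cons x xs ih =>
    rw [List.foldlM_cons]
    refine .bind (hstep s x l st (hB x (by simp)) (hl x (by simp)) hJ) inferInstance
      fun st₁ s₁ ⟨h₁, h₂⟩ => ?_
    refine (ih s₁ (fun y hy => hB y (by simp [hy])) (List.pairwise_cons.1 hs).2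
      (List.pairwise_cons.1 hs).1 h₁).mono ?_
    rintro st' s' ⟨⟨l', hl', hJ'⟩, h₃⟩
    refine ⟨⟨l', .inr ?_, hJ'⟩, ?_⟩
    · rcases hl' with rfl | ⟨y, hy, rfl⟩
      · exact ⟨x, by simp, rfl⟩
      · exact ⟨y, by simp [hy], rfl⟩
    · rw [List.length_cons, add_comm]
      exact h₂.trans h₃

theorem sizes_spec (U : Unforged I P L G R) (s : Log) (ps : List (Fin I.n)) :
    Triple G s (ps.mapM fun p => do
      let m ← I.ask p .size 0 1
      return (p, m.toNat)) fun xs s' =>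
        xs.map Prod.fst = ps ∧ (∀ x ∈ xs, x.1 = P → x.2 = L.length + 1) ∧ s'.rounds = s.rounds ∧
          s'.words = s.words + ps.length := by
  induction ps generalizing s with
  | nil =>
    rw [List.mapM_nil]
    exact .pure ⟨rfl, by simp, rfl, rfl⟩
  | cons p ps ih =>
    rw [List.mapM_cons]
    refine .bind (Q := fun (x : Fin I.n × ℕ) s' => x.1 = p ∧ (p = P → x.2 = L.length + 1) ∧
      s'.rounds = s.rounds ∧ s'.words = s.words + 1) ?_ inferInstance fun x s₁ ⟨h₁, h₂, h₃, h₄⟩ => ?_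
    · refine .bind (U.ask _ _ _ _ _) inferInstance fun m s₁ ⟨_, hm, hr, hw⟩ => .pure ⟨rfl, ?_, hr, hw⟩
      rintro rfl
      rw [hm L U.ledger, honest, toNat_ofNat]
    · refine .bind (ih s₁) inferInstance fun xs s₂ ⟨h₅, h₆, h₇, h₈⟩ => .pure ⟨?_, ?_, ?_, ?_⟩
      · rw [List.map_cons, h₁, h₅]
      · intro y hy hyP
        rcases List.mem_cons.1 hy with rfl | hy
        · exact h₂ (h₁ ▸ hyP)
        · exact h₆ y hy hyP
      · omega
      · rw [List.length_cons]; omega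

instance : Mono (modify fun s : Log => { s with rounds := s.rounds + 1 }) := ⟨fun _ _ h => h⟩

theorem tournament_spec (U : Unforged I P L G R) :
    Triple G ⟨[], 0, 0⟩ I.tournament fun _ s' =>
      s'.rounds ≤ I.n * (Nat.log 2 (I.maxSize L) + 2) ∧
      s'.words ≤ I.n + I.n * (2 * I.gameWords L) := by
  unfold tournament
  refine .bind (sizes_spec U _ _) inferInstance fun xs s₁ ⟨hxs, hP, hr, hw⟩ => ?_
  have hmod : ∀ s : Log, Triple G s (modify fun s => { s with rounds := s.rounds + 1 })
      fun (_ : PUnit) s' => s' = ⟨s.transcript, s.rounds + 1, s.words⟩ := fun s _ => rfl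
  refine .bind (hmod s₁) inferInstance fun _ s₂ hs₂ => ?_
  subst hs₂
  set ys := xs.insertionSort fun x y => x.2 ≤ y.2 with hys
  have : Std.Total fun x y : Fin I.n × ℕ => x.2 ≤ y.2 := ⟨fun x y => le_total x.2 y.2⟩
  have : IsTrans (Fin I.n × ℕ) fun x y => x.2 ≤ y.2 := ⟨fun x y z => le_trans⟩
  have hsort : ys.Pairwise fun x y => x.2 ≤ y.2 := List.pairwise_insertionSort _ xs
  have hperm : ys.Perm xs := List.perm_insertionSort _ xs
  have hlen : xs.length = I.n := by
    rw [← List.length_map (f := Prod.fst), hxs, List.length_finRange]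
  obtain ⟨x, hx, hxP⟩ : ∃ x ∈ xs, x.1 = P := by
    have : P ∈ xs.map Prod.fst := by rw [hxs]; exact List.mem_finRange P
    simpa using this
  -- The sorted list is split at the honest prover: sizes before it are at most `|L| + 1`, sizes
  -- after it at least `|L| + 1`.
  obtain ⟨pre, post, hpp⟩ := List.append_of_mem (hperm.mem_iff.2 hx)
  have hx₂ := hP x hx hxP
  rw [hpp, List.pairwise_append, List.pairwise_cons] at hsort
  obtain ⟨hpre, ⟨hxpost, hpost⟩, hcross⟩ := hsort
  have hlen' : pre.length + (post.length + 1) = I.n := by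
    have := hperm.length_eq
    rw [hpp, List.length_append, List.length_cons] at this
    omega
  rw [hpp]
  simp only [List.foldlM_append, List.foldlM_cons]
  have hM₁ : ∀ st, Mono (List.foldlM (fun st (x : Fin I.n × ℕ) => I.step x.1 x.2 st) st post) :=
    fun st => inferInstance
  -- The sum is a crude upper bound for the last claimed size. Its value is irrelevant; it only
  -- makes the final invariant explicit.
  refine .bind (Q := fun st s' => After I P L G R (L.length + 1 + (post.map Prod.snd).sum) st ∧
    Cost I L I.n ⟨s₁.transcript, s₁.rounds + 1, s₁.words⟩ [] s' st) ?_ inferInstance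
    fun st s₃ ⟨h₁, h₂⟩ => .pure ?_
  · refine .bind (foldlM_step (J := Before I L G) (B := fun x => x.2 ≤ L.length + 1) (l := 0)
      (fun s x l st hB hl hJ => step_before U s x.1 ⟨hB, fun c hc => ?_⟩) _ (fun y hy => ?_) hpre
      (fun _ _ => Nat.zero_le _) ⟨Nat.zero_le _, by simp⟩) inferInstance
      fun st s₂ ⟨⟨l, hl, hJ⟩, hcost⟩ => ?_
    · exact ⟨(hJ.2 c hc).1, (hJ.2 c hc).2.trans hl⟩
    · rw [← hx₂]; exact hcross y hy x (by simp)
    have hB : Before I L G (L.length + 1) st :=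
      ⟨le_rfl, fun c hc => ⟨(hJ.2 c hc).1, (hJ.2 c hc).2.trans hJ.1⟩⟩
    rw [hxP, hx₂]
    refine .bind ((step_before U s₂ P hB).and (step_honest U s₂ hB)) inferInstance
      fun st' s₃ ⟨⟨_, hcost'⟩, hA⟩ => ?_
    refine (foldlM_step (J := After I P L G R) (B := fun x => L.length + 1 ≤ x.2)
      (l := L.length + 1) (fun s x l st hB hl hJ => step_after U s x.1 ⟨hB, ?_⟩) _ (fun y hy => ?_)
      hpost (fun y hy => ?_) hA).mono ?_
    · obtain ⟨-, above, below, h, h'⟩ := hJ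
      exact ⟨above, below, h, fun c hc => ⟨(h' c hc).1, (h' c hc).2.1, (h' c hc).2.2.trans hl⟩⟩
    · rw [← hx₂]; exact hxpost y hy
    · rw [← hx₂]; exact hxpost y hy
    · rintro st'' s₄ ⟨⟨l', hl', hJ'⟩, h₃⟩
      have hle : l' ≤ L.length + 1 + (post.map Prod.snd).sum := by
        rcases hl' with rfl | ⟨y, hy, rfl⟩
        · omega
        · exact (List.single_le_sum (by simp) _ (List.mem_map_of_mem hy)).trans (by omega)
      obtain ⟨hl'', above, below, h, h'⟩ := hJ'
      refine ⟨⟨by omega, above, below, h, fun c hc =>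
        ⟨(h' c hc).1, (h' c hc).2.1, (h' c hc).2.2.trans hle⟩⟩, ?_⟩
      have := hcost.trans (hcost'.trans h₃)
      rwa [show pre.length + (1 + post.length) = I.n by omega] at this
  -- The honest claim is still in the stack. What it carries, at least one round, is never spent and
  -- pays for the round in which all sizes are claimed.
  · obtain ⟨-, above, below, h, -⟩ := h₁
    have hpos : 1 ≤ st.length := by rw [h]; simp; omega
    obtain ⟨h₃, h₄⟩ := h₂
    have h₅ : (Nat.log 2 (I.maxSize L) + 1) * 1 ≤ (Nat.log 2 (I.maxSize L) + 1) * st.length := by gcongr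
    simp only [List.length_nil, mul_zero, add_zero, List.length_finRange] at *
    constructor <;> omega

end Setting


/-! ### Efficiently computable quantities -/

/-- A quantity that is polynomially bounded in the size of the encoding `e`. -/
def Bounded {Γ : Type} (e : Γ → Data) (m : Γ → ℕ) : Prop :=
  ∃ b : Polynomial ℕ, ∀ y, m y ≤ b.eval (e y).size

/-- The function `v` can be computed in polynomial time from the encoding `e` of its argument. -/
def Eff {Γ : Type} (e v : Γ → Data) : Prop := ∃ F, PolyTime F ∧ ∀ y, F (e y) = v y

namespace Bounded

variable {Γ Δ : Type} {e : Γ → Data} {d : Δ → Data} {m m' : Γ → ℕ}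

theorem of_le (h : Bounded e m) (hm : ∀ y, m' y ≤ m y) : Bounded e m' := by
  obtain ⟨b, hb⟩ := h
  exact ⟨b, fun y => (hm y).trans (hb y)⟩

theorem const (c : ℕ) : Bounded e fun _ => c := ⟨Polynomial.C c, fun _ => by simp⟩

theorem add (h : Bounded e m) (h' : Bounded e m') : Bounded e fun y => m y + m' y := by
  obtain ⟨b, hb⟩ := h
  obtain ⟨b', hb'⟩ := h'
  exact ⟨b + b', fun x => by rw [Polynomial.eval_add]; exact add_le_add (hb x) (hb' x)⟩

theorem mul (h : Bounded e m) (h' : Bounded e m') : Bounded e fun y => m y * m' y := by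
  obtain ⟨b, hb⟩ := h
  obtain ⟨b', hb'⟩ := h'
  exact ⟨b * b', fun x => by rw [Polynomial.eval_mul]; exact Nat.mul_le_mul (hb x) (hb' x)⟩

theorem eval (b : Polynomial ℕ) (h : Bounded e m) : Bounded e fun y => b.eval (m y) := by
  obtain ⟨b', hb'⟩ := h
  exact ⟨b.comp b', fun x => by rw [Polynomial.eval_comp]; exact eval_nat_mono b (hb' x)⟩

end Bounded

namespace Eff

variable {Γ Δ : Type} {e : Γ → Data} {d : Δ → Data} {v v₁ v₂ v₃ v₄ : Γ → Data}

theorem bound (h : Eff e v) : Bounded e fun y => (v y).size := by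
  obtain ⟨F, hF, h⟩ := h
  obtain ⟨b, hb⟩ := hF.bound
  exact ⟨b, fun y => by simpa only [h] using hb (e y)⟩

theorem congr (h : Eff e v₁) (h' : ∀ y, v₁ y = v₂ y) : Eff e v₂ := funext h' ▸ h

theorem self : Eff e e := ⟨_, .id, fun _ => rfl⟩

theorem const (c : Data) : Eff e fun _ => c := ⟨_, .const c, fun _ => rfl⟩

/-- Composition of computations. -/
theorem comp {e' : Δ → Data} {w : Δ → Data} (hw : Eff e' w) (g : Γ → Δ)
    (h : Eff e fun y => e' (g y)) : Eff e fun y => w (g y) := by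
  obtain ⟨F, hF, hw⟩ := hw
  obtain ⟨G, hG, h⟩ := h
  exact ⟨_, hF.comp hG, fun y => by rw [h, hw]⟩

theorem comp₁ {F : Data → Data} (hF : PolyTime F) (h : Eff e v) : Eff e fun y => F (v y) := by
  obtain ⟨G, hG, h⟩ := h
  exact ⟨_, hF.comp hG, fun y => by rw [h]⟩

theorem cons (h₁ : Eff e v₁) (h₂ : Eff e v₂) : Eff e fun y => Data.cons (v₁ y) (v₂ y) := by
  obtain ⟨F, hF, h₁⟩ := h₁
  obtain ⟨G, hG, h₂⟩ := h₂
  exact ⟨_, hF.cons hG, fun y => by rw [h₁, h₂]⟩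

theorem comp₂ {F : Data → Data → Data} (hF : PolyTime fun x => F x.hd x.tl) (h₁ : Eff e v₁)
    (h₂ : Eff e v₂) : Eff e fun y => F (v₁ y) (v₂ y) := comp₁ hF (h₁.cons h₂)

theorem comp₃ {F : Data → Data → Data → Data} (hF : PolyTime fun x => F x.hd x.tl.hd x.tl.tl)
    (h₁ : Eff e v₁) (h₂ : Eff e v₂) (h₃ : Eff e v₃) : Eff e fun y => F (v₁ y) (v₂ y) (v₃ y) :=
  comp₁ hF (h₁.cons (h₂.cons h₃))

theorem hd (h : Eff e v) : Eff e fun y => (v y).hd := comp₁ (by fun_prop) h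

theorem tl (h : Eff e v) : Eff e fun y => (v y).tl := comp₁ (by fun_prop) h

theorem nil : Eff e fun _ => ofList [] := const _

theorem ofList_cons {l : Γ → List Data} (h₁ : Eff e v) (h₂ : Eff e fun y => ofList (l y)) :
    Eff e fun y => ofList (v y :: l y) := h₁.cons h₂

theorem ofList_one (h₁ : Eff e v₁) : Eff e fun y => ofList [v₁ y] := h₁.ofList_cons nil

theorem ofList_two (h₁ : Eff e v₁) (h₂ : Eff e v₂) : Eff e fun y => ofList [v₁ y, v₂ y] :=
  h₁.ofList_cons h₂.ofList_one

theorem ofList_three (h₁ : Eff e v₁) (h₂ : Eff e v₂) (h₃ : Eff e v₃) :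
    Eff e fun y => ofList [v₁ y, v₂ y, v₃ y] := h₁.ofList_cons (h₂.ofList_two h₃)

theorem toList (h : Eff e v) : Eff e fun y => ofList (v y).toList := h.congr fun y => by simp

theorem nth (h : Eff e v) (i : ℕ) : Eff e fun y => (v y).nth i :=
  (comp₃ (F := Data.getD) (by fun_prop) (const (unary i)) h (const .nil)).congr fun y => by simp [Data.nth]

theorem eq (h₁ : Eff e v₁) (h₂ : Eff e v₂) : Eff e fun y => ofProp (v₁ y = v₂ y) :=
  comp₂ (F := fun a b => ofProp (a = b)) (by fun_prop) h₁ h₂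

/-- Case distinction. -/
theorem cases {p : Γ → Prop} [DecidablePred p] (hp : Eff e fun y => ofProp (p y))
    (h₁ : Eff (fun y : {y // p y} => e y) fun y => v y)
    (h₂ : Eff (fun y : {y // ¬ p y} => e y) fun y => v y) : Eff e v := by
  obtain ⟨C, hC, hp⟩ := hp
  obtain ⟨F, hF, h₁⟩ := h₁
  obtain ⟨G, hG, h₂⟩ := h₂
  refine ⟨fun x => Data.cond (C x) (F x) (G x), hC.cond hF hG, fun y => ?_⟩
  dsimp only
  rw [hp, cond_ofProp]
  split_ifs with h
  · exact h₁ ⟨y, h⟩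
  · exact h₂ ⟨y, h⟩

/-- Substitution. -/
theorem sub (h : Eff e v) (g : Δ → Γ) : Eff (fun z => e (g z)) fun z => v (g z) :=
  comp h g self

theorem ite {p : Γ → Prop} [DecidablePred p] (hp : Eff e fun y => ofProp (p y)) (h₁ : Eff e v₁)
    (h₂ : Eff e v₂) : Eff e fun y => if p y then v₁ y else v₂ y :=
  cases hp ((h₁.sub _).congr fun y => by simp [y.2]) ((h₂.sub _).congr fun y => by simp [y.2])

theorem not {p : Γ → Prop} [DecidablePred p] (hp : Eff e fun y => ofProp (p y)) :
    Eff e fun y => ofProp (¬ p y) :=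
  (ite hp (const (ofProp False)) (const (ofProp True))).congr fun y => by
    by_cases h : p y <;> simp [h, ofProp]

theorem and {p q : Γ → Prop} [DecidablePred p] [DecidablePred q]
    (hp : Eff e fun y => ofProp (p y)) (hq : Eff e fun y => ofProp (q y)) :
    Eff e fun y => ofProp (p y ∧ q y) :=
  (ite hp hq (const (ofProp False))).congr fun y => by by_cases h : p y <;> simp [h, ofProp]

theorem or {p q : Γ → Prop} [DecidablePred p] [DecidablePred q]
    (hp : Eff e fun y => ofProp (p y)) (hq : Eff e fun y => ofProp (q y)) :
    Eff e fun y => ofProp (p y ∨ q y) :=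
  (ite hp (const (ofProp True)) hq).congr fun y => by by_cases h : p y <;> simp [h, ofProp]

theorem unary_size (h : Eff e v) : Eff e fun y => unary (v y).size :=
  (comp₁ (F := fun x => Data.len (subtrees x)) (by fun_prop) h).congr fun y => by
    simp [subtrees, length_subs]

theorem unary_eval (b : Polynomial ℕ) {m : Γ → ℕ} (h : Eff e fun y => unary (m y)) :
    Eff e fun y => unary (b.eval (m y)) :=
  (comp₁ (F := fun x => unary (b.eval x.toList.length)) (.unary_eval b .id) h).congr fun y => by
    simp

/-- Recursion: only polynomially bounded values may occur. -/
theorem natRec {a : Γ → ℕ} {v : Γ → ℕ → Data} {B : Γ → ℕ} (ha : Eff e fun y => unary (a y))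
    (h0 : Eff e fun y => v y 0)
    (hs : ∀ (Δ : Type) (d : Δ → Data) (g : Δ → Γ) (i : Δ → ℕ), (∀ z, i z < a (g z)) →
      (∀ {w : Γ → Data}, Eff e w → Eff d fun z => w (g z)) → (Eff d fun z => unary (i z)) →
      (Eff d fun z => v (g z) (i z)) → Eff d fun z => v (g z) (i z + 1))
    (hB : Bounded e B) (hv : ∀ y, ∀ i ≤ a y, (v y i).size ≤ B y) : Eff e fun y => v y (a y) := by
  -- The step is assumed computable in every context that provides the outer data, the index and the
  -- current value. Here it is used in the universal context of this kind, whose encoding is just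
  -- the triple of these.
  obtain ⟨F, hF, hs⟩ := hs {z : Γ × ℕ // z.2 < a z.1}
    (fun z => .cons (e z.1.1) (.cons (unary z.1.2) (v z.1.1 z.1.2)))
    (fun z => z.1.1) (fun z => z.1.2) (fun z => z.2)
    (fun h => h.comp _ self.hd) self.tl.hd self.tl.tl
  obtain ⟨A, hA, ha⟩ := ha
  obtain ⟨Z, hZ, h0⟩ := h0
  obtain ⟨b, hb⟩ := hB
  obtain ⟨C, hC, hc⟩ : Eff (fun y : Data => y)
      fun y => unary ((Polynomial.X + b + 2).eval (2 * (A y).size + y.size + 1)) := by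
    refine unary_eval _ ?_
    exact ((unary_size (v := fun y => Data.cons (Data.cons (A y) (A y)) y)
      (comp₁ (F := fun y => Data.cons (Data.cons (A y) (A y)) y) (by fun_prop) self)).comp₁
      (F := Data.tl) (by fun_prop)).congr fun y => by
        rw [size_cons, size_cons, unary_succ, tl_cons]; congr 1; ring
  -- `F` is controlled only on genuine encodings, whereas polynomial time is required on all inputs.
  -- Hence every state is cut off at a polynomial size computed in advance; on genuine encodings the
  -- cut never takes effect (`hok`).
  let f : Data → Data → Data → Data := fun x s _ => cap x.hd
    (Data.cons (Data.cons .nil s.hd) (F (Data.cons x.tl s)))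
  let G : Data → Data := fun y => (Data.fold f (Data.cons (C y) y) (A y) (cap (C y) (Data.cons .nil (Z y)))).tl
  have hcap : ∀ u x : Data, (cap u x).size ≤ u.size := by
    intro u x
    rw [cap_eq]
    split_ifs with h
    · exact h.trans (length_toList_lt _).le
    · exact size_pos u
  refine ⟨G, .tl (.fold (B := fun y => (C y).size) ?_ (by fun_prop) hA (by fun_prop) hC.bound ?_), ?_⟩
  · have : PolyTime fun y : Data => F (Data.cons y.hd.tl y.tl.hd) :=
      hF.comp' (G := fun y => Data.cons y.hd.tl y.tl.hd) (by fun_prop)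
    exact .cap (by fun_prop) (.cons (by fun_prop) this)
  · intro y l _
    induction l using List.reverseRecOn with
    | nil => exact hcap _ _
    | append_singleton l _ _ => rw [List.foldl_append]; exact hcap _ _
  · intro y
    have hok : ∀ i ≤ a y, cap (C (e y)) (Data.cons (unary i) (v y i)) = Data.cons (unary i) (v y i) := by
      intro i hi
      rw [cap_eq, if_pos]
      rw [hc, length_toList_unary, size_cons, size_unary, Polynomial.eval_add, Polynomial.eval_add,
        Polynomial.eval_X, ha, size_unary]
      have h₁ := (hv y i hi).trans (hb y)
      have h₂ := eval_nat_mono b (show (e y).size ≤ 2 * (2 * a y + 1) + (e y).size + 1 by omega)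
      dsimp only at h₂
      have h₃ : Polynomial.eval (2 * (2 * a y + 1) + (e y).size + 1) (2 : Polynomial ℕ) = 2 := by
        rw [← Polynomial.C_ofNat, Polynomial.eval_C]
      omega
    have key : ∀ l : List Data, l.length ≤ a y → l.foldl (f (Data.cons (C (e y)) (e y)))
        (Data.cons (unary 0) (v y 0)) = Data.cons (unary l.length) (v y l.length) := by
      intro l
      induction l using List.reverseRecOn with
      | nil => simp
      | append_singleton l t ih =>
        intro hl
        simp only [List.length_append, List.length_cons, List.length_nil, zero_add] at hl ⊢
        rw [List.foldl_append, ih (by omega), List.foldl_cons, List.foldl_nil]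
        have := hs ⟨(y, l.length), hl⟩
        dsimp only at this
        simp only [f, hd_cons, tl_cons]
        rw [this, ← unary_succ, hok _ hl]
    have := key (A (e y)).toList (by simp [ha])
    rw [← hok 0 (Nat.zero_le _)] at this
    simp only [G, Data.fold, h0]
    rw [unary_zero] at this
    rw [this, ha, length_toList_unary, tl_cons]

theorem length {β : Γ → Type} {enc : ∀ y, β y → Data} {l : ∀ y, List (β y)}
    (hl : Eff e fun y => ofList ((l y).map (enc y))) : Eff e fun y => unary (l y).length :=
  (comp₁ (F := Data.len) (by fun_prop) hl).congr fun y => by simp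

theorem length_list {l : Γ → List Data} (hl : Eff e fun y => ofList (l y)) :
    Eff e fun y => unary (l y).length :=
  (comp₁ (F := Data.len) (by fun_prop) hl).congr fun y => by simp

/-- The body is required to be computable in every context `Δ` from which the outer data (through
the lifting hypothesis) and the list entry can be recovered. In this form bodies are built with the
same combinators as everything else, and such constructions can be nested. -/
theorem map {β : Γ → Type} {enc : ∀ y, β y → Data} {l : ∀ y, List (β y)} {f : ∀ y, β y → Data}
    (hl : Eff e fun y => ofList ((l y).map (enc y)))
    (hf : ∀ (Δ : Type) (d : Δ → Data) (g : Δ → Γ) (b : ∀ z, β (g z)), (∀ z, b z ∈ l (g z)) →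
      (∀ {w : Γ → Data}, Eff e w → Eff d fun z => w (g z)) → (Eff d fun z => enc (g z) (b z)) →
      Eff d fun z => f (g z) (b z)) : Eff e fun y => ofList ((l y).map (f y)) := by
  obtain ⟨F, hF, hf⟩ := hf {z : Σ y, β y // z.2 ∈ l z.1}
    (fun z => .cons (e z.1.1) (enc _ z.1.2)) (fun z => z.1.1) (fun z => z.1.2) (fun z => z.2)
    (fun h => h.comp _ self.hd) self.tl
  obtain ⟨A, hA, hl⟩ := hl
  refine ⟨fun y => Data.map (fun y b => F (.cons y b)) y (A y), .map ?_ .id hA, fun y => ?_⟩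
  · exact hF.comp' (G := fun y => Data.cons y.hd y.tl) (by fun_prop)
  · apply ext_toList
    simp only [toList_map, hl, toList_ofList, List.map_map]
    exact List.map_congr_left fun b hb => hf ⟨⟨y, b⟩, hb⟩

theorem flatMap {β : Γ → Type} {enc : ∀ y, β y → Data} {l : ∀ y, List (β y)}
    {f : ∀ y, β y → List Data} (hl : Eff e fun y => ofList ((l y).map (enc y)))
    (hf : ∀ (Δ : Type) (d : Δ → Data) (g : Δ → Γ) (b : ∀ z, β (g z)), (∀ z, b z ∈ l (g z)) →
      (∀ {w : Γ → Data}, Eff e w → Eff d fun z => w (g z)) → (Eff d fun z => enc (g z) (b z)) →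
      Eff d fun z => ofList (f (g z) (b z))) : Eff e fun y => ofList ((l y).flatMap (f y)) := by
  have h := map (f := fun y b => ofList (f y b)) hl hf
  obtain ⟨F, hF, h⟩ := h
  refine ⟨fun y => Data.flatMap (fun _ b => b) .nil (F y), .flatMap (by fun_prop) (.const _) hF,
    fun y => ext_toList ?_⟩
  simp [h, List.flatMap_map]

/-- The first entry of a list with a property. -/
theorem find {β : Γ → Type} {enc : ∀ y, β y → Data} {l : ∀ y, List (β y)}
    {p : ∀ y, β y → Bool} (hl : Eff e fun y => ofList ((l y).map (enc y)))
    (hp : ∀ (Δ : Type) (d : Δ → Data) (g : Δ → Γ) (b : ∀ z, β (g z)), (∀ z, b z ∈ l (g z)) →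
      (∀ {w : Γ → Data}, Eff e w → Eff d fun z => w (g z)) → (Eff d fun z => enc (g z) (b z)) →
      Eff d fun z => ofBool (p (g z) (b z))) :
    Eff e fun y => ofOption (((l y).find? (p y)).map (enc y)) := by
  have h := map (f := fun y b => .cons (ofBool (p y b)) (enc y b)) hl
    fun Δ d g b hb lift h => (hp Δ d g b hb lift h).cons h
  obtain ⟨F, hF, h⟩ := h
  refine ⟨fun y => Data.cond (Data.find (fun _ b => b.hd) .nil (F y))
    (.cons .nil (Data.find (fun _ b => b.hd) .nil (F y)).tl.tl) .nil, ?_, fun y => ?_⟩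
  · have : PolyTime fun y => Data.find (fun _ b => b.hd) .nil (F y) :=
      .find (by fun_prop) (.const _) hF
    fun_prop
  · dsimp only
    rw [h, find_eq, toList_ofList, List.find?_map]
    have : (fun e : Data => decide (e.hd ≠ Data.nil)) ∘
        (fun b => Data.cons (ofBool (p y b)) (enc y b)) = p y := by
      funext b
      simp
    rw [this]
    cases (l y).find? (p y) <;> simp [ofOption]

theorem any {β : Γ → Type} {enc : ∀ y, β y → Data} {l : ∀ y, List (β y)}
    {p : ∀ y, β y → Bool} (hl : Eff e fun y => ofList ((l y).map (enc y)))
    (hp : ∀ (Δ : Type) (d : Δ → Data) (g : Δ → Γ) (b : ∀ z, β (g z)), (∀ z, b z ∈ l (g z)) →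
      (∀ {w : Γ → Data}, Eff e w → Eff d fun z => w (g z)) → (Eff d fun z => enc (g z) (b z)) →
      Eff d fun z => ofBool (p (g z) (b z))) : Eff e fun y => ofBool ((l y).any (p y)) := by
  refine (comp₁ (F := fun x => Data.cond x (.cons .nil .nil) .nil) (by fun_prop)
    (find hl hp)).congr fun y => ?_
  have : (l y).any (p y) = ((l y).find? (p y)).isSome := by
    rw [Bool.eq_iff_iff, List.any_eq_true, List.find?_isSome]
  rw [this]
  cases (l y).find? (p y) <;> simp [ofOption]

theorem range {m : Γ → ℕ} (h : Eff e fun y => unary (m y)) :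
    Eff e fun y => ofList ((List.range (m y)).map unary) :=
  (comp₁ (F := Data.range) (by fun_prop) h).congr fun y => by simp

theorem getD {l : Γ → List Data} {m : Γ → ℕ} (hm : Eff e fun y => unary (m y))
    (hl : Eff e fun y => ofList (l y)) (h : Eff e v) : Eff e fun y => (l y).getD (m y) (v y) :=
  (comp₃ (F := Data.getD) (by fun_prop) hm hl h).congr fun y => by simp

theorem drop {l : Γ → List Data} {m : Γ → ℕ} (hm : Eff e fun y => unary (m y))
    (hl : Eff e fun y => ofList (l y)) : Eff e fun y => ofList ((l y).drop (m y)) :=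
  (comp₂ (F := Data.drop) (by fun_prop) hm hl).congr fun y => ext_toList (by simp)

theorem append {l l' : Γ → List Data} (hl : Eff e fun y => ofList (l y))
    (hl' : Eff e fun y => ofList (l' y)) : Eff e fun y => ofList (l y ++ l' y) :=
  (comp₂ (F := Data.append) (by fun_prop) hl hl').congr fun y => ext_toList (by simp)

theorem reverse {l : Γ → List Data} (hl : Eff e fun y => ofList (l y)) :
    Eff e fun y => ofList (l y).reverse :=
  (comp₁ (F := Data.rev) (by fun_prop) hl).congr fun y => ext_toList (by simp)

theorem take {l : Γ → List Data} {m : Γ → ℕ} (hm : Eff e fun y => unary (m y))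
    (hl : Eff e fun y => ofList (l y)) : Eff e fun y => ofList ((l y).take (m y)) := by
  have h := drop hm (hl.length_list.congr fun y => rfl)
  refine (reverse (drop (m := fun y => (l y).length - m y) (h.congr fun y => ?_)
    (reverse hl))).congr fun y => ?_
  · apply ext_toList
    simp [unary]
  · rw [List.drop_reverse, List.reverse_reverse]
    rcases le_total (m y) (l y).length with h | h
    · rw [Nat.sub_sub_self h]
    · rw [Nat.sub_eq_zero_of_le h, Nat.sub_zero, List.take_length, List.take_of_length_le h]

theorem bin {m : Γ → ℕ} (h : Eff e fun y => unary (m y)) : Eff e fun y => ofNat (m y) :=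
  (comp₁ (F := Data.bin) (by fun_prop) h).congr fun y => by simp

theorem unary_add {m m' : Γ → ℕ} (h : Eff e fun y => unary (m y))
    (h' : Eff e fun y => unary (m' y)) : Eff e fun y => unary (m y + m' y) :=
  (comp₂ (F := Data.append) (by fun_prop) h h').congr fun y => by simp

theorem unary_mul {m m' : Γ → ℕ} (h : Eff e fun y => unary (m y))
    (h' : Eff e fun y => unary (m' y)) : Eff e fun y => unary (m y * m' y) :=
  (comp₂ (F := Data.mulUnary) (by fun_prop) h h').congr fun y => by simp

theorem succ {m : Γ → ℕ} (h : Eff e fun y => ofNat (m y)) : Eff e fun y => ofNat (m y + 1) :=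
  (comp₁ (F := Data.inc) (by fun_prop) h).congr fun y => by simp

theorem pred {m : Γ → ℕ} (h : Eff e fun y => ofNat (m y)) : Eff e fun y => ofNat (m y - 1) :=
  (comp₁ (F := Data.dec) (by fun_prop) h).congr fun y => by simp

theorem toNat (h : Eff e v) : Eff e fun y => ofNat (v y).toNat :=
  (comp₁ (F := Data.norm) (by fun_prop) h).congr fun y => by simp

theorem double {m : Γ → ℕ} (h : Eff e fun y => ofNat (m y)) : Eff e fun y => ofNat (2 * m y) :=
  (comp₁ (F := Data.dbl) (by fun_prop) h).congr fun y => by rw [ofNat_two_mul]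

theorem half {m : Γ → ℕ} (h : Eff e fun y => ofNat (m y)) : Eff e fun y => ofNat (m y / 2) :=
  h.tl.congr fun y => by simp

theorem div_pow {m a : Γ → ℕ} (h : Eff e fun y => ofNat (m y)) (ha : Eff e fun y => unary (a y)) :
    Eff e fun y => ofNat (m y / 2 ^ a y) :=
  (comp₂ (F := Data.drop) (by fun_prop) ha h).congr fun y => by simp

theorem odd {m : Γ → ℕ} (h : Eff e fun y => ofNat (m y)) :
    Eff e fun y => ofProp (m y % 2 = 1) := h.hd.congr fun y => by simp [ofProp]

theorem even {m : Γ → ℕ} (h : Eff e fun y => ofNat (m y)) :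
    Eff e fun y => ofProp (m y % 2 = 0) := h.odd.not.congr fun y => by simp

theorem le {m m' : Γ → ℕ} (h : Eff e fun y => ofNat (m y)) (h' : Eff e fun y => ofNat (m' y)) :
    Eff e fun y => ofProp (m y ≤ m' y) :=
  (comp₂ (F := Data.le) (by fun_prop) h h').congr fun y => by simp

theorem eq_nat {m m' : Γ → ℕ} (h : Eff e fun y => ofNat (m y)) (h' : Eff e fun y => ofNat (m' y)) :
    Eff e fun y => ofProp (m y = m' y) := (h.eq h').congr fun y => by simp

theorem eq_unary {m m' : Γ → ℕ} (h : Eff e fun y => unary (m y))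
    (h' : Eff e fun y => unary (m' y)) : Eff e fun y => ofProp (m y = m' y) := h.bin.eq_nat h'.bin

/-- The capped difference of two numbers. -/
theorem min_sub {m m' a : Γ → ℕ} (h : Eff e fun y => ofNat (m y)) (h' : Eff e fun y => ofNat (m' y))
    (ha : Eff e fun y => unary (a y)) : Eff e fun y => unary (min (m' y - m y) (a y)) :=
  (comp₃ (F := Data.countUp) (by fun_prop) h h' ha).congr fun y => by simp

theorem min_unary {m a : Γ → ℕ} (h : Eff e fun y => ofNat (m y)) (ha : Eff e fun y => unary (a y)) :
    Eff e fun y => unary (min (m y) (a y)) :=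
  (min_sub (m := fun _ => 0) ((const .nil).congr fun y => by simp) h ha).congr fun y => by simp

theorem heights {m : Γ → ℕ} (h : Eff e fun y => ofNat (m y)) :
    Eff e fun y => ofList ((LightClient.heights (m y)).map unary) :=
  (comp₁ (F := Data.heights) (by fun_prop) h).congr fun y => by simp

theorem peakPos {m a : Γ → ℕ} (h : Eff e fun y => ofNat (m y)) (ha : Eff e fun y => unary (a y)) :
    Eff e fun y => ofNat (LightClient.peakPos (m y) (a y)) :=
  (comp₂ (F := Data.peakPos) (by fun_prop) h ha).congr fun y => by simp

theorem siblingPos {m : Γ → ℕ} (h : Eff e fun y => ofNat (m y)) :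
    Eff e fun y => ofNat (LightClient.siblingPos (m y)) :=
  (comp₁ (F := Data.sibling) (by fun_prop) h).congr fun y => by simp

/-- The binary logarithm. -/
theorem log {m : Γ → ℕ} (h : Eff e fun y => ofNat (m y)) : Eff e fun y => unary (Nat.log 2 (m y)) :=
  (comp₁ (F := fun x => (Data.len x).tl) (by fun_prop) h).congr fun y => by
    rw [len_eq, length_toList_ofNat]
    rcases Nat.eq_zero_or_pos (m y) with h | h
    · simp [h, unary_zero]
    · have : (m y).size = Nat.log 2 (m y) + 1 := by
        refine le_antisymm (Nat.size_le.2 (Nat.lt_pow_succ_log_self (by norm_num) _)) ?_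
        rw [Nat.succ_le_iff, Nat.lt_size]
        exact Nat.pow_log_le_self 2 h.ne'
      rw [this, unary_succ, tl_cons]

/-- The number `m + i`, where `i` is given in unary. -/
theorem add_unary {m i : Γ → ℕ} (h : Eff e fun y => ofNat (m y)) (hi : Eff e fun y => unary (i y)) :
    Eff e fun y => ofNat (m y + i y) := by
  refine natRec (v := fun y i => ofNat (m y + i)) hi (h.congr fun y => by simp)
    (fun Δ d g i _ _ _ hv => hv.succ) (h.bound.add ((Bounded.const 2).mul hi.bound)) fun y i hi => ?_
  rw [size_unary]
  have : ∀ i, (ofNat (m y + i)).size ≤ (ofNat (m y)).size + 4 * i := by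
    intro i
    induction i with
    | zero => simp
    | succ i ih =>
      have := size_ofNat_add_one (m y + i)
      rw [← add_assoc]
      omega
  have := this i
  omega

/-- Folds over lists. -/
theorem foldl {β τ : Γ → Type} {enc : ∀ y, β y → Data} {encτ : ∀ y, τ y → Data}
    {l : ∀ y, List (β y)} {z : ∀ y, τ y} {f : ∀ y, τ y → β y → τ y} {B : Γ → ℕ}
    (hl : Eff e fun y => ofList ((l y).map (enc y))) (hz : Eff e fun y => encτ y (z y))
    (hf : ∀ (Δ : Type) (d : Δ → Data) (g : Δ → Γ) (s : ∀ z, τ (g z)) (b : ∀ z, β (g z)),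
      (∀ z, b z ∈ l (g z)) → (∀ {w : Γ → Data}, Eff e w → Eff d fun z => w (g z)) →
      (Eff d fun z => encτ (g z) (s z)) → (Eff d fun z => enc (g z) (b z)) →
      Eff d fun z => encτ (g z) (f (g z) (s z) (b z)))
    (hB : Bounded e B)
    (hv : ∀ y l', l' <+: l y → (encτ y (l'.foldl (f y) (z y))).size ≤ B y) :
    Eff e fun y => encτ y ((l y).foldl (f y) (z y)) := by
  refine (natRec (v := fun y i => encτ y (((l y).take i).foldl (f y) (z y))) hl.length
    (hz.congr fun y => by simp) (fun Δ d g i hi lift hi' hs => ?_) hB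
    fun y i _ => hv y _ (List.take_prefix _ _)).congr fun y => by simp
  have hb : Eff d fun z => enc (g z) ((l (g z))[i z]'(hi z)) :=
    (getD hi' (lift hl) (const .nil)).congr fun y => by
      rw [List.getD_eq_getElem _ _ (by simpa using hi y), List.getElem_map]
  refine (hf Δ d g _ _ (fun z => List.getElem_mem _) lift hs hb).congr fun y => ?_
  rw [List.take_add_one, List.getElem?_eq_getElem (hi y), List.foldl_append]
  rfl

end Eff


/-! ### The algorithms of honest provers -/

/-- A family of tournaments whose ingredients can be computed in polynomial time from the
encoding `e₀` of the index. -/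
structure Feasible {X : Type} (I : X → Setting) (e₀ : X → Data) : Prop where
  hash : Eff (fun z : X × Data => cons (e₀ z.1) z.2) fun z => (I z.1).hash z.2
  δ : Eff (fun z : X × Data × Data => cons (e₀ z.1) (cons z.2.1 z.2.2)) fun z =>
    (I z.1).δ z.2.1 z.2.2
  st0 : Eff e₀ fun x => (I x).st0
  commit : Eff (fun z : X × Data => cons (e₀ z.1) z.2) fun z => (I z.1).commit z.2
  sδ : Eff (fun z : X × Data × Data × Data => cons (e₀ z.1) (cons z.2.1 (cons z.2.2.1 z.2.2.2)))
    fun z => ofOption ((I z.1).sδ z.2.1 z.2.2.1 z.2.2.2)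
  prove : Eff (fun z : X × Data × Data => cons (e₀ z.1) (cons z.2.1 z.2.2)) fun z =>
    (I z.1).prove z.2.1 z.2.2
  co : Eff (fun z : X × Data × Data × Data => cons (e₀ z.1) (cons z.2.1 (cons z.2.2.1 z.2.2.2)))
    fun z => ofBool ((I z.1).co z.2.1 z.2.2.1 z.2.2.2)
  adv : Eff (fun z : X × ℕ × Data × Data => cons (e₀ z.1) (cons (unary z.2.1) (cons z.2.2.1 z.2.2.2)))
    fun z => (I z.1).adv z.2.1 z.2.2.1 z.2.2.2
  window : Eff e₀ fun x => unary (I x).window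
  f : Eff e₀ fun x => unary (I x).f
  g : Eff e₀ fun x => unary (I x).g
  n : Eff e₀ fun x => unary (I x).n
  ledger : Eff e₀ fun x => ofList (List.ofFn fun i => ofOption (((I x).ledger i).map ofList))
  hash_size : ∃ B, Bounded e₀ B ∧ ∀ x d, ((I x).hash d).size ≤ B x
  growth : ∃ c, ∀ x st tx, ((I x).δ st tx).size ≤ st.size + c * tx.size
  adv_size : ∃ B, Bounded e₀ B ∧ ∀ x m t q, ((I x).adv m t q).size ≤ m * B x + 1

theorem Bounded.comp {Γ X : Type} {e : Γ → Data} {e₀ : X → Data} {m : X → ℕ} (h : Bounded e₀ m)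
    {x : Γ → X} (hx : Eff e fun y => e₀ (x y)) : Bounded e fun y => m (x y) := by
  obtain ⟨b, hb⟩ := h
  exact (hx.bound.eval b).of_le fun y => hb (x y)

namespace Feasible

variable {X : Type} {I : X → Setting} {e₀ : X → Data} (h : Feasible I e₀)
  {Γ : Type} {e : Γ → Data} {x : Γ → X} (hx : Eff e fun y => e₀ (x y))
  {L : Γ → List Data} (hL : Eff e fun y => ofList (L y)) {a i j l m : Γ → ℕ} {v v₁ v₂ v₃ : Γ → Data}

include h hx

theorem eff_hash (hv : Eff e v) : Eff e fun y => (I (x y)).hash (v y) :=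
  h.hash.comp (fun y => (x y, v y)) (hx.cons hv)

theorem eff_commit (hv : Eff e v) : Eff e fun y => (I (x y)).commit (v y) :=
  h.commit.comp (fun y => (x y, v y)) (hx.cons hv)

theorem eff_δ (h₁ : Eff e v₁) (h₂ : Eff e v₂) : Eff e fun y => (I (x y)).δ (v₁ y) (v₂ y) :=
  h.δ.comp (fun y => (x y, v₁ y, v₂ y)) (hx.cons (h₁.cons h₂))

theorem eff_prove (h₁ : Eff e v₁) (h₂ : Eff e v₂) :
    Eff e fun y => (I (x y)).prove (v₁ y) (v₂ y) :=
  h.prove.comp (fun y => (x y, v₁ y, v₂ y)) (hx.cons (h₁.cons h₂))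

theorem eff_sδ (h₁ : Eff e v₁) (h₂ : Eff e v₂) (h₃ : Eff e v₃) :
    Eff e fun y => ofOption ((I (x y)).sδ (v₁ y) (v₂ y) (v₃ y)) :=
  h.sδ.comp (fun y => (x y, v₁ y, v₂ y, v₃ y)) (hx.cons (h₁.cons (h₂.cons h₃)))

theorem eff_co (h₁ : Eff e v₁) (h₂ : Eff e v₂) (h₃ : Eff e v₃) :
    Eff e fun y => ofBool ((I (x y)).co (v₁ y) (v₂ y) (v₃ y)) :=
  h.co.comp (fun y => (x y, v₁ y, v₂ y, v₃ y)) (hx.cons (h₁.cons (h₂.cons h₃)))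

theorem eff_adv (hm : Eff e fun y => unary (m y)) (h₁ : Eff e v₁) (h₂ : Eff e v₂) :
    Eff e fun y => (I (x y)).adv (m y) (v₁ y) (v₂ y) :=
  h.adv.comp (fun y => (x y, m y, v₁ y, v₂ y)) (hx.cons (hm.cons (h₁.cons h₂)))

theorem eff_ledger {p : ∀ y, Fin (I (x y)).n} (hp : Eff e fun y => ofNat (p y)) :
    Eff e fun y => ofOption (((I (x y)).ledger (p y)).map ofList) := by
  refine (Eff.getD (m := fun y => (p y : ℕ)) ((Eff.min_unary hp (h.n.comp x hx)).congr fun y => ?_)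
    (h.ledger.comp x hx) (.const nil)).congr fun y => ?_
  · rw [min_eq_left (p y).2.le]
  · rw [List.getD_eq_getElem _ _ (by simp), List.getElem_ofFn]

include hL

/-- The index is given in binary and may be exponentially large, so it is first cut off at the
length of the ledger, beyond which the state no longer changes. Linear growth of the state bounds
the intermediate states by the size of the ledger. -/
theorem eff_state (hi : Eff e fun y => ofNat (i y)) : Eff e fun y => (I (x y)).state (L y) (i y) := by
  obtain ⟨c, hc⟩ := h.growth
  have htake := Eff.take (Eff.min_unary hi hL.length_list) hL
  refine (Eff.foldl (β := fun _ => Data) (τ := fun _ => Data) (enc := fun _ d => d)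
    (encτ := fun _ d => d) (l := fun y => (L y).take (min (i y) (L y).length))
    (z := fun y => (I (x y)).st0) (f := fun y => (I (x y)).δ) (htake.congr fun y => by simp)
    (h.st0.comp x hx) (fun Δ d g s b _ lift hs hb => h.eff_δ (lift hx) hs hb)
    ((h.st0.comp x hx).bound.add ((Bounded.const c).mul htake.bound)) ?_).congr ?_
  · intro y l' hl'
    refine le_trans ?_ (Nat.add_le_add_left
      (Nat.mul_le_mul_left c (size_ofList_le_of_prefix hl')) _)
    generalize (I (x y)).st0 = s
    clear hl'
    induction l' generalizing s with
    | nil => simp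
    | cons a l ih =>
      have h₁ := ih ((I (x y)).δ s a)
      have h₂ := hc (x y) s a
      rw [List.foldl_cons, ofList_cons, size_cons, mul_add, mul_add]
      omega
  · intro y
    rw [Setting.state]
    congr 1
    exact List.take_eq_take_iff.2 (by simp)

omit h hx in
theorem eff_txAt (hi : Eff e fun y => ofNat (i y)) : Eff e fun y => Setting.txAt (L y) (i y) := by
  have hl := (Eff.const nil).ofList_cons hL
  refine (Eff.getD (Eff.min_unary hi hl.length_list) hl (.const nil)).congr fun y => ?_
  rw [Setting.txAt]
  rcases le_total (i y) (nil :: L y).length with h | h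
  · rw [min_eq_left h]
  · rw [min_eq_right h, List.getD_eq_default _ _ le_rfl, List.getD_eq_default _ _ h]

theorem eff_entry (hi : Eff e fun y => ofNat (i y)) :
    Eff e fun y => (I (x y)).entry (L y) (i y) :=
  (eff_txAt hL hi).cons (h.eff_commit hx (h.eff_state hx hL hi))

theorem eff_justify (hi : Eff e fun y => ofNat (i y)) :
    Eff e fun y => (I (x y)).justify (L y) (i y) :=
  (h.eff_entry hx hL hi).ofList_three (.const nil)
    (h.eff_prove hx (h.eff_state hx hL hi.pred) (eff_txAt hL hi))

-- Beyond the ledger every leaf has the default transaction and the final state, so all these leaves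
-- agree; inductively, so do all nodes of a given height at positions past `|L|`. This makes nodes
-- at exponentially large positions computable.
omit h hx hL in
theorem node_eq (J : Setting) (L : List Data) (a : ℕ) {j : ℕ} (hj : L.length + 1 ≤ j) :
    node J.hash (J.entry L) a j = node J.hash (J.entry L) a (L.length + 1) := by
  induction a generalizing j with
  | zero =>
    have : ∀ j, L.length + 1 ≤ j → J.entry L j = cons nil (J.commit (L.foldl J.δ J.st0)) := by
      intro j hj
      rw [Setting.entry, Setting.txAt, Setting.state, List.getD_eq_default _ _ (by simpa using hj),
        List.take_of_length_le (by omega)]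
    rw [node, node, this _ hj, this _ le_rfl]
  | succ a ih =>
    rw [node, node, ih (by omega : _ ≤ 2 * j), ih (by omega : _ ≤ 2 * j + 1),
      ih (by omega : _ ≤ 2 * (L.length + 1)), ih (by omega : _ ≤ 2 * (L.length + 1) + 1)]

/-- All nodes of a level. -/
theorem eff_level (ha : Eff e fun y => unary (a y)) :
    Eff e fun y => ofList ((List.range (L y).length.succ.succ).map
      (node (I (x y)).hash ((I (x y)).entry (L y)) (a y))) := by
  obtain ⟨B, hB, hsize⟩ := h.hash_size
  have hlen : Eff e fun y => unary ((L y).length.succ.succ) :=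
    ((Eff.const nil).ofList_cons ((Eff.const nil).ofList_cons hL)).length_list
  -- The recursion produces whole levels rather than single nodes: a node of height `i` has `2 ^ i`
  -- leaves below it, whereas by `node_eq` the first `|L| + 2` nodes represent the whole level.
  refine Eff.natRec (v := fun y i => ofList ((List.range (L y).length.succ.succ).map
      (node (I (x y)).hash ((I (x y)).entry (L y)) i))) ha ?_ ?_
    ((hlen.bound.mul ((hB.comp hx).add (.const 1))).add (.const 1)) ?_
  · refine Eff.map (β := fun _ => ℕ) (enc := fun _ => unary) hlen.range
      fun Δ d g b _ lift hb => ?_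
    exact h.eff_hash (lift hx) (h.eff_entry (lift hx) (lift hL) hb.bin)
  · intro Δ d g i _ lift _ hv
    refine Eff.map (β := fun _ => ℕ) (enc := fun _ => unary) (lift hlen).range
      fun Δ' d' g' b hb lift' hb' => ?_
    have hget : ∀ {m : Δ' → ℕ}, (Eff d' fun z => unary (m z)) → Eff d' fun z =>
        node (I (x (g (g' z)))).hash ((I (x (g (g' z)))).entry (L (g (g' z)))) (i (g' z)) (m z) := by
      intro m hm
      refine (Eff.getD (Eff.min_unary hm.bin (lift' (lift hlen)).tl) (lift' hv)
        (.const nil)).congr fun z => ?_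
      rw [List.getD_eq_getElem _ _ (by simp), List.getElem_map, List.getElem_range]
      rcases le_total (m z) ((L (g (g' z))).length + 1) with h | h
      · rw [min_eq_left h]
      · rw [min_eq_right h, node_eq _ _ _ h]
    have h₂ : Eff d' fun z => unary (2 * b z) := (hb'.unary_add hb').congr fun z => by rw [two_mul]
    exact h.eff_hash (lift' (lift hx)) ((hget h₂).cons (hget (h₂.unary_add (.const (unary 1)))))
  · intro y i _
    rw [size_unary]
    refine (size_ofList_le (m := B (x y)) fun d hd => ?_).trans ?_
    · obtain ⟨j, -, rfl⟩ := List.mem_map.1 hd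
      cases i <;> exact hsize _ _
    · rw [List.length_map, List.length_range]
      gcongr
      omega

theorem eff_node (ha : Eff e fun y => unary (a y)) (hj : Eff e fun y => ofNat (j y)) :
    Eff e fun y => node (I (x y)).hash ((I (x y)).entry (L y)) (a y) (j y) := by
  have hlen : Eff e fun y => unary ((L y).length + 1) :=
    ((Eff.const nil).ofList_cons hL).length_list
  refine (Eff.getD (Eff.min_unary hj hlen) (h.eff_level hx hL ha) (.const nil)).congr fun y => ?_
  rw [List.getD_eq_getElem _ _ (by simp), List.getElem_map, List.getElem_range]
  rcases le_total (j y) ((L y).length + 1) with h | h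
  · rw [min_eq_left h]
  · rw [min_eq_right h, node_eq _ _ _ h]

theorem eff_peaks (hl : Eff e fun y => ofNat (l y)) :
    Eff e fun y => ofList (peaks (I (x y)).hash ((I (x y)).entry (L y)) (l y)) :=
  Eff.map (β := fun _ => ℕ) (enc := fun _ => unary) hl.heights fun _ _ _ _ _ lift hb =>
    h.eff_node (lift hx) (lift hL) hb ((lift hl).peakPos hb)

theorem eff_merklePath (ha : Eff e fun y => unary (a y)) (hi : Eff e fun y => ofNat (i y)) :
    Eff e fun y => ofList (merklePath (I (x y)).hash ((I (x y)).entry (L y)) (a y) (i y)) :=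
  Eff.map (β := fun _ => ℕ) (enc := fun _ => unary) ha.range fun _ _ _ _ _ lift hb =>
    h.eff_node (lift hx) (lift hL) hb ((lift hi).div_pow hb).siblingPos

omit h hx hL in
theorem eff_heightAt (hl : Eff e fun y => ofNat (l y)) (hi : Eff e fun y => ofNat (i y)) :
    Eff e fun y => unary (heightAt (l y) (i y)) := by
  refine (Eff.find (β := fun _ => ℕ) (enc := fun _ => unary)
    (p := fun y a => decide (i y / 2 ^ a = peakPos (l y) a)) hl.heights fun _ _ _ _ _ lift hb =>
    ((lift hi).div_pow hb).eq_nat ((lift hl).peakPos hb)).tl.congr fun y => ?_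
  rw [heightAt]
  cases List.find? (fun a => decide (i y / 2 ^ a = peakPos (l y) a)) (heights (l y)) <;> rfl

omit h hx in
theorem eff_honest_size : Eff e fun y => (I (x y)).honest (L y) .size :=
  ((Eff.const nil).ofList_cons hL).length_list.bin

theorem eff_honest_claim : Eff e fun y => (I (x y)).honest (L y) .claim := by
  have hlen := hL.length_list.bin
  exact (h.eff_peaks hx hL hlen.succ).ofList_three (h.eff_entry hx hL hlen)
    (h.eff_merklePath hx hL (eff_heightAt hlen.succ hlen) hlen)

theorem eff_honest_suffix (hi : Eff e fun y => ofNat (i y)) (hm : Eff e fun y => unary (m y)) :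
    Eff e fun y => (I (x y)).honest (L y) (.suffix (i y) (m y)) :=
  Eff.map (β := fun _ => ℕ) (enc := fun _ => unary) hm.range fun _ _ _ _ _ lift hb =>
    h.eff_justify (lift hx) (lift hL) ((lift hi).add_unary hb)

theorem eff_honest_children (ha : Eff e fun y => unary (a y)) (hj : Eff e fun y => ofNat (j y)) :
    Eff e fun y => (I (x y)).honest (L y) (.children (a y) (j y)) :=
  (h.eff_node hx hL ha hj.double).cons (h.eff_node hx hL ha hj.double.succ)

theorem eff_honest_pick (ha : Eff e fun y => unary (a y)) (hj : Eff e fun y => ofNat (j y))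
    (hv : Eff e v₁) : Eff e fun y => (I (x y)).honest (L y) (.pick (a y) (j y) (v₁ y) (v₂ y)) :=
  (Eff.const nil).cons ((h.eff_node hx hL ha hj.double).eq hv)

theorem eff_honest_leaf (hj : Eff e fun y => ofNat (j y)) :
    Eff e fun y => (I (x y)).honest (L y) (.leaf (j y)) :=
  (h.eff_entry hx hL hj.pred).cons ((h.eff_merklePath hx hL
    (eff_heightAt hL.length_list.bin.succ hj.pred) hj.pred).cons (h.eff_justify hx hL hj))

omit h hx hL in
theorem eff_zip_heights {pk : Γ → List Data} (hl : Eff e fun y => ofNat (l y))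
    (hpk : Eff e fun y => ofList (pk y)) : Eff e fun y =>
      ofList (((heights (l y)).zip (pk y)).map fun z : ℕ × Data => cons (unary z.1) z.2) := by
  have hlen : Eff e fun y => unary (min (heights (l y)).length (pk y).length) :=
    Eff.min_unary hl.heights.length.bin hpk.length_list
  refine (Eff.map (β := fun _ => ℕ) (enc := fun _ => unary)
    (f := fun y i => cons (((heights (l y)).map unary).getD i nil) ((pk y).getD i nil))
    hlen.range fun _ _ _ _ _ lift hb =>
    (Eff.getD hb (lift hl.heights) (.const nil)).cons (Eff.getD hb (lift hpk) (.const nil))).congr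
    fun y => ?_
  congr 1
  refine List.ext_getElem (by simp) fun i h₁ h₂ => ?_
  simp only [List.length_map, List.length_range, List.length_zip, lt_min_iff] at h₁ h₂
  simp [h₁.1, h₁.2]

theorem eff_honest_move {pk : Γ → List Data} (hl : Eff e fun y => ofNat (l y))
    (hpk : Eff e fun y => ofList (pk y)) :
    Eff e fun y => (I (x y)).honest (L y) (.move (l y) (pk y)) := by
  have hz := eff_zip_heights hl hpk
  let p : ∀ y, ℕ × Data → Bool := fun y z =>
    decide (node (I (x y)).hash ((I (x y)).entry (L y)) z.1 (peakPos (l y) z.1) ≠ z.2)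
  have hflags := Eff.map (β := fun _ => ℕ × Data) (f := fun y z => ofBool (p y z)) hz
    fun _ _ _ b _ lift hb => ((h.eff_node (a := fun z => (b z).1) (lift hx) (lift hL) hb.hd
      ((lift hl).peakPos hb.hd)).eq hb.tl).not
  have hidx := Eff.find (β := fun _ => ℕ) (enc := fun _ => unary)
    (p := fun y i => decide (((((heights (l y)).zip (pk y)).map
      fun z => ofBool (p y z)).getD i nil) ≠ nil)) hz.length.range
    fun _ _ _ b _ lift hb => ((Eff.getD hb (lift hflags) (.const nil)).eq (.const nil)).not
  refine (Eff.comp₁ (F := fun o => Data.cond o (cons (cons nil nil) (Data.bin o.tl)) (cons nil nil))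
    (by fun_prop) hidx).congr fun y => ?_
  rw [Setting.honest]
  generalize (heights (l y)).zip (pk y) = zs
  have key : (List.range zs.length).find? (fun i => decide ((zs.map fun z => ofBool (p y z)).getD i nil ≠ nil)) =
      zs.findIdx? (p y) := by
    rcases hf : zs.findIdx? (p y) with _ | i
    · rw [List.find?_eq_none]
      rw [List.findIdx?_eq_none_iff] at hf
      intro i hi
      rw [List.mem_range] at hi
      simp [hi, hf _ (List.getElem_mem hi)]
    · rw [List.findIdx?_eq_some_iff_getElem] at hf
      obtain ⟨hi, h₁, h₂⟩ := hf
      rw [List.find?_range_eq_some]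
      refine ⟨by simp [hi, h₁], by simpa using hi, fun j hj => ?_⟩
      have := h₂ j hj
      simp [hj.trans hi, this]
  rw [key]
  show _ = match zs.findIdx? (p y) with
      | none => cons nil nil
      | some i => cons (cons nil nil) (ofNat i)
  cases zs.findIdx? (p y) <;> simp [ofOption]

end Feasible


/-! ### The algorithm of the verifier -/

def Claim.encode {n : ℕ} (c : Claim n) : Data :=
  cons (ofNat c.prover) (cons (ofNat c.size) (cons (ofList c.peaks) c.last))

def Outcome.encode {n : ℕ} : Outcome n → Data
  | challengerLoses => cons nil nil
  | responderLoses => nil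
  | nested c => cons (cons nil nil) c.encode

/-- The result and the transcript of an interaction can be computed in polynomial time. -/
def EffRun {Γ : Type} (e : Γ → Data) {α : Γ → Type} (enc : ∀ y, α y → Data)
    (prog : ∀ y, StateM Log (α y)) (s : Γ → Log) : Prop :=
  (Eff e fun y => enc y ((prog y).run (s y)).1) ∧
    Eff e fun y => ofList ((prog y).run (s y)).2.transcript

namespace EffRun

variable {Γ : Type} {e : Γ → Data} {α β : Γ → Type} {enc : ∀ y, α y → Data}
  {enc' : ∀ y, β y → Data} {s : Γ → Log} {prog prog' : ∀ y, StateM Log (α y)}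

theorem pure {a : ∀ y, α y} (ha : Eff e fun y => enc y (a y))
    (hs : Eff e fun y => ofList (s y).transcript) :
    EffRun e enc (fun y => Pure.pure (a y)) s := ⟨ha, hs⟩

theorem bind {f : ∀ y, α y → StateM Log (β y)} (h : EffRun e enc prog s)
    (hf : ∀ (a : ∀ y, α y) (s' : Γ → Log), (Eff e fun y => enc y (a y)) →
      (Eff e fun y => ofList (s' y).transcript) → EffRun e enc' (fun y => f y (a y)) s') :
    EffRun e enc' (fun y => prog y >>= f y) s := hf _ _ h.1 h.2

theorem congr (h : EffRun e enc prog s) (h' : ∀ y, prog y = prog' y) : EffRun e enc prog' s :=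
  funext h' ▸ h

theorem cases {p : Γ → Prop} [DecidablePred p] (hp : Eff e fun y => ofProp (p y))
    (h₁ : EffRun (fun y : {y // p y} => e y) (fun y => enc y) (fun y => prog y) fun y => s y)
    (h₂ : EffRun (fun y : {y // ¬ p y} => e y) (fun y => enc y) (fun y => prog y) fun y => s y) :
    EffRun e enc prog s :=
  ⟨.cases hp h₁.1 h₂.1, .cases hp h₁.2 h₂.2⟩

theorem sub {Δ : Type} (h : EffRun e enc prog s) (g : Δ → Γ) :
    EffRun (fun z => e (g z)) (fun z => enc (g z)) (fun z => prog (g z)) fun z => s (g z) :=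
  ⟨h.1.sub g, h.2.sub g⟩

theorem ite {p : Γ → Prop} [DecidablePred p] (hp : Eff e fun y => ofProp (p y))
    (h₁ : EffRun e enc prog s) (h₂ : EffRun e enc prog' s) :
    EffRun e enc (fun y => if p y then prog y else prog' y) s :=
  cases hp ((h₁.sub _).congr fun y => by rw [if_pos y.2])
    ((h₂.sub _).congr fun y => by rw [if_neg y.2])

/-- Case distinction on an optional value. -/
theorem option {o : ∀ y, Option (β y)} (ho : Eff e fun y => ofOption ((o y).map (enc' y)))
    (h₁ : ∀ (Δ : Type) (d : Δ → Data) (g : Δ → Γ), (∀ z, o (g z) = none) →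
      (∀ {w : Γ → Data}, Eff e w → Eff d fun z => w (g z)) →
      EffRun d (fun z => enc (g z)) (fun z => prog (g z)) fun z => s (g z))
    (h₂ : ∀ (Δ : Type) (d : Δ → Data) (g : Δ → Γ) (b : ∀ z, β (g z)), (∀ z, o (g z) = some (b z)) →
      (∀ {w : Γ → Data}, Eff e w → Eff d fun z => w (g z)) → (Eff d fun z => enc' (g z) (b z)) →
      EffRun d (fun z => enc (g z)) (fun z => prog (g z)) fun z => s (g z)) :
    EffRun e enc prog s := by
  have hp : Eff e fun y => ofProp (o y = none) := (ho.eq (.const nil)).congr fun y => by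
    cases o y <;> simp [ofOption, ofProp]
  refine cases hp (h₁ _ _ _ (fun z => z.2) fun h => h.sub _)
    (h₂ _ _ (fun z : {y // ¬ o y = none} => z.1)
      (fun z => (o z.1).get (Option.isSome_iff_ne_none.2 z.2)) (fun z => by simp)
      (fun h => h.sub _) ?_)
  refine (ho.tl.sub _).congr fun z => ?_
  obtain ⟨b, hb⟩ := Option.ne_none_iff_exists'.1 z.2
  simp [hb, ofOption]

/-- Value and transcript together form the state of an ordinary fold. The counters in `Log` need no
encoding, since no message depends on them. -/
theorem foldlM {τ : Γ → Type} {encτ : ∀ y, τ y → Data} {l : ∀ y, List (β y)} {z : ∀ y, τ y}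
    {f : ∀ y, τ y → β y → StateM Log (τ y)} {B : Γ → ℕ}
    (hl : Eff e fun y => ofList ((l y).map (enc' y))) (hz : Eff e fun y => encτ y (z y))
    (hs : Eff e fun y => ofList (s y).transcript)
    (hf : ∀ (Δ : Type) (d : Δ → Data) (g : Δ → Γ) (a : ∀ z, τ (g z)) (s' : Δ → Log)
      (b : ∀ z, β (g z)), (∀ {w : Γ → Data}, Eff e w → Eff d fun z => w (g z)) →
      (Eff d fun z => encτ (g z) (a z)) → (Eff d fun z => ofList (s' z).transcript) →
      (Eff d fun z => enc' (g z) (b z)) →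
      EffRun d (fun z => encτ (g z)) (fun z => f (g z) (a z) (b z)) s')
    (hB : Bounded e B)
    (hv : ∀ y l', l' <+: l y → (encτ y ((l'.foldlM (f y) (z y)).run (s y)).1).size +
      (ofList ((l'.foldlM (f y) (z y)).run (s y)).2.transcript).size ≤ B y) :
    EffRun e encτ (fun y => (l y).foldlM (f y) (z y)) s := by
  let F : ∀ y, τ y × Log → β y → τ y × Log := fun y p b => (f y p.1 b).run p.2
  have hfold : ∀ y (l' : List (β y)) (p : τ y × Log), l'.foldl (F y) p =
      (l'.foldlM (f y) p.1).run p.2 := by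
    intro y l'
    induction l' with
    | nil => intro p; rfl
    | cons b l ih => intro p; rw [List.foldl_cons, ih]; rfl
  have := Eff.foldl (τ := fun y => τ y × Log)
    (encτ := fun y p => Data.cons (encτ y p.1) (ofList p.2.transcript))
    (z := fun y => (z y, s y)) (f := F) hl (hz.cons hs)
    (fun Δ d g p b _ lift hp hb =>
      (hf Δ d g (fun z => (p z).1) (fun z => (p z).2) b lift hp.hd hp.tl hb).1.cons
      (hf Δ d g (fun z => (p z).1) (fun z => (p z).2) b lift hp.hd hp.tl hb).2)
    (hB.add (.const 1)) fun y l' hl' => by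
      rw [hfold]
      exact Nat.succ_le_succ (hv y l' hl')
  simp only [hfold] at this
  exact ⟨this.hd, this.tl⟩

end EffRun

namespace Feasible

variable {X : Type} {I : X → Setting} {e₀ : X → Data} (h : Feasible I e₀)
  {Γ : Type} {e : Γ → Data} {x : Γ → X} (hx : Eff e fun y => e₀ (x y))
  {i j l m : Γ → ℕ} {v v₁ v₂ v₃ : Γ → Data} {pk path : Γ → List Data} {s : Γ → Log}
  {p : ∀ y, Fin (I (x y)).n} {c : ∀ y, Claim (I (x y)).n}

include h hx

theorem eff_pathRoot (hv : Eff e v) (hj : Eff e fun y => ofNat (j y))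
    (hpath : Eff e fun y => ofList (path y)) :
    Eff e fun y => pathRoot (I (x y)).hash (v y) (j y) (path y) := by
  obtain ⟨B, hB, hsize⟩ := h.hash_size
  let f : Γ → Data × ℕ → Data → Data × ℕ := fun y s d =>
    (if s.2 % 2 = 0 then (I (x y)).hash (cons s.1 d) else (I (x y)).hash (cons d s.1), s.2 / 2)
  have hfold : ∀ y (l : List Data) (s : Data × ℕ),
      (l.foldl (f y) s).1 = pathRoot (I (x y)).hash s.1 s.2 l := by
    intro y l
    induction l with
    | nil => intro s; rfl
    | cons d l ih => intro s; rw [List.foldl_cons, ih]; rfl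
  refine (Eff.foldl (β := fun _ => Data) (enc := fun _ d => d) (τ := fun _ => Data × ℕ)
    (encτ := fun _ s => cons s.1 (ofNat s.2)) (z := fun y => (v y, j y)) (f := f)
    (hpath.congr fun y => by simp) (hv.cons hj) (fun Δ d g s b _ lift hs hb =>
      .cons (.ite (p := fun z => (s z).2 % 2 = 0) hs.tl.even (h.eff_hash (lift hx) (hs.hd.cons hb))
        (h.eff_hash (lift hx) (hb.cons hs.hd))) hs.tl.half)
    (((hv.bound.add (hB.comp hx)).add hj.bound).add (.const 1)) ?_).hd.congr fun y => hfold y _ _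
  intro y l' _
  have : ∀ (l : List Data) (s : Data × ℕ), s.1.size ≤ (v y).size + B (x y) →
      (ofNat s.2).size ≤ (ofNat (j y)).size → (l.foldl (f y) s).1.size ≤ (v y).size + B (x y) ∧
        (ofNat (l.foldl (f y) s).2).size ≤ (ofNat (j y)).size := by
    intro l
    induction l with
    | nil => intro s h₁ h₂; exact ⟨h₁, h₂⟩
    | cons d l ih =>
      intro s h₁ h₂
      refine ih _ ?_ ?_
      · dsimp only [f]
        split_ifs <;> exact (hsize _ _).trans (Nat.le_add_left _ _)
      · dsimp only [f]
        rw [← tl_ofNat]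
        exact (size_tl_le _).trans h₂
  obtain ⟨h₁, h₂⟩ := this l' (v y, j y) (Nat.le_add_right _ _) le_rfl
  rw [size_cons]
  omega

theorem eff_merkleVerify (hl : Eff e fun y => ofNat (l y)) (hpk : Eff e fun y => ofList (pk y))
    (hi : Eff e fun y => ofNat (i y)) (hv : Eff e v) (hpath : Eff e fun y => ofList (path y)) :
    Eff e fun y => ofBool (merkleVerify (I (x y)).hash (l y) (pk y) (i y) (v y) (path y)) := by
  refine Eff.any (β := fun _ => ℕ × Data) (eff_zip_heights hl hpk) fun Δ d g b _ lift hb => ?_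
  refine (Eff.and (p := fun z => i (g z) / 2 ^ (b z).1 = peakPos (l (g z)) (b z).1 ∧
    (path (g z)).length = (b z).1) (q := fun z => pathRoot (I (x (g z))).hash
      ((I (x (g z))).hash (v (g z))) (i (g z)) (path (g z)) = (b z).2)
    (.and (((lift hi).div_pow hb.hd).eq_nat ((lift hl).peakPos hb.hd))
      ((lift hpath.length_list).eq_unary hb.hd))
    ((h.eff_pathRoot (lift hx) (h.eff_hash (lift hx) (lift hv)) (lift hi) (lift hpath)).eq
      hb.tl)).congr fun z => ?_
  simp [ofProp]

theorem eff_validStep (h₁ : Eff e v₁) (h₂ : Eff e v₂) :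
    Eff e fun y => ofBool ((I (x y)).validStep (v₁ y) (v₂ y)) := by
  have hco := h.eff_co hx h₁.hd (h₂.nth 0).hd (h₂.nth 1)
  have hex := (h.eff_sδ hx h₁.tl (h₂.nth 0).hd (h₂.nth 2)).eq ((Eff.const nil).cons (h₂.nth 0).tl)
  refine (Eff.comp₂ (F := fun a b => Data.cond a b nil) (by fun_prop) hco hex).congr fun y => ?_
  rw [Setting.validStep, cond_ofBool]
  cases (I (x y)).co (v₁ y).hd ((v₂ y).nth 0).hd ((v₂ y).nth 1)
  · simp
  · cases (I (x y)).sδ (v₁ y).tl ((v₂ y).nth 0).hd ((v₂ y).nth 2) <;> simp [ofOption, ofProp]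

/-- The check of a suffix and its last entry. -/
theorem eff_chain (hv : Eff e v) (hpath : Eff e fun y => ofList (path y)) :
    (Eff e fun y => ofBool ((I (x y)).validChain (v y) (path y))) ∧
      Eff e fun y => Setting.lastEntry (v y) (path y) := by
  let f : Γ → Bool × Data → Data → Bool × Data := fun y s d =>
    (s.1 && (I (x y)).validStep s.2 d, d.nth 0)
  have hfold : ∀ y (l : List Data) (s : Bool × Data), l.foldl (f y) s =
      (s.1 && (I (x y)).validChain s.2 l, Setting.lastEntry s.2 l) := by
    intro y l
    induction l with
    | nil => intro s; simp [Setting.validChain, Setting.lastEntry]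
    | cons d l ih =>
      intro s
      rw [List.foldl_cons, ih]
      simp only [f, Setting.validChain, Setting.lastEntry, Bool.and_assoc, List.map_cons,
        List.getLastD_cons]
  have := Eff.foldl (β := fun _ => Data) (enc := fun _ d => d) (τ := fun _ => Bool × Data)
    (encτ := fun _ s => cons (ofBool s.1) s.2) (l := path) (z := fun y => (true, v y)) (f := f)
    (hpath.congr fun y => by simp) ((Eff.const _).cons hv) (fun Δ d g s b _ lift hs hb =>
      .cons ((Eff.comp₂ (F := fun a b => Data.cond a b nil) (by fun_prop) hs.hd
        (h.eff_validStep (lift hx) hs.tl hb)).congr fun z => by cases h : (s z).1 <;> simp [f, h])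
        (hb.nth 0))
    ((hv.bound.add hpath.bound).add (.const 4)) (fun y l' hl' => ?_)
  · refine ⟨this.hd.congr fun y => ?_, this.tl.congr fun y => ?_⟩
    · simp [hfold]
    · simp [hfold]
  · rw [hfold, size_cons]
    have h₁ : (Setting.lastEntry (v y) l').size ≤ (v y).size + (ofList (path y)).size := by
      have h₃ := size_ofList_le_of_prefix hl'
      rcases List.eq_nil_or_concat l' with rfl | ⟨t, d, rfl⟩
      · exact Nat.le_add_right _ _
      · have : Setting.lastEntry (v y) (t.concat d) = d.hd := by
          simp [Setting.lastEntry, hd_eq_getD, nth]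
        rw [this]
        have h₂ : d.size ≤ (ofList (t.concat d)).size := size_le_of_mem_toList (by simp)
        have := size_hd_le d
        omega
    have h₂ : ∀ b, (ofBool b).size ≤ 3 := by decide
    have := h₂ (true && (I (x y)).validChain (v y) l')
    dsimp only
    omega

theorem eff_leafOk (hc : Eff e fun y => (c y).encode) (hj : Eff e fun y => ofNat (j y))
    (h₁ : Eff e v₁) (h₂ : Eff e v₂) :
    Eff e fun y => ofBool ((I (x y)).leafOk (c y) (j y) (v₁ y) (v₂ y)) := by
  have hif := Eff.ite (hj.eq_nat (.congr (.const nil) (v₂ := fun _ => ofNat 0) fun _ => by simp))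
    ((h₂.nth 2).eq ((Eff.const nil).cons (h.eff_commit hx (h.st0.comp x hx))))
    (.comp₂ (F := fun a b => Data.cond a b nil) (by fun_prop)
      (h.eff_merkleVerify hx hc.tl.hd hc.tl.tl.hd hj.pred (h₂.nth 0) (h₂.nth 1).toList)
      (h.eff_validStep hx (h₂.nth 0) h₂.tl.tl))
  refine (Eff.comp₂ (F := fun a b => Data.cond a b nil) (by fun_prop) (.and (h₂.eq (.const nil)).not
    ((h.eff_hash hx (h₂.nth 2)).eq h₁)) hif).congr fun y => ?_
  rw [Setting.leafOk, cond_ofProp]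
  by_cases hm : v₂ y = nil
  · simp [hm]
  by_cases hh : (I (x y)).hash ((v₂ y).nth 2) = v₁ y
  · by_cases hj : j y = 0
    · simp [hm, hh, hj, ofProp]
    · simp only [hm, hh, hj, not_false_eq_true, and_self, if_true, if_false, ne_eq, decide_true,
        Bool.true_and, cond_ofBool]
      cases merkleVerify (I (x y)).hash (c y).size (c y).peaks (j y - 1) ((v₂ y).nth 0)
        ((v₂ y).nth 1).toList <;> rfl
  · simp [hm, hh]

theorem effRun_ask {q : Γ → Query} {r : Γ → ℕ} (hs : Eff e fun y => ofList (s y).transcript)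
    (hp : Eff e fun y => ofNat (p y)) (hq : Eff e fun y => (q y).encode)
    (hm : Eff e fun y => unary (m y))
    (hL : ∀ (Δ : Type) (d : Δ → Data) (g : Δ → Γ) (L : Δ → List Data),
      (∀ {w : Γ → Data}, Eff e w → Eff d fun z => w (g z)) → (Eff d fun z => ofList (L z)) →
      Eff d fun z => (I (x (g z))).honest (L z) (q (g z))) :
    EffRun e (fun _ d => d) (fun y => (I (x y)).ask (p y) (q y) (r y) (m y)) s := by
  have hmsg : Eff e fun y => (match (I (x y)).ledger (p y) with
      | some L => (I (x y)).honest L (q y)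
      | none => (I (x y)).adv (m y) (ofList (s y).transcript) (ofList [ofNat (p y), (q y).encode])) := by
    have ho := h.eff_ledger hx hp
    have ho' : Eff e fun y => ofProp ((I (x y)).ledger (p y) = none) :=
      (ho.eq (.const nil)).congr fun y => by
        cases (I (x y)).ledger (p y) <;> simp [ofOption, ofProp]
    refine Eff.cases ho' ?_ ?_
    · refine ((h.eff_adv hx hm hs (hp.ofList_two hq)).sub _).congr fun y => ?_
      simp only [y.2]
    · refine (hL _ _ _ (fun z : {y // ¬ (I (x y)).ledger (p y) = none} =>
          ((I (x z)).ledger (p z)).get (Option.isSome_iff_ne_none.2 z.2))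
        (fun h => h.sub _) ((ho.tl.sub _).congr fun z => ?_)).congr fun z => ?_
      · obtain ⟨b, hb⟩ := Option.ne_none_iff_exists'.1 z.2
        simp [hb, ofOption]
      · obtain ⟨b, hb⟩ := Option.ne_none_iff_exists'.1 z.2
        simp only [hb, Option.get_some]
  exact ⟨hmsg, (hp.ofList_three hq hmsg).ofList_cons hs⟩

omit h hx in
theorem eff_tag (t : ℕ) : Eff e fun _ => unary t := .const _

theorem effRun_getClaim {r : Γ → ℕ} (hs : Eff e fun y => ofList (s y).transcript)
    (hp : Eff e fun y => ofNat (p y)) (hl : Eff e fun y => ofNat (l y)) :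
    EffRun e (fun _ o => ofOption (o.map Claim.encode))
      (fun y => (I (x y)).getClaim (p y) (l y) (r y)) s := by
  refine .bind (h.effRun_ask hx hs hp (q := fun _ => .claim) (eff_tag 1).ofList_one
    ((hl.heights.length.unary_add (.const (unary 2))).unary_add (eff_heightAt hl hl.pred))
    fun Δ d g L lift hL => h.eff_honest_claim (lift hx) hL) fun m s' hm hs' => ?_
  refine .ite (p := fun y => 1 ≤ l y ∧ ((m y).nth 0).toList.length = (heights (l y)).length ∧
    merkleVerify (I (x y)).hash (l y) ((m y).nth 0).toList (l y - 1) ((m y).nth 1)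
      ((m y).nth 2).toList = true) (.and (Eff.le (m := fun _ => 1) (.const _) hl) (.and
    ((hm.nth 0).toList.length_list.eq_unary hl.heights.length) ?_)) ?_ ?_
  · refine (h.eff_merkleVerify hx hl (hm.nth 0).toList hl.pred (hm.nth 1) (hm.nth 2).toList).congr
      fun y => ?_
    rw [ofProp]
    congr 1
    exact Bool.decide_eq_true.symm
  · exact .pure (α := fun y => Option (Claim (I (x y)).n)) (a := fun y => some ⟨p y, l y, ((m y).nth 0).toList, (m y).nth 1⟩)
      ((Eff.const nil).cons (hp.cons (hl.cons ((hm.nth 0).toList.cons (hm.nth 1))))) hs'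
  · exact .pure (α := fun y => Option (Claim (I (x y)).n)) (a := fun _ => none) (.const nil) hs'

theorem effRun_monologue (hs : Eff e fun y => ofList (s y).transcript)
    (hp : Eff e fun y => ofNat (p y)) (hl : Eff e fun y => ofNat (l y))
    (hc : Eff e fun y => (c y).encode) :
    EffRun e (fun _ => Outcome.encode) (fun y => (I (x y)).monologue (p y) (l y) (c y)) s := by
  have hw := h.window.comp x hx
  have hcs : Eff e fun y => ofNat (c y).size := hc.tl.hd
  have hcp : Eff e fun y => ofList (c y).peaks := hc.tl.tl.hd
  have hcl : Eff e fun y => (c y).last := hc.tl.tl.tl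
  have hm := Eff.min_sub hcs hl hw
  have hchal : ∀ {Δ : Type} {d : Δ → Data} {g : Δ → Γ} {s : Δ → Log},
      (Eff d fun z => ofList (s z).transcript) →
      EffRun d (fun _ => Outcome.encode)
        (fun z => (return .challengerLoses : StateM Log (Outcome (I (x (g z))).n))) s :=
    fun hs => .pure (.const _) hs
  refine .bind (h.effRun_ask hx hs hp
    (q := fun y => .suffix (c y).size (min (l y - (c y).size) (I (x y)).window))
    ((eff_tag 3).ofList_three hcs hm.bin)
    (hm.unary_mul (((Eff.const (unary 2)).unary_add (h.f.comp x hx)).unary_add (h.g.comp x hx)))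
    fun Δ d g L lift hL => h.eff_honest_suffix (lift hx) hL (lift hcs) (lift hm))
    fun v s' hv hs' => ?_
  have hchain := h.eff_chain hx hcl hv.toList
  refine .ite (.or (hv.toList.length_list.eq_unary hm).not ?_) (hchal (g := fun y => y) hs') (.ite ?_ (.pure (.const _) hs') ?_)
  · refine (hchain.1.eq (.const nil)).congr fun y => ?_
    cases (I (x y)).validChain (c y).last (v y).toList <;> simp [ofProp]
  -- The difference of the sizes may be exponentially large. It exceeds the window iff it reaches
  -- `window + 1` after being capped there, and the capped value is computable in unary.
  · refine (Eff.eq_unary (Eff.min_sub hcs hl (hw.unary_add (.const (unary 1))))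
      (hw.unary_add (.const (unary 1)))).congr fun y => ?_
    simp only [ofProp]
    congr 2
    rw [eq_iff_iff]
    omega
  · refine .bind (h.effRun_getClaim hx (r := fun _ => 0) hs' hp hl) fun o s'' ho hs'' => ?_
    refine .option (enc' := fun _ => Claim.encode) ho ?_ ?_
    · intro Δ d g hg lift
      refine (hchal (lift hs'')).congr fun z => ?_
      rw [hg z]
    · intro Δ d g c' hg lift hc'
      refine (EffRun.ite (p := fun z => (c' z).last = Setting.lastEntry (c (g z)).last (v (g z)).toList ∧
        (l (g z) = (c (g z)).size → (c' z).peaks = (c (g z)).peaks)) (.and (hc'.tl.tl.tl.eq (lift hchain.2)) ?_)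
        (.pure (α := fun z => Outcome (I (x (g z))).n) (enc := fun _ => Outcome.encode)
          (a := fun z => .nested (c' z)) ((Eff.const _).cons hc') (lift hs''))
        (hchal (lift hs''))).congr fun z => ?_
      · refine (Eff.or ((lift hl).eq_nat (lift hcs)).not
          (hc'.tl.tl.hd.eq (lift hcp))).congr fun z => ?_
        simp only [ofProp, hd_cons, tl_cons, Claim.encode, imp_iff_not_or, ofList_injective.eq_iff]
      · rw [hg z]

end Feasible


/-! ### The size of the transcript -/

theorem size_le_add_one_of_le_two_mul_add_one {m n : ℕ} (h : m ≤ 2 * n + 1) : m.size ≤ n.size + 1 := by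
  rw [Nat.size_le, pow_succ]
  have := Nat.lt_size_self n
  omega

theorem size_le_self (n : ℕ) : n.size ≤ n := Nat.size_le.2 Nat.lt_two_pow_self

theorem size_ofNat_le_of_le {m k : ℕ} (h : m ≤ k) : (ofNat m).size ≤ 4 * k + 1 := by
  have := size_ofNat_le m
  have := size_le_self m
  omega

theorem log_le_size (n : ℕ) : Nat.log 2 n ≤ n.size := by
  rcases Nat.eq_zero_or_pos n with rfl | h
  · simp
  · exact (Nat.lt_size.2 (Nat.pow_log_le_self 2 h.ne')).le

theorem size_le_size_ofNat (n : ℕ) : n.size ≤ (ofNat n).size := by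
  rw [← length_toList_ofNat]
  exact (length_toList_lt _).le

theorem size_toNat_le (d : Data) : d.toNat.size ≤ d.size :=
  (Nat.size_le.2 (toNat_lt d)).trans (length_toList_lt d).le

theorem length_heights_le_size (l : ℕ) : (heights l).length ≤ l.size := by
  rw [heights_eq_filter l l.size (Nat.lt_size_self l)]
  exact (List.length_filter_le _ _).trans (by simp)

/-- Each level of the bisection adds at most one digit to the position and lowers the height by one.
The sum of the two thus never increases during a game; this is its initial bound. -/
theorem size_peakPos_add_le {l a : ℕ} (h : a ∈ heights l) : (peakPos l a).size + a ≤ l.size := by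
  have h₁ := peakPos_lt h
  have h₂ := Nat.lt_size_self l
  have h₃ : a < l.size := by
    rw [Nat.lt_size]
    exact (Nat.le_mul_of_pos_left _ (by omega)).trans h₁
  have : (peakPos l a).size ≤ l.size - a := by
    rw [Nat.size_le]
    by_contra hlt
    have h₄ : 2 ^ (l.size - a) * 2 ^ a ≤ (peakPos l a + 1) * 2 ^ a := by gcongr; omega
    rw [← pow_add, Nat.sub_add_cancel h₃.le] at h₄
    omega
  omega

theorem Triple.bind_univ {α β : Type} {s : Log} {x : StateM Log α} {f : α → StateM Log β}
    {Q : α → Log → Prop} {R : β → Log → Prop} (hx : Triple Set.univ s x Q)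
    (hf : ∀ a s', Q a s' → Triple Set.univ s' (f a) R) : Triple Set.univ s (x >>= f) R :=
  fun h => hf _ _ (hx fun _ _ => trivial) h

/-- At most `k` entries, each of size at most `E`, are added to the transcript. -/
def Grow (E k : ℕ) (s s' : Log) : Prop :=
  ∃ new, s'.transcript = new ++ s.transcript ∧ new.length ≤ k ∧ ∀ d ∈ new, d.size ≤ E

namespace Grow

variable {E k k' : ℕ} {s s' s'' : Log}

theorem refl (E k : ℕ) (s : Log) : Grow E k s s := ⟨[], rfl, Nat.zero_le _, by simp⟩

theorem trans (h : Grow E k s s') (h' : Grow E k' s' s'') : Grow E (k + k') s s'' := by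
  obtain ⟨l, h₁, h₂, h₃⟩ := h
  obtain ⟨l', h₁', h₂', h₃'⟩ := h'
  refine ⟨l' ++ l, by rw [h₁', h₁, List.append_assoc], by rw [List.length_append]; omega, ?_⟩
  intro d hd
  rcases List.mem_append.1 hd with hd | hd
  · exact h₃' d hd
  · exact h₃ d hd

theorem of_le (h : Grow E k s s') (hk : k ≤ k') : Grow E k' s s' := by
  obtain ⟨l, h₁, h₂, h₃⟩ := h
  exact ⟨l, h₁, h₂.trans hk, h₃⟩

theorem size_le (h : Grow E k s s') :
    (ofList s'.transcript).size ≤ (ofList s.transcript).size + k * (E + 1) := by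
  obtain ⟨l, h₁, h₂, h₃⟩ := h
  have h₄ := size_ofList_append l s.transcript
  have h₅ := size_ofList_le h₃
  have h₆ : l.length * (E + 1) ≤ k * (E + 1) := by gcongr
  rw [h₁]
  omega

end Grow

/-- Numbers in the query have at most `k` digits, and other parts have size at most `W`. -/
def Query.Small (k W : ℕ) : Query → Prop
  | size | claim => True
  | move l pk => l.size ≤ k ∧ (ofList pk).size ≤ W
  | suffix i m => i.size ≤ k ∧ m ≤ k
  | children a j => a ≤ k ∧ j.size ≤ k
  | pick a j hl hr => a ≤ k ∧ j.size ≤ k ∧ hl.size ≤ W ∧ hr.size ≤ W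
  | leaf j => j.size ≤ k

theorem Query.Small.size_encode_le {k W : ℕ} {q : Query} (h : q.Small k W) :
    q.encode.size ≤ 8 * k + 2 * W + 22 := by
  have key : ∀ {m : ℕ}, m.size ≤ k → (ofNat m).size ≤ 4 * k + 1 := fun {m} hm =>
    (size_ofNat_le m).trans (by omega)
  cases q with
  | size => simp [encode]
  | claim => simp [encode]
  | move l pk => have := key h.1; have := h.2; simp [encode]; omega
  | suffix i m => have := key h.1; have := size_ofNat_le_of_le h.2; simp [encode]; omega
  | children a j => have := key h.2; have := size_ofNat_le_of_le h.1; simp [encode]; omega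
  | pick a j hl hr =>
    have := key h.2.1; have := size_ofNat_le_of_le h.1; have := h.2.2; simp [encode]; omega
  | leaf j => have := key h; simp [encode]; omega

def Claim.Small {n : ℕ} (k W : ℕ) (c : Claim n) : Prop :=
  c.size.size ≤ k ∧ c.peaks.length ≤ k ∧ (ofList c.peaks).size ≤ W ∧ c.last.size ≤ W

namespace Setting

variable {I : Setting} {k M W : ℕ} {s : Log}

/-- Messages that answer queries with small numbers have size at most `M`. -/
structure Bounds (I : Setting) (k M : ℕ) : Prop where
  window : I.window ≤ k
  f : I.f ≤ k
  g : I.g ≤ k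
  n : I.n ≤ k
  ask : ∀ p q r w s W, q.Small k W → w ≤ (2 * k + 8) * (2 * k + 2) →
    ((I.ask p q r w).run s).1.size ≤ M

/-- A bound for the size of an entry of the transcript. -/
def entryBound (k W : ℕ) : ℕ := 12 * k + 3 * W + 30

theorem ask_grow (hb : Bounds I k M) (hW : M ≤ W) (s : Log) (p : Fin I.n) {q : Query} (r : ℕ) {w : ℕ}
    (hq : q.Small k W) (hw : w ≤ 2 * k + 8 ∨ w ≤ (2 * k + 8) * (2 * k + 2)) :
    Triple Set.univ s (I.ask p q r w) fun m s' => m.size ≤ W ∧ Grow (entryBound k W) 1 s s' := by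
  have hw' : w ≤ (2 * k + 8) * (2 * k + 2) :=
    hw.elim (fun h => h.trans (Nat.le_mul_of_pos_right _ (by omega))) fun h => h
  have hm := (hb.ask p q r w s W hq hw').trans hW
  refine fun _ => ⟨hm, [_], rfl, le_rfl, ?_⟩
  simp only [List.mem_singleton]
  rintro _ rfl
  have h₁ := hq.size_encode_le
  have h₂ := size_ofNat_le_of_le (p.2.le.trans hb.n)
  have h₃ : ∀ m : Data, m.size ≤ W → (ofList [ofNat p, q.encode, m]).size ≤ entryBound k W := by
    intro m hm
    simp only [ofList_cons, ofList_nil, size_cons, size_nil, entryBound]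
    omega
  exact h₃ _ hm

theorem getClaim_grow (hb : Bounds I k M) (hW : M ≤ W) (s : Log) (p : Fin I.n) {l : ℕ} (r : ℕ)
    (hl : l.size ≤ k) : Triple Set.univ s (I.getClaim p l r) fun o s' =>
      (∀ c, o = some c → c.Small k W) ∧ Grow (entryBound k W) 1 s s' := by
  have h₁ := length_heights_le_size l
  have h₂ := (heightAt_le_log l (l - 1)).trans (log_le_size l)
  refine .bind_univ (ask_grow hb hW s p r (q := .claim) trivial (.inl (by omega)))
    fun m s' ⟨hm, hs'⟩ => .ite (fun hif => ?_) fun _ => ?_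
  · refine Triple.pure ⟨?_, hs'⟩
    rintro c ⟨⟩
    have h₃ : ∀ i, (m.nth i).size ≤ m.size := by
      intro i
      rw [nth]
      rcases lt_or_ge i m.toList.length with h | h
      · rw [List.getD_eq_getElem _ _ h]
        exact size_le_of_mem_toList (List.getElem_mem h)
      · rw [List.getD_eq_default _ _ h]
        exact size_pos m
    exact ⟨hl, hif.2.1.trans_le (h₁.trans hl), by simpa using (h₃ 0).trans hm, (h₃ 1).trans hm⟩
  · exact Triple.pure ⟨by simp, hs'⟩

theorem monologue_grow (hb : Bounds I k M) (hW : M ≤ W) (s : Log) (p : Fin I.n) {l : ℕ}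
    {c : Claim I.n} (hl : l.size ≤ k) (hc : c.Small k W) :
    Triple Set.univ s (I.monologue p l c) fun o s' =>
      (∀ c, o = .nested c → c.Small k W) ∧ Grow (entryBound k W) 2 s s' := by
  have h₁ : min (l - c.size) I.window ≤ k := (min_le_right _ _).trans hb.window
  refine .bind_univ (ask_grow hb hW s p 0 (q := .suffix _ _) ⟨hc.1, h₁⟩ (.inr ?_))
    fun m s' ⟨hm, hs'⟩ => .ite (fun _ => ?_) fun _ => .ite (fun _ => ?_) fun _ => ?_
  · have := hb.f
    have := hb.g
    exact Nat.mul_le_mul (by omega) (by omega)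
  · exact Triple.pure ⟨by simp, hs'.of_le (by omega)⟩
  · exact Triple.pure ⟨by simp, hs'.of_le (by omega)⟩
  · refine .bind_univ (getClaim_grow hb hW s' p 0 hl) fun o s'' ⟨ho, hs''⟩ => ?_
    rcases o with _ | c'
    · exact Triple.pure ⟨by simp, hs'.trans hs''⟩
    · refine .ite (fun _ => ?_) fun _ => ?_
      · refine Triple.pure ⟨?_, hs'.trans hs''⟩
        rintro _ ⟨⟩
        exact ho _ rfl
      · exact Triple.pure ⟨by simp, hs'.trans hs''⟩

/-- A round of the bisection game at height `a`, given the position and the node if the game is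
still going on. -/
def bisectRound (I : Setting) (p : Fin I.n) (c : Claim I.n) (σ : Bool ⊕ ℕ × Data) (a : ℕ) :
    StateM Log (Bool ⊕ ℕ × Data) :=
  match σ with
  | .inl b => return .inl b
  | .inr (j, h) => do
      let m ← I.ask c.prover (.children a j) 0 3
      if m = nil ∨ I.hash (cons m.hd m.tl) ≠ h then
        return .inl false
      else
        let b ← I.ask p (.pick a j m.hd m.tl) 1 3
        if b = nil then
          return .inl true
        else if b.tl = nil then
          return .inr (2 * j, m.hd)
        else
          return .inr (2 * j + 1, m.tl)

/-- The last round of the bisection game. -/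
def bisectEnd (I : Setting) (c : Claim I.n) (σ : Bool ⊕ ℕ × Data) : StateM Log Bool :=
  match σ with
  | .inl b => return b
  | .inr (j, h) => do
      let m ← I.ask c.prover (.leaf j) 0 (4 + Nat.log 2 c.size + I.f + I.g)
      return I.leafOk c j h m

theorem foldlM_bisectRound_inl (p : Fin I.n) (c : Claim I.n) (b : Bool) (l : List ℕ) :
    l.foldlM (I.bisectRound p c) (.inl b) = Pure.pure (.inl b) := by
  induction l with
  | nil => rfl
  | cons a l ih => rw [List.foldlM_cons, bisectRound, LawfulMonad.pure_bind, ih]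

/-- The recursion is turned into a fold over the heights, to which `EffRun.foldlM` applies. Once the
game is decided, the remaining rounds do nothing. -/
theorem bisect_eq (p : Fin I.n) (c : Claim I.n) (a j : ℕ) (h : Data) : I.bisect p c a j h =
    (List.range a).reverse.foldlM (I.bisectRound p c) (.inr (j, h)) >>= I.bisectEnd c := by
  induction a generalizing j h with
  | zero => rfl
  | succ a ih =>
    rw [bisect, List.range_succ, List.reverse_append, List.reverse_singleton, List.singleton_append,
      List.foldlM_cons, bisectRound, bind_assoc, bind_assoc]
    congr 1
    funext m
    split_ifs with h₁
    · rw [LawfulMonad.pure_bind, foldlM_bisectRound_inl, LawfulMonad.pure_bind]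
      rfl
    · rw [bind_assoc]
      congr 1
      funext b
      split_ifs
      · rw [LawfulMonad.pure_bind, foldlM_bisectRound_inl, LawfulMonad.pure_bind]
        rfl
      · rw [LawfulMonad.pure_bind, ih]
      · rw [LawfulMonad.pure_bind, ih]

theorem foldlM_bisectRound_grow (hb : Bounds I k M) (hW : M ≤ W) (p : Fin I.n) (c : Claim I.n)
    {l : List ℕ} (hl : ∀ a ∈ l, a ≤ k) (σ : Bool ⊕ ℕ × Data) (s : Log)
    (hσ : ∀ j h, σ = .inr (j, h) → j.size + l.length ≤ k ∧ h.size ≤ W) :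
    Triple Set.univ s (l.foldlM (I.bisectRound p c) σ) fun σ' s' =>
      (∀ j h, σ' = .inr (j, h) → j.size ≤ k ∧ h.size ≤ W) ∧
        Grow (entryBound k W) (2 * l.length) s s' := by
  induction l generalizing σ s with
  | nil => exact Triple.pure ⟨fun j h he => by simpa using hσ j h he, .refl _ _ _⟩
  | cons a l ih =>
    rw [List.foldlM_cons]
    refine .bind_univ (Q := fun σ' s' => (∀ j h, σ' = .inr (j, h) → j.size + l.length ≤ k ∧ h.size ≤ W) ∧
      Grow (entryBound k W) 2 s s') ?_ fun σ' s' ⟨h₁, h₂⟩ =>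
      (ih (fun a ha => hl a (by simp [ha])) σ' s' h₁).mono fun σ'' s'' ⟨h₃, h₄⟩ =>
        ⟨h₃, (h₂.trans h₄).of_le (by rw [List.length_cons]; omega)⟩
    rcases σ with b | ⟨j, h⟩
    · exact Triple.pure ⟨by simp, .refl _ _ _⟩
    · obtain ⟨hj, hh⟩ := hσ j h rfl
      rw [List.length_cons] at hj
      have ha := hl a (by simp)
      refine .bind_univ (ask_grow hb hW s c.prover 0 (q := .children a j) ⟨ha, by omega⟩
        (.inl (by omega))) fun m s' ⟨hm, hs'⟩ => .ite (fun _ => ?_) fun _ => ?_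
      · exact Triple.pure ⟨by simp, hs'.of_le (by omega)⟩
      have h₁ := (size_hd_le m).trans hm
      have h₂ := (size_tl_le m).trans hm
      refine .bind_univ (ask_grow hb hW s' p 1 (q := .pick a j m.hd m.tl) ⟨ha, by omega, h₁, h₂⟩
        (.inl (by omega))) fun b s'' ⟨_, hs''⟩ => .ite (fun _ => ?_) fun _ => .ite (fun _ => ?_)
          fun _ => ?_
      · exact Triple.pure ⟨by simp, hs'.trans hs''⟩
      · refine Triple.pure ⟨?_, hs'.trans hs''⟩
        rintro _ _ ⟨⟩
        have := size_le_add_one_of_le_two_mul_add_one (show 2 * j ≤ 2 * j + 1 by omega)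
        exact ⟨by omega, h₁⟩
      · refine Triple.pure ⟨?_, hs'.trans hs''⟩
        rintro _ _ ⟨⟩
        have := size_le_add_one_of_le_two_mul_add_one (show 2 * j + 1 ≤ 2 * j + 1 by omega)
        exact ⟨by omega, h₂⟩

theorem bisect_grow (hb : Bounds I k M) (hW : M ≤ W) (s : Log) (p : Fin I.n) {c : Claim I.n}
    (hc : c.size.size ≤ k) {a j : ℕ} {h : Data} (ha : j.size + a ≤ k) (hh : h.size ≤ W) :
    Triple Set.univ s (I.bisect p c a j h) fun _ s' => Grow (entryBound k W) (2 * k + 1) s s' := by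
  rw [bisect_eq]
  refine .bind_univ (foldlM_bisectRound_grow hb hW p c (l := (List.range a).reverse) ?_ _ s ?_)
    fun σ s' ⟨h₁, h₂⟩ => ?_
  · intro b hb
    simp only [List.mem_reverse, List.mem_range] at hb
    omega
  · rintro _ _ ⟨⟩
    simpa using ⟨ha, hh⟩
  rw [List.length_reverse, List.length_range] at h₂
  rcases σ with b | ⟨j', h'⟩
  · exact Triple.pure (h₂.of_le (by omega))
  · have := hb.f
    have := hb.g
    have := log_le_size c.size
    refine .bind_univ (ask_grow hb hW s' c.prover 0 (q := .leaf j') (h₁ _ _ rfl).1 (.inr ?_))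
      fun _ s'' ⟨_, h₃⟩ => Triple.pure ((h₂.trans h₃).of_le (by omega))
    nlinarith

theorem challenge_grow (hb : Bounds I k M) (hW : M ≤ W) (s : Log) (p : Fin I.n) {l : ℕ}
    {c : Claim I.n} (hl : l.size ≤ k) (hc : c.Small k W) :
    Triple Set.univ s (I.challenge p l c) fun o s' =>
      (∀ c, o = .nested c → c.Small k W) ∧ Grow (entryBound k W) (2 * k + 3) s s' := by
  have h₁ := hc.2.1
  refine .bind_univ (ask_grow hb hW s p 1 (q := .move c.size c.peaks) ⟨hc.1, hc.2.2.1⟩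
    (.inl (by omega))) fun m s' ⟨hm, hs'⟩ => .ite (fun _ => ?_) fun _ => .ite (fun _ => ?_)
      fun _ => ?_
  · exact Triple.pure ⟨by simp, hs'.of_le (by omega)⟩
  · exact (monologue_grow hb hW s' p hl hc).mono fun o s'' ⟨h₂, h₃⟩ =>
      ⟨h₂, (hs'.trans h₃).of_le (by omega)⟩
  · rcases hz : ((heights c.size).zip c.peaks)[m.tl.toNat]? with _ | z
    · exact Triple.pure ⟨by simp, hs'.of_le (by omega)⟩
    · obtain ⟨z₁, z₂⟩ := z
      have hmem := List.of_mem_zip (List.mem_of_getElem? hz)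
      refine .bind_univ (bisect_grow hb hW s' p (h := z₂) hc.1
        ((size_peakPos_add_le hmem.1).trans hc.1)
        ((size_le_of_mem_toList (d := ofList c.peaks) (by simpa using hmem.2)).trans hc.2.2.1))
        fun b s'' h₂ => .ite (fun _ => ?_) fun _ => ?_
      · exact Triple.pure ⟨by simp, (hs'.trans h₂).of_le (by omega)⟩
      · exact Triple.pure ⟨by simp, (hs'.trans h₂).of_le (by omega)⟩

/-- A challenge game of an entering prover, given the remaining claims if the step is not yet
complete, and the resulting claims otherwise. -/
def stepRound (I : Setting) (p : Fin I.n) (l : ℕ) (σ : List (Claim I.n) ⊕ List (Claim I.n)) :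
    StateM Log (List (Claim I.n) ⊕ List (Claim I.n)) :=
  match σ with
  | .inl st => return .inl st
  | .inr [] => do return .inl (← I.getClaim p l 1).toList
  | .inr (c :: st) => do
      match ← I.challenge p l c with
      | .challengerLoses => return .inl (c :: st)
      | .responderLoses => return .inr st
      | .nested c' => return .inl (c' :: c :: st)

theorem foldlM_stepRound_inl (p : Fin I.n) (l : ℕ) (st : List (Claim I.n)) (u : List ℕ) :
    u.foldlM (fun σ _ => I.stepRound p l σ) (.inl st) = Pure.pure (.inl st) := by
  induction u with
  | nil => rfl
  | cons a u ih => rw [List.foldlM_cons, stepRound, LawfulMonad.pure_bind, ih]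

/-- Every round either completes the step or removes one claim, and one more round is needed for the
claim on an empty stack. So `st.length + 1` rounds suffice, with `u` serving as the counter. -/
theorem step_eq (p : Fin I.n) (l : ℕ) (st : List (Claim I.n)) {u : List ℕ}
    (hu : u.length = st.length + 1) : I.step p l st = do
      return (← u.foldlM (fun σ _ => I.stepRound p l σ) (.inr st)).elim id id := by
  induction st generalizing u with
  | nil =>
    obtain ⟨a, rfl⟩ := List.length_eq_one_iff.1 hu
    rw [step, List.foldlM_cons, stepRound, bind_assoc, bind_assoc]
    congr 1
    funext o
    cases o <;> rfl
  | cons c st ih =>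
    obtain ⟨a, u, rfl⟩ := List.exists_cons_of_length_eq_add_one hu
    rw [step, List.foldlM_cons, stepRound, bind_assoc, bind_assoc]
    congr 1
    funext o
    rcases o with _ | _ | c'
    · dsimp only
      rw [LawfulMonad.pure_bind, foldlM_stepRound_inl, LawfulMonad.pure_bind]
      rfl
    · dsimp only
      rw [LawfulMonad.pure_bind, ih (by simpa using hu)]
    · dsimp only
      rw [LawfulMonad.pure_bind, foldlM_stepRound_inl, LawfulMonad.pure_bind]
      rfl

theorem foldlM_stepRound_grow (hb : Bounds I k M) (hW : M ≤ W) (p : Fin I.n) {l : ℕ}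
    (hl : l.size ≤ k) (u : List ℕ) (m : ℕ) (σ : List (Claim I.n) ⊕ List (Claim I.n)) (s : Log)
    (hσ : ∀ c ∈ σ.elim id id, c.Small k W) (h₁ : ∀ st, σ = .inl st → st.length ≤ m + 1)
    (h₂ : ∀ st, σ = .inr st → st.length ≤ m) :
    Triple Set.univ s (u.foldlM (fun σ _ => I.stepRound p l σ) σ) fun σ' s' =>
      (∀ c ∈ σ'.elim id id, c.Small k W) ∧ (σ'.elim id id).length ≤ m + 1 ∧
        Grow (entryBound k W) (u.length * (2 * k + 3)) s s' := by
  induction u generalizing σ s with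
  | nil =>
    refine Triple.pure ⟨hσ, ?_, .refl _ _ _⟩
    rcases σ with st | st
    · exact h₁ _ rfl
    · exact (h₂ _ rfl).trans (Nat.le_succ _)
  | cons a u ih =>
    rw [List.foldlM_cons]
    refine .bind_univ (Q := fun σ' s' => ((∀ c ∈ σ'.elim id id, c.Small k W) ∧
      (∀ st, σ' = .inl st → st.length ≤ m + 1) ∧ ∀ st, σ' = .inr st → st.length ≤ m) ∧
      Grow (entryBound k W) (2 * k + 3) s s') ?_ fun σ' s' ⟨⟨h₃, h₄, h₅⟩, h₆⟩ =>
      (ih σ' s' h₃ h₄ h₅).mono fun σ'' s'' ⟨h₇, h₈, h₉⟩ =>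
        ⟨h₇, h₈, (h₆.trans h₉).of_le (by rw [List.length_cons, Nat.add_mul]; omega)⟩
    rcases σ with st | _ | ⟨c, st⟩
    · exact Triple.pure ⟨⟨hσ, h₁, h₂⟩, .refl _ _ _⟩
    · refine .bind_univ (getClaim_grow hb hW s p 1 hl) fun o s' ⟨ho, hs'⟩ =>
        Triple.pure ⟨⟨?_, ?_, by simp⟩, hs'.of_le (by omega)⟩
      · intro c hc
        exact ho c (Option.mem_toList.1 hc)
      · rintro _ ⟨⟩
        cases o <;> simp
    · have hlen := h₂ _ rfl
      rw [List.length_cons] at hlen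
      simp only [Sum.elim_inr, id_eq, List.mem_cons, forall_eq_or_imp] at hσ
      refine .bind_univ (challenge_grow hb hW s p hl hσ.1) fun o s' ⟨ho, hs'⟩ => ?_
      rcases o with _ | _ | c'
      · refine Triple.pure ⟨⟨by simpa using hσ, ?_, by simp⟩, hs'⟩
        rintro _ ⟨⟩
        rw [List.length_cons]
        omega
      · refine Triple.pure ⟨⟨by simpa using hσ.2, by simp, ?_⟩, hs'⟩
        rintro _ ⟨⟩
        omega
      · refine Triple.pure ⟨⟨by simpa using ⟨ho _ rfl, hσ⟩, ?_, by simp⟩, hs'⟩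
        rintro _ ⟨⟩
        simp only [List.length_cons]
        omega

theorem step_grow (hb : Bounds I k M) (hW : M ≤ W) (s : Log) (p : Fin I.n) {l : ℕ}
    (hl : l.size ≤ k) {st : List (Claim I.n)} (hst : ∀ c ∈ st, c.Small k W) :
    Triple Set.univ s (I.step p l st) fun st' s' => (∀ c ∈ st', c.Small k W) ∧
      st'.length ≤ st.length + 1 ∧
        Grow (entryBound k W) ((st.length + 1) * (2 * k + 3)) s s' := by
  rw [step_eq p l st (u := List.range (st.length + 1)) (by simp)]
  refine .bind_univ (foldlM_stepRound_grow hb hW p hl _ st.length _ s hst (by simp) ?_)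
    fun σ s' ⟨h₁, h₂, h₃⟩ => Triple.pure ⟨h₁, h₂, by simpa using h₃⟩
  rintro _ ⟨⟩
  rfl

theorem foldlM_step_grow (hb : Bounds I k M) (hW : M ≤ W) (s : Log) (n : ℕ)
    {xs : List (Fin I.n × ℕ)} (hxs : ∀ x ∈ xs, x.2.size ≤ k) {st : List (Claim I.n)}
    (hst : ∀ c ∈ st, c.Small k W) (hn : st.length + xs.length ≤ n) :
    Triple Set.univ s (xs.foldlM (fun st x => I.step x.1 x.2 st) st) fun st' s' =>
      (∀ c ∈ st', c.Small k W) ∧ st'.length ≤ n ∧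
        Grow (entryBound k W) (xs.length * ((n + 1) * (2 * k + 3))) s s' := by
  induction xs generalizing s st with
  | nil => exact Triple.pure ⟨hst, by simpa using hn, .refl _ _ _⟩
  | cons x xs ih =>
    rw [List.foldlM_cons]
    rw [List.length_cons] at hn
    refine .bind_univ (step_grow hb hW s x.1 (hxs x (by simp)) hst) fun st' s' ⟨h₁, h₂, h₃⟩ =>
      (ih s' (fun y hy => hxs y (by simp [hy])) h₁ (by omega)).mono fun st'' s'' ⟨h₄, h₅, h₆⟩ =>
        ⟨h₄, h₅, (h₃.trans h₆).of_le ?_⟩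
    have : (st.length + 1) * (2 * k + 3) ≤ (n + 1) * (2 * k + 3) := by gcongr; omega
    rw [List.length_cons, Nat.add_mul xs.length]
    omega

end Setting


/-! ### Uniform message bounds and efficiency of the bisection game. -/

namespace Bounded

variable {Γ : Type} {e : Γ → Data}

theorem nat {m : Γ → ℕ} (h : Eff e fun y => unary (m y)) : Bounded e m :=
  h.bound.of_le fun y => by rw [size_unary]; omega

theorem comp_nat {M : ℕ → ℕ} (hM : Bounded unary M) {k : Γ → ℕ} (hk : Bounded e k) :
    Bounded e fun y => M (k y) := by
  obtain ⟨b, hb⟩ := hM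
  refine ((((const 2).mul hk).add (const 1)).eval b).of_le fun y => ?_
  simpa using hb (k y)

end Bounded

namespace Feasible

variable {X : Type} {I : X → Setting} {e₀ : X → Data} (h : Feasible I e₀)

include h

theorem size_ledger_le : ∃ B, Bounded e₀ B ∧ ∀ x p L, (I x).ledger p = some L →
    (ofList L).size ≤ B x := by
  refine ⟨_, h.ledger.bound, fun x p L hL => ?_⟩
  have h₁ : ofOption (((I x).ledger p).map ofList) ∈
      (ofList (List.ofFn fun i => ofOption (((I x).ledger i).map ofList))).toList := by
    rw [toList_ofList, List.mem_ofFn]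
    exact ⟨p, rfl⟩
  refine le_trans ?_ (size_le_of_mem_toList h₁)
  rw [hL]
  simp [ofOption]
  omega

/-- The bound `M k` does not involve the size `W` of adversarial data quoted in a query. Otherwise
the length of one message could feed into that of the next and compound. It is avoidable because
honest answers to `move` and `pick` are an index and a bit, and adversarial messages are cut to
their allotted words. -/
theorem exists_bounds : ∃ (K : X → ℕ) (M : ℕ → ℕ), Bounded e₀ K ∧ Bounded unary M ∧
    ∀ x k, K x ≤ k → (I x).Bounds k (M k) := by
  obtain ⟨BL, ⟨bL, hbL⟩, hL⟩ := h.size_ledger_le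
  obtain ⟨BH, ⟨bH, hbH⟩, hH⟩ := h.hash_size
  obtain ⟨BA, ⟨bA, hbA⟩, hA⟩ := h.adv_size
  let e : X × List Data × ℕ × ℕ → Data := fun z =>
    cons (e₀ z.1) (cons (ofList z.2.1) (cons (ofNat z.2.2.1) (unary z.2.2.2)))
  have hx : Eff e fun z => e₀ z.1 := Eff.self.hd
  have heL : Eff e fun z => ofList z.2.1 := Eff.self.tl.hd
  have hi : Eff e fun z => ofNat z.2.2.1 := Eff.self.tl.tl.hd
  have hm : Eff e fun z => unary z.2.2.2 := Eff.self.tl.tl.tl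
  obtain ⟨b₁, hb₁⟩ := (eff_honest_size (I := I) (x := fun z => z.1) heL).bound
  obtain ⟨b₂, hb₂⟩ := (h.eff_honest_claim hx heL).bound
  obtain ⟨b₃, hb₃⟩ := (h.eff_honest_suffix hx heL hi hm).bound
  obtain ⟨b₄, hb₄⟩ := (h.eff_honest_leaf hx heL hi).bound
  -- A bound for the size of `e (x, L, i, m)`: a number with `k` binary digits takes at most `4 * k
  -- + 1` nodes, and a unary number up to `k` at most `2 * k + 1`.
  let N : ℕ → ℕ := fun k => k + bL.eval k + 6 * k + 10
  let M : ℕ → ℕ := fun k => b₁.eval (N k) + b₂.eval (N k) + b₃.eval (N k) + b₄.eval (N k) +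
    2 * bH.eval k + (4 * k + 10) + (2 * k + 8) * (2 * k + 2) * bA.eval k
  have hk : Bounded unary fun k => k := .nat .self
  have hN : Bounded unary N := ((hk.add (hk.eval bL)).add ((Bounded.const 6).mul hk)).add (.const 10)
  refine ⟨fun x => (e₀ x).size + (I x).window + (I x).f + (I x).g + (I x).n, M,
    (((Eff.self.bound.add (.nat h.window)).add (.nat h.f)).add (.nat h.g)).add (.nat h.n), ?_, ?_⟩
  · exact ((((((hN.eval b₁).add (hN.eval b₂)).add (hN.eval b₃)).add (hN.eval b₄)).add
      ((Bounded.const 2).mul (hk.eval bH))).add (((Bounded.const 4).mul hk).add (.const 10))).add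
      (((((Bounded.const 2).mul hk).add (.const 8)).mul (((Bounded.const 2).mul hk).add
        (.const 2))).mul (hk.eval bA))
  · intro x k hxk
    dsimp only at hxk
    refine ⟨by omega, by omega, by omega, by omega, fun p q r w s W hq hw => ?_⟩
    have hek : (e₀ x).size ≤ k := by omega
    show (match (I x).ledger p with
      | some L => (I x).honest L q
      | none => (I x).adv w (ofList s.transcript) (ofList [ofNat p, q.encode])).size ≤ M k
    have hh : ∀ d, ((I x).hash d).size ≤ bH.eval k := fun d =>
      (hH x d).trans ((hbH x).trans (eval_nat_mono bH hek))
    have hn : ∀ D a j, (node (I x).hash D a j).size ≤ bH.eval k := fun D a j => by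
      cases a <;> exact hh _
    rcases hp : (I x).ledger p with _ | L <;> dsimp only
    · have h₁ := hA x w (ofList s.transcript) (ofList [ofNat p, q.encode])
      have h₂ := (hbA x).trans (eval_nat_mono bA hek)
      have h₃ := Nat.mul_le_mul hw h₂
      dsimp only at h₃
      dsimp only [M]
      omega
    · have he : ∀ i m, (ofNat i).size ≤ 4 * k + 1 → m ≤ k → (e (x, L, i, m)).size ≤ N k := by
        intro i m h₁ h₂
        have h₃ := (hL x p L hp).trans ((hbL x).trans (eval_nat_mono bL hek))
        dsimp only at h₃
        simp only [e, N, size_cons, size_unary]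
        omega
      have hk' : ∀ {m : ℕ}, m.size ≤ k → (ofNat m).size ≤ 4 * k + 1 := fun {m} hm =>
        (size_ofNat_le m).trans (by omega)
      have h0 : (ofNat 0).size ≤ 4 * k + 1 := by simp
      cases q with
      | size =>
        have := (hb₁ (x, L, 0, 0)).trans (eval_nat_mono b₁ (he 0 0 h0 (Nat.zero_le _)))
        dsimp only [M] at this ⊢
        omega
      | claim =>
        have := (hb₂ (x, L, 0, 0)).trans (eval_nat_mono b₂ (he 0 0 h0 (Nat.zero_le _)))
        dsimp only [M] at this ⊢
        omega
      | move l pk =>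
        rw [Setting.honest]
        set o := ((heights l).zip pk).findIdx? fun z =>
          decide (node (I x).hash ((I x).entry L) z.1 (peakPos l z.1) ≠ z.2) with ho
        rcases ho' : o with _ | i
        · dsimp [M]
          omega
        · have hi : i < ((heights l).zip pk).length := by
            rw [ho', eq_comm, List.findIdx?_eq_some_iff_getElem] at ho
            exact ho.1
          rw [List.length_zip] at hi
          have h₁ := length_heights_le_size l
          have h₂ := size_ofNat_le_of_le (show i ≤ k by have := hq.1; omega)
          simp only [size_cons, size_nil, M]
          omega
      | suffix i m =>
        have := (hb₃ (x, L, i, m)).trans (eval_nat_mono b₃ (he i m (hk' hq.1) hq.2))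
        dsimp only [M] at this ⊢
        omega
      | children a j =>
        have h₁ := hn ((I x).entry L) a (2 * j)
        have h₂ := hn ((I x).entry L) a (2 * j + 1)
        simp only [Setting.honest, size_cons, M]
        omega
      | pick a j hl hr =>
        have h₁ : ∀ b, (ofBool b).size ≤ 3 := by decide
        have := h₁ (decide (node (I x).hash ((I x).entry L) a (2 * j) = hl))
        simp only [Setting.honest, size_cons, size_nil, M]
        omega
      | leaf j =>
        have := (hb₄ (x, L, j, 0)).trans (eval_nat_mono b₄ (he j 0 (hk' hq) (Nat.zero_le _)))
        dsimp only [M] at this ⊢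
        omega

variable {Γ : Type} {e : Γ → Data} {x : Γ → X} (hx : Eff e fun y => e₀ (x y))
  {a j l m : Γ → ℕ} {v : Γ → Data} {s : Γ → Log}
  {p : ∀ y, Fin (I (x y)).n} {c : ∀ y, Claim (I (x y)).n} {st : ∀ y, List (Claim (I (x y)).n)}

include hx

omit h hx in
theorem _root_.LightClient.Eff.getElem? {β : Γ → Type} {enc : ∀ y, β y → Data} {l : ∀ y, List (β y)}
    (hm : Eff e fun y => ofNat (m y)) (hl : Eff e fun y => ofList ((l y).map (enc y))) :
    Eff e fun y => ofOption ((l y)[m y]?.map (enc y)) := by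
  have hd := Eff.drop (Eff.min_unary hm hl.length) hl
  refine (Eff.ite (hd.eq (.const nil)) (.const nil) ((Eff.const nil).cons hd.hd)).congr fun y => ?_
  rcases lt_or_ge (m y) (l y).length with h | h
  · rw [min_eq_left h.le, List.getElem?_eq_getElem h,
      List.drop_eq_getElem_cons (by simpa using h)]
    simp [ofOption]
  · rw [min_eq_right h, List.getElem?_eq_none h, List.drop_eq_nil_of_le (by simp)]
    rfl

omit h hx in
/-- Case distinction on a sum. -/
theorem _root_.LightClient.EffRun.sum {α β γ : Γ → Type} {enc : ∀ y, γ y → Data}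
    {encα : ∀ y, α y → Data} {encβ : ∀ y, β y → Data} {σ : ∀ y, α y ⊕ β y}
    {prog : ∀ y, StateM Log (γ y)}
    (hσ : Eff e fun y => (σ y).elim (fun a => cons nil (encα y a))
      fun b => cons (cons nil nil) (encβ y b))
    (h₁ : ∀ (Δ : Type) (d : Δ → Data) (g : Δ → Γ) (a : ∀ z, α (g z)), (∀ z, σ (g z) = .inl (a z)) →
      (∀ {w : Γ → Data}, Eff e w → Eff d fun z => w (g z)) → (Eff d fun z => encα (g z) (a z)) →
      EffRun d (fun z => enc (g z)) (fun z => prog (g z)) fun z => s (g z))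
    (h₂ : ∀ (Δ : Type) (d : Δ → Data) (g : Δ → Γ) (b : ∀ z, β (g z)), (∀ z, σ (g z) = .inr (b z)) →
      (∀ {w : Γ → Data}, Eff e w → Eff d fun z => w (g z)) → (Eff d fun z => encβ (g z) (b z)) →
      EffRun d (fun z => enc (g z)) (fun z => prog (g z)) fun z => s (g z)) :
    EffRun e enc prog s := by
  have hp : Eff e fun y => ofProp ((σ y).isLeft = true) := (hσ.hd.eq (.const nil)).congr fun y => by
    cases σ y <;> simp [ofProp]
  refine .cases hp (h₁ _ _ (fun z : {y // (σ y).isLeft = true} => z.1)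
    (fun z => (σ z.1).getLeft z.2) (fun z => by simp) (fun h => h.sub _) ?_)
    (h₂ _ _ (fun z : {y // ¬ (σ y).isLeft = true} => z.1)
    (fun z => (σ z.1).getRight (by simpa using z.2)) (fun z => by simp) (fun h => h.sub _) ?_)
  · refine (hσ.tl.sub _).congr fun z => ?_
    obtain ⟨a, ha⟩ := Sum.isLeft_iff.1 z.2
    simp [ha]
  · refine (hσ.tl.sub _).congr fun z => ?_
    obtain ⟨b, hb⟩ := Sum.isRight_iff.1 (show (σ z.1).isRight = true by simpa using z.2)
    simp [hb]

omit h hx in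
/-- Case distinction on a list. -/
theorem _root_.LightClient.EffRun.list {β γ : Γ → Type} {enc : ∀ y, γ y → Data}
    {enc' : ∀ y, β y → Data} {l : ∀ y, List (β y)} {prog : ∀ y, StateM Log (γ y)}
    (hl : Eff e fun y => ofList ((l y).map (enc' y)))
    (h₁ : ∀ (Δ : Type) (d : Δ → Data) (g : Δ → Γ), (∀ z, l (g z) = []) →
      (∀ {w : Γ → Data}, Eff e w → Eff d fun z => w (g z)) →
      EffRun d (fun z => enc (g z)) (fun z => prog (g z)) fun z => s (g z))
    (h₂ : ∀ (Δ : Type) (d : Δ → Data) (g : Δ → Γ) (b : ∀ z, β (g z)) (t : ∀ z, List (β (g z))),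
      (∀ z, l (g z) = b z :: t z) → (∀ {w : Γ → Data}, Eff e w → Eff d fun z => w (g z)) →
      (Eff d fun z => enc' (g z) (b z)) → (Eff d fun z => ofList ((t z).map (enc' (g z)))) →
      EffRun d (fun z => enc (g z)) (fun z => prog (g z)) fun z => s (g z)) :
    EffRun e enc prog s := by
  have hp : Eff e fun y => ofProp ((l y).isEmpty = true) := (hl.eq (.const nil)).congr fun y => by
    cases l y <;> simp [ofProp]
  have hne : ∀ z : {y // ¬ (l y).isEmpty = true}, l z.1 ≠ [] := fun z => by simpa using z.2
  refine .cases hp (h₁ _ _ (fun z : {y // (l y).isEmpty = true} => z.1)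
    (fun z => List.isEmpty_iff.1 z.2) (fun h => h.sub _))
    (h₂ _ _ (fun z : {y // ¬ (l y).isEmpty = true} => z.1)
    (fun z => (l z.1).head (hne z)) (fun z => (l z.1).tail) (fun z => by simp)
    (fun h => h.sub _) ?_ ?_)
  · refine (hl.hd.sub _).congr fun z => ?_
    obtain ⟨b, t, hb⟩ := List.exists_cons_of_ne_nil (hne z)
    simp [hb]
  · refine (hl.tl.sub _).congr fun z => ?_
    obtain ⟨b, t, hb⟩ := List.exists_cons_of_ne_nil (hne z)
    simp [hb]

omit h hx in
theorem size_encode_le {n k W : ℕ} {c : Claim n} (hn : n ≤ k) (hc : c.Small k W) :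
    c.encode.size ≤ 8 * k + 2 * W + 5 := by
  have h₁ := size_ofNat_le_of_le (c.prover.2.le.trans hn)
  have h₂ := size_ofNat_le c.size
  have h₃ := hc.1
  have h₄ := hc.2.2
  simp only [Claim.encode, size_cons]
  omega

omit h hx in
theorem small_encode {n : ℕ} (c : Claim n) : c.Small c.encode.size c.encode.size := by
  have h₁ := size_le_size_ofNat c.size
  have h₂ := length_toList_lt (ofList c.peaks)
  rw [toList_ofList] at h₂
  simp only [Claim.encode, size_cons]
  exact ⟨by omega, by omega, by omega, by omega⟩

omit h hx in
theorem small_mono {n k k' W W' : ℕ} {c : Claim n} (hc : c.Small k W) (hk : k ≤ k') (hW : W ≤ W') :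
    c.Small k' W' :=
  ⟨hc.1.trans hk, hc.2.1.trans hk, hc.2.2.1.trans hW, hc.2.2.2.trans hW⟩

omit h hx in
theorem bounded_entryBound {k W : Γ → ℕ} (hk : Bounded e k) (hW : Bounded e W) :
    Bounded e fun y => Setting.entryBound (k y) (W y) :=
  (((Bounded.const 12).mul hk).add ((Bounded.const 3).mul hW)).add (.const 30)

/-- The encoding of the state of the bisection game. -/
def encodeRound (σ : Bool ⊕ ℕ × Data) : Data :=
  σ.elim (fun b => cons nil (ofBool b)) fun z => cons (cons nil nil) (cons (ofNat z.1) z.2)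

theorem effRun_bisectRound {σ : Γ → Bool ⊕ ℕ × Data}
    (hs : Eff e fun y => ofList (s y).transcript) (hp : Eff e fun y => ofNat (p y))
    (hc : Eff e fun y => (c y).encode) (hσ : Eff e fun y => encodeRound (σ y))
    (ha : Eff e fun y => unary (a y)) : EffRun e (fun _ => encodeRound)
      (fun y => (I (x y)).bisectRound (p y) (c y) (σ y) (a y)) s := by
  refine .sum (α := fun _ => Bool) (β := fun _ => ℕ × Data) (σ := σ) (encα := fun _ => ofBool)
    (encβ := fun _ z => cons (ofNat z.1) z.2) hσ ?_ ?_
  · intro Δ d g b hb lift hb'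
    exact (EffRun.pure (α := fun _ => Bool ⊕ ℕ × Data) (enc := fun _ => encodeRound)
      (a := fun z => .inl (b z)) ((Eff.const nil).cons hb') (lift hs)).congr fun z => by
        rw [hb z]; rfl
  · intro Δ d g z hz lift hz'
    have hret : ∀ {Δ : Type} {d : Δ → Data} {s : Δ → Log} (b : Bool),
        (Eff d fun z => ofList (s z).transcript) → EffRun d (fun _ => encodeRound)
          (fun _ => (return .inl b : StateM Log (Bool ⊕ ℕ × Data))) s :=
      fun b hs => .pure (.const _) hs
    refine EffRun.congr (prog := fun y => do
      let m ← (I (x (g y))).ask (c (g y)).prover (.children (a (g y)) (z y).1) 0 3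
      if m = nil ∨ (I (x (g y))).hash (cons m.hd m.tl) ≠ (z y).2 then
        return .inl false
      else
        let b ← (I (x (g y))).ask (p (g y)) (.pick (a (g y)) (z y).1 m.hd m.tl) 1 3
        if b = nil then
          return .inl true
        else if b.tl = nil then
          return .inr (2 * (z y).1, m.hd)
        else
          return .inr (2 * (z y).1 + 1, m.tl)) ?_ fun y => by rw [hz y]; rfl
    refine .bind (h.effRun_ask (lift hx) (lift hs) (lift hc).hd
      ((eff_tag 4).ofList_three (lift ha).bin hz'.hd) (.const (unary 3)) fun Δ d g L lift' hL =>
      h.eff_honest_children (lift' (lift hx)) hL (lift' (lift ha)) (lift' hz'.hd)) fun m s' hm hs' => ?_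
    refine .ite (.or (hm.eq (.const nil)) ((h.eff_hash (lift hx) (hm.hd.cons hm.tl)).eq hz'.tl).not)
      (hret false hs') ?_
    refine .bind (h.effRun_ask (lift hx) hs' (lift hp)
      (q := fun y => .pick (a (g y)) (z y).1 (m y).hd (m y).tl)
      ((eff_tag 5).ofList_cons ((lift ha).bin.ofList_cons (hz'.hd.ofList_three hm.hd hm.tl)))
      (.const (unary 3)) fun Δ d g L lift' hL =>
      h.eff_honest_pick (lift' (lift hx)) hL (lift' (lift ha)) (lift' hz'.hd) (lift' hm.hd))
      fun b s'' hb hs'' => ?_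
    refine .ite (hb.eq (.const nil)) (hret true hs'') (.ite (hb.tl.eq (.const nil)) ?_ ?_)
    · exact .pure (α := fun _ => Bool ⊕ ℕ × Data) (enc := fun _ => encodeRound)
        (a := fun y => .inr (2 * (z y).1, (m y).hd))
        ((Eff.const _).cons ((Eff.double (m := fun y => (z y).1) hz'.hd).cons hm.hd)) hs''
    · exact .pure (α := fun _ => Bool ⊕ ℕ × Data) (enc := fun _ => encodeRound)
        (a := fun y => .inr (2 * (z y).1 + 1, (m y).tl))
        ((Eff.const _).cons ((Eff.double (m := fun y => (z y).1) hz'.hd).succ.cons hm.tl)) hs''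

theorem effRun_bisect (hs : Eff e fun y => ofList (s y).transcript)
    (hp : Eff e fun y => ofNat (p y)) (hc : Eff e fun y => (c y).encode)
    (ha : Eff e fun y => unary (a y)) (hj : Eff e fun y => ofNat (j y)) (hv : Eff e v) :
    EffRun e (fun _ => ofBool) (fun y => (I (x y)).bisect (p y) (c y) (a y) (j y) (v y)) s := by
  obtain ⟨K, M, hK, hM, hb⟩ := h.exists_bounds
  -- This leaves room for the digits of `j` and for the at most `a` further digits that the position
  -- acquires on the way down.
  let k : Γ → ℕ := fun y => K (x y) + a y + (ofNat (j y)).size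
  let W : Γ → ℕ := fun y => M (k y) + (v y).size
  have hk : Bounded e k := ((hK.comp hx).add (.nat ha)).add hj.bound
  have hW : Bounded e W := (hM.comp_nat hk).add hv.bound
  refine EffRun.congr (prog := fun y => (List.range (a y)).reverse.foldlM
    ((I (x y)).bisectRound (p y) (c y)) (.inr (j y, v y)) >>= (I (x y)).bisectEnd (c y)) ?_
    fun y => (Setting.bisect_eq _ _ _ _ _).symm
  refine .bind (enc := fun _ => encodeRound) (.foldlM (τ := fun _ => Bool ⊕ ℕ × Data)
    (encτ := fun _ => encodeRound) (β := fun _ => ℕ) (enc' := fun _ => unary)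
    (l := fun y => (List.range (a y)).reverse) (z := fun y => .inr (j y, v y))
    (f := fun y => (I (x y)).bisectRound (p y) (c y)) (B := fun y => (4 * k y + W y + 10) +
      ((ofList (s y).transcript).size + 2 * a y * (Setting.entryBound (k y) (W y) + 1)))
    ((Eff.reverse ha.range).congr fun y => by simp) ((Eff.const _).cons (hj.cons hv)) hs
    (fun Δ d g σ s' b lift hσ hs' hb => h.effRun_bisectRound (lift hx) hs' (lift hp) (lift hc) hσ hb)
    ((((((Bounded.const 4).mul hk).add hW).add (.const 10)).add (hs.bound.add
      (((Bounded.const 2).mul (.nat ha)).mul ((bounded_entryBound hk hW).add (.const 1))))))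
    fun y l' hl' => ?_) fun σ s' hσ hs' => ?_
  · have hlen := hl'.length_le
    rw [List.length_reverse, List.length_range] at hlen
    have hsize := size_le_size_ofNat (j y)
    have hle : ∀ b ∈ l', b ≤ k y := fun b hb => by
      have := hl'.subset hb
      simp only [List.mem_reverse, List.mem_range] at this
      simp only [k]
      omega
    obtain ⟨h₁, h₂⟩ := Setting.foldlM_bisectRound_grow (k := k y) (W := W y) (hb (x y) (k y) (by simp only [k]; omega))
      (Nat.le_add_right _ _) (p y) (c y) (l := l') hle (.inr (j y, v y)) (s y) (by
        rintro _ _ ⟨⟩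
        exact ⟨by simp only [k]; omega, Nat.le_add_left _ _⟩) fun _ _ => trivial
    have h₃ := h₂.size_le
    have h₄ : 2 * l'.length * (Setting.entryBound (k y) (W y) + 1) ≤
      2 * a y * (Setting.entryBound (k y) (W y) + 1) := by gcongr
    refine add_le_add ?_ (h₃.trans (by omega))
    · rcases hσ : ((l'.foldlM ((I (x y)).bisectRound (p y) (c y)) (.inr (j y, v y))).run (s y)).1
        with b | ⟨j', v'⟩
      · have : ∀ b, (ofBool b).size ≤ 3 := by decide
        have := this b
        simp only [encodeRound, Sum.elim_inl, size_cons, size_nil]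
        omega
      · have h₅ := h₁ j' v' hσ
        have h₆ := size_ofNat_le j'
        simp only [encodeRound, Sum.elim_inr, size_cons, size_nil]
        omega
  · refine .sum (α := fun _ => Bool) (β := fun _ => ℕ × Data) (σ := σ) (encα := fun _ => ofBool)
      (encβ := fun _ z => cons (ofNat z.1) z.2) hσ ?_ ?_
    · intro Δ d g b hb lift hb'
      exact (EffRun.pure (α := fun _ => Bool) (enc := fun _ => ofBool) (a := b) hb'
        (lift hs')).congr fun z => by rw [hb z]; rfl
    · intro Δ d g z hz lift hz'
      refine EffRun.congr (prog := fun y => do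
        let m ← (I (x (g y))).ask (c (g y)).prover (.leaf (z y).1) 0
          (4 + Nat.log 2 (c (g y)).size + (I (x (g y))).f + (I (x (g y))).g)
        return (I (x (g y))).leafOk (c (g y)) (z y).1 (z y).2 m) ?_ fun y => by rw [hz y]; rfl
      refine .bind (h.effRun_ask (lift hx) (lift hs') (lift hc).hd
        ((eff_tag 6).ofList_two hz'.hd) ((((Eff.const (unary 4)).unary_add
        (Eff.log (m := fun y => (c (g y)).size) (lift hc).tl.hd)).unary_add (h.f.comp _ (lift hx))).unary_add (h.g.comp _ (lift hx)))
        fun Δ d g L lift' hL => h.eff_honest_leaf (lift' (lift hx)) hL (lift' hz'.hd))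
        fun m s'' hm hs'' => ?_
      exact .pure (h.eff_leafOk (lift hx) (lift hc) hz'.hd hz'.tl hm) hs''

end Feasible


/-! ### Efficiency of sorting, challenge games, steps and the whole tournament. -/

theorem Eff.insertionSort {Γ : Type} {e : Γ → Data} {n : Γ → ℕ} {l : ∀ y, List (Fin (n y) × ℕ)}
    (hl : Eff e fun y => ofList ((l y).map fun z => .cons (ofNat z.1) (ofNat z.2))) :
    Eff e fun y => ofList (((l y).insertionSort fun a b => a.2 ≤ b.2).map
      fun z => .cons (ofNat z.1) (ofNat z.2)) := by
  let enc : ∀ y, Fin (n y) × ℕ → Data := fun y z => .cons (ofNat z.1) (ofNat z.2)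
  let v : Γ → ℕ → Data := fun y i => ofList (((((l y).reverse.take i).reverse).insertionSort
    fun a b => a.2 ≤ b.2).map (enc y))
  have hlr : Eff e fun y => ofList ((l y).reverse.map (enc y)) :=
    (Eff.reverse hl).congr fun y => by rw [List.map_reverse]
  -- Inserting into a sorted list means splitting it at a threshold. Both parts are written as a
  -- `flatMap`, so that no second recursion is needed for an insertion.
  have hinsert : ∀ {y} (a : Fin (n y) × ℕ) (t : List (Fin (n y) × ℕ)),
      t.Pairwise (fun a b => a.2 ≤ b.2) → t.orderedInsert (fun a b => a.2 ≤ b.2) a =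
        (t.flatMap fun b => if a.2 ≤ b.2 then [] else [b]) ++
          a :: t.flatMap fun b => if a.2 ≤ b.2 then [b] else [] := by
    intro y a t ht
    induction t with
    | nil => rfl
    | cons b t ih =>
      rw [List.pairwise_cons] at ht
      rw [List.orderedInsert, List.flatMap_cons, List.flatMap_cons]
      split_ifs with h
      · have h₁ : (t.flatMap fun b => if a.2 ≤ b.2 then [] else [b]) = [] := by
          rw [List.flatMap_eq_nil_iff]
          intro c hc
          rw [if_pos (h.trans (ht.1 c hc))]
        have h₂ : ∀ t : List (Fin (n y) × ℕ), (∀ c ∈ t, a.2 ≤ c.2) →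
            (t.flatMap fun b => if a.2 ≤ b.2 then [b] else []) = t := by
          intro t ht
          induction t with
          | nil => rfl
          | cons c t ih => rw [List.flatMap_cons, if_pos (ht c (by simp)), ih fun d hd => ht d (by simp [hd])]; rfl
        rw [h₁, h₂ t fun c hc => h.trans (ht.1 c hc)]
        rfl
      · rw [ih ht.2]
        rfl
  refine (natRec (v := v) hlr.length ((const .nil).congr fun y => by simp [v]) ?_
    (B := fun y => (ofList ((l y).reverse.map (enc y))).size *
      ((ofList ((l y).reverse.map (enc y))).size + 1) + 1)
    ((hlr.bound.mul (hlr.bound.add (.const 1))).add (.const 1)) ?_).congr fun y => ?_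
  · intro Δ d g i hi lift hi' hv
    have hb : Eff d fun z => enc (g z) ((l (g z)).reverse[i z]'(hi z)) :=
      (getD hi' (lift hlr) (const .nil)).congr fun y => by
        rw [List.getD_eq_getElem _ _ (by simpa using hi y), List.getElem_map]
    have hfl : ∀ {p : ∀ z, Fin (n (g z)) × ℕ → List (Fin (n (g z)) × ℕ)},
        (∀ (Δ' : Type) (d' : Δ' → Data) (g' : Δ' → Δ) (b : ∀ z, Fin (n (g (g' z))) × ℕ),
          (∀ {w : Δ → Data}, Eff d w → Eff d' fun z => w (g' z)) →
          (Eff d' fun z => enc (g (g' z)) (b z)) →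
          Eff d' fun z => ofList ((p (g' z) (b z)).map (enc (g (g' z))))) →
        Eff d fun z => ofList (((((l (g z)).reverse.take (i z)).reverse.insertionSort
          fun a b => a.2 ≤ b.2).flatMap (p z)).map (enc (g z))) := by
      intro p hp
      refine (flatMap (enc := fun z => enc (g z)) hv (f := fun z b => (p z b).map (enc (g z)))
        fun Δ' d' g' b _ lift' hb' => hp Δ' d' g' b lift' hb').congr fun z => ?_
      rw [List.map_flatMap]
    refine (append (hfl (p := fun z b => if ((l (g z)).reverse[i z]'(hi z)).2 ≤ b.2 then [] else [b])
        fun Δ' d' g' b lift' hb' => ?_) (ofList_cons hb (hfl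
          (p := fun z b => if ((l (g z)).reverse[i z]'(hi z)).2 ≤ b.2 then [b] else [])
          fun Δ' d' g' b lift' hb' => ?_))).congr fun z => ?_
    · refine (ite (p := fun z => ((l (g (g' z))).reverse[i (g' z)]'(hi (g' z))).2 ≤ (b z).2)
        (le (lift' hb).tl hb'.tl) (const .nil) hb'.ofList_one).congr fun z => ?_
      split_ifs <;> simp
    · refine (ite (p := fun z => ((l (g (g' z))).reverse[i (g' z)]'(hi (g' z))).2 ≤ (b z).2)
        (le (lift' hb).tl hb'.tl) hb'.ofList_one (const .nil)).congr fun z => ?_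
      split_ifs <;> simp
    · simp only [v]
      rw [List.take_add_one, List.getElem?_eq_getElem (hi z), Option.toList_some, List.reverse_append,
        List.reverse_singleton, List.singleton_append, List.insertionSort_cons, hinsert]
      · rw [List.map_append, List.map_cons]
      · have : Std.Total fun x y : Fin (n (g z)) × ℕ => x.2 ≤ y.2 := ⟨fun x y => le_total x.2 y.2⟩
        have : IsTrans (Fin (n (g z)) × ℕ) fun x y => x.2 ≤ y.2 := ⟨fun x y z => le_trans⟩
        exact List.pairwise_insertionSort _ _
  · intro y i hi
    have hperm := List.perm_insertionSort (fun a b : Fin (n y) × ℕ => a.2 ≤ b.2)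
      ((l y).reverse.take i).reverse
    refine (size_ofList_le (m := (ofList ((l y).reverse.map (enc y))).size) fun d hd => ?_).trans ?_
    · obtain ⟨b, hb, rfl⟩ := List.mem_map.1 hd
      rw [hperm.mem_iff, List.mem_reverse] at hb
      exact size_le_of_mem_toList (by
        rw [toList_ofList]
        exact List.mem_map_of_mem (List.take_subset _ _ hb))
    · rw [List.length_map, hperm.length_eq]
      have h₁ := length_toList_lt (ofList ((l y).reverse.map (enc y)))
      rw [toList_ofList, List.length_map] at h₁
      gcongr
      simp only [List.length_reverse, List.length_take] at h₁ ⊢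
      omega
  · simp only [v]
    rw [List.take_length, List.reverse_reverse]

namespace Feasible

variable {X : Type} {I : X → Setting} {e₀ : X → Data} (h : Feasible I e₀)
  {Γ : Type} {e : Γ → Data} {x : Γ → X} (hx : Eff e fun y => e₀ (x y))
  {l : Γ → ℕ} {s : Γ → Log}
  {p : ∀ y, Fin (I (x y)).n} {c : ∀ y, Claim (I (x y)).n} {st : ∀ y, List (Claim (I (x y)).n)}

include h hx

theorem effRun_challenge (hs : Eff e fun y => ofList (s y).transcript)
    (hp : Eff e fun y => ofNat (p y)) (hl : Eff e fun y => ofNat (l y))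
    (hc : Eff e fun y => (c y).encode) :
    EffRun e (fun _ => Outcome.encode) (fun y => (I (x y)).challenge (p y) (l y) (c y)) s := by
  have hcs : Eff e fun y => ofNat (c y).size := hc.tl.hd
  have hcp : Eff e fun y => ofList (c y).peaks := hc.tl.tl.hd
  refine .bind (h.effRun_ask hx hs hp (q := fun y => .move (c y).size (c y).peaks)
    ((eff_tag 2).ofList_three hcs hcp) (hcp.length_list.unary_add (.const (unary 3)))
    fun Δ d g L lift hL => h.eff_honest_move (lift hx) hL (lift hcs) (lift hcp))
    fun m s' hm hs' => ?_
  refine .ite (hm.eq (.const nil)) (.pure (.const _) hs') (.ite (hm.hd.eq (.const nil))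
    (h.effRun_monologue hx hs' hp hl hc) ?_)
  refine .option (β := fun _ => ℕ × Data) (enc' := fun _ z => cons (unary z.1) z.2)
    (Eff.getElem? hm.tl.toNat (eff_zip_heights hcs hcp)) ?_ ?_
  · intro Δ d g hg lift
    exact (EffRun.pure (α := fun z => Outcome (I (x (g z))).n) (enc := fun _ => Outcome.encode)
      (a := fun _ => .challengerLoses) (.const _) (lift hs')).congr fun z => by rw [hg z]
  · intro Δ d g z hz lift hz'
    refine EffRun.congr (prog := fun y => do
      if ← (I (x (g y))).bisect (p (g y)) (c (g y)) (z y).1 (peakPos (c (g y)).size (z y).1) (z y).2 then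
        return .challengerLoses
      else
        return .responderLoses) ?_ fun y => by rw [hz y]
    refine .bind (h.effRun_bisect (lift hx) (lift hs') (lift hp) (lift hc) hz'.hd
      ((lift hcs).peakPos hz'.hd) hz'.tl) fun b s'' hb hs'' => ?_
    refine .ite ((hb.eq (.const nil)).not.congr fun y => ?_) (.pure (.const _) hs'')
      (.pure (.const _) hs'')
    cases b y <;> simp [ofProp]

/-- The encoding of the state of a step of the tournament. -/
def encodeStep {n : ℕ} (σ : List (Claim n) ⊕ List (Claim n)) : Data :=
  σ.elim (fun st => cons nil (ofList (st.map Claim.encode)))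
    fun st => cons (cons nil nil) (ofList (st.map Claim.encode))

theorem effRun_stepRound {σ : ∀ y, List (Claim (I (x y)).n) ⊕ List (Claim (I (x y)).n)}
    (hs : Eff e fun y => ofList (s y).transcript) (hp : Eff e fun y => ofNat (p y))
    (hl : Eff e fun y => ofNat (l y)) (hσ : Eff e fun y => encodeStep (σ y)) :
    EffRun e (fun _ => encodeStep) (fun y => (I (x y)).stepRound (p y) (l y) (σ y)) s := by
  have hinl : ∀ {Δ : Type} {d : Δ → Data} {g : Δ → Γ} {s : Δ → Log}
      (t : ∀ z, List (Claim (I (x (g z))).n)), (Eff d fun z => ofList (s z).transcript) →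
      (Eff d fun z => ofList ((t z).map Claim.encode)) →
      EffRun d (fun _ => encodeStep) (fun z => (return .inl (t z) :
        StateM Log (List (Claim (I (x (g z))).n) ⊕ List (Claim (I (x (g z))).n)))) s :=
    fun t hs ht => .pure ((Eff.const nil).cons ht) hs
  refine .sum (α := fun y => List (Claim (I (x y)).n)) (β := fun y => List (Claim (I (x y)).n))
    (σ := σ) (encα := fun _ st => ofList (st.map Claim.encode))
    (encβ := fun _ st => ofList (st.map Claim.encode)) hσ ?_ ?_
  · intro Δ d g st hst lift hst'
    exact (hinl st (lift hs) hst').congr fun z => by rw [hst z]; rfl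
  intro Δ d g st hst lift hst'
  refine .list (enc' := fun _ => Claim.encode) hst' ?_ ?_
  · intro Δ' d' g' hnil lift'
    refine EffRun.congr (prog := fun y => do
      return .inl (← (I (x (g (g' y)))).getClaim (p (g (g' y))) (l (g (g' y))) 1).toList) ?_
      fun y => by rw [hst (g' y), hnil y]; rfl
    refine .bind (h.effRun_getClaim (lift' (lift hx)) (r := fun _ => 1) (lift' (lift hs))
      (lift' (lift hp)) (lift' (lift hl))) fun o s' ho hs' => ?_
    refine hinl _ hs' ((Eff.ite (ho.eq (.const nil)) (.const nil) ho.tl.ofList_one).congr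
      fun y => ?_)
    cases o y <;> simp [ofOption]
  · intro Δ' d' g' c t hct lift' hc ht
    refine EffRun.congr (prog := fun y => do
      match ← (I (x (g (g' y)))).challenge (p (g (g' y))) (l (g (g' y))) (c y) with
      | .challengerLoses => return .inl (c y :: t y)
      | .responderLoses => return .inr (t y)
      | .nested c' => return .inl (c' :: c y :: t y)) ?_ fun y => by
        rw [hst (g' y), hct y, Setting.stepRound]
        refine bind_congr fun o => ?_
        cases o <;> rfl
    refine .bind (h.effRun_challenge (lift' (lift hx)) (lift' (lift hs)) (lift' (lift hp))
      (lift' (lift hl)) hc) fun o s' ho hs' => ?_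
    -- The three outcomes are recast as a sum, with the two losing cases as Booleans, so that the
    -- case distinction `EffRun.sum` applies.
    let τ : ∀ y, Bool ⊕ Claim (I (x (g (g' y)))).n := fun y =>
      match o y with
      | .challengerLoses => .inl true
      | .responderLoses => .inl false
      | .nested c => .inr c
    have hτ : Eff d' fun y => (τ y).elim (fun b => cons nil (ofBool b))
        fun c => cons (cons nil nil) c.encode := by
      refine (Eff.ite (ho.hd.eq (.const nil)) ((Eff.const nil).cons (Eff.ite (ho.eq (.const nil))
        (.const nil) (.const (cons nil nil)))) ho).congr fun y => ?_
      simp only [τ]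
      cases o y <;> simp [Outcome.encode]
    refine .sum (α := fun _ => Bool) (σ := τ) (encα := fun _ => ofBool)
      (encβ := fun _ => Claim.encode) hτ ?_ ?_
    · intro Δ'' d'' g'' b hb lift'' hb'
      have hp : Eff d'' fun z => ofProp (b z = true) := hb'.congr fun z => by simp [ofProp]
      refine (EffRun.ite hp (hinl (g := fun z => g (g' (g'' z))) (fun z => c (g'' z) :: t (g'' z))
        (lift'' hs') ((lift'' hc).ofList_cons (lift'' ht)))
        (.pure (α := fun z => List (Claim (I (x (g (g' (g'' z))))).n) ⊕
          List (Claim (I (x (g (g' (g'' z))))).n)) (enc := fun _ => encodeStep)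
          (a := fun z => .inr (t (g'' z))) ((Eff.const _).cons (lift'' ht)) (lift'' hs'))).congr
        fun z => ?_
      have := hb z
      simp only [τ] at this
      cases ho : o (g'' z) with
      | challengerLoses => rw [ho] at this; rw [if_pos (Sum.inl.inj this).symm]
      | responderLoses => rw [ho] at this; rw [← Sum.inl.inj this]; rfl
      | nested c => rw [ho] at this; cases this
    · intro Δ'' d'' g'' c' hc' lift'' hc''
      refine (hinl (g := fun z => g (g' (g'' z))) (fun z => c' z :: c (g'' z) :: t (g'' z))
        (lift'' hs') (hc''.ofList_cons ((lift'' hc).ofList_cons (lift'' ht)))).congr fun z => ?_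
      have := hc' z
      simp only [τ] at this
      cases ho : o (g'' z) with
      | challengerLoses => rw [ho] at this; cases this
      | responderLoses => rw [ho] at this; cases this
      | nested c => rw [ho] at this; cases this; rfl

omit h hx in
theorem size_stack_le {n k W m : ℕ} {st : List (Claim n)} (hn : n ≤ k) (hm : st.length ≤ m)
    (hst : ∀ c ∈ st, c.Small k W) :
    (ofList (st.map Claim.encode)).size ≤ m * (8 * k + 2 * W + 6) + 1 := by
  refine (size_ofList_le (m := 8 * k + 2 * W + 5) fun d hd => ?_).trans ?_
  · obtain ⟨c, hc, rfl⟩ := List.mem_map.1 hd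
    exact size_encode_le hn (hst c hc)
  · rw [List.length_map]
    gcongr

omit h hx in
theorem small_of_mem_stack {n : ℕ} {st : List (Claim n)} {c : Claim n} (hc : c ∈ st) :
    c.Small (ofList (st.map Claim.encode)).size (ofList (st.map Claim.encode)).size := by
  have : c.encode.size ≤ (ofList (st.map Claim.encode)).size :=
    size_le_of_mem_toList (by rw [toList_ofList]; exact List.mem_map_of_mem hc)
  exact small_mono (small_encode c) this this

omit h hx in
theorem length_stack_le {n : ℕ} (st : List (Claim n)) :
    st.length ≤ (ofList (st.map Claim.encode)).size := by
  have := length_toList_lt (ofList (st.map Claim.encode))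
  rw [toList_ofList, List.length_map] at this
  exact this.le

omit h hx in
theorem bounded_stack {m k W : Γ → ℕ} (hm : Bounded e m) (hk : Bounded e k) (hW : Bounded e W) :
    Bounded e fun y => m y * (8 * k y + 2 * W y + 6) + 1 :=
  (hm.mul ((((Bounded.const 8).mul hk).add ((Bounded.const 2).mul hW)).add (.const 6))).add (.const 1)

theorem effRun_step (hs : Eff e fun y => ofList (s y).transcript)
    (hp : Eff e fun y => ofNat (p y)) (hl : Eff e fun y => ofNat (l y))
    (hst : Eff e fun y => ofList ((st y).map Claim.encode)) :
    EffRun e (fun _ st => ofList (st.map Claim.encode))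
      (fun y => (I (x y)).step (p y) (l y) (st y)) s := by
  obtain ⟨K, M, hK, hM, hb⟩ := h.exists_bounds
  let S : Γ → ℕ := fun y => (ofList ((st y).map Claim.encode)).size
  let k : Γ → ℕ := fun y => K (x y) + (ofNat (l y)).size + S y
  let W : Γ → ℕ := fun y => M (k y) + S y
  have hS : Bounded e S := hst.bound
  have hk : Bounded e k := ((hK.comp hx).add hl.bound).add hS
  have hW : Bounded e W := (hM.comp_nat hk).add hS
  have hlen : Eff e fun y => unary ((st y).length + 1) := hst.length.unary_add (.const (unary 1))
  refine EffRun.congr (prog := fun y => do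
    return (← (List.range ((st y).length + 1)).foldlM
      (fun σ _ => (I (x y)).stepRound (p y) (l y) σ) (.inr (st y))).elim id id) ?_
    fun y => (Setting.step_eq _ _ _ (by simp)).symm
  refine .bind (enc := fun _ => encodeStep) (.foldlM (β := fun _ => ℕ) (enc' := fun _ => unary)
    (τ := fun y => List (Claim (I (x y)).n) ⊕ List (Claim (I (x y)).n)) (encτ := fun _ => encodeStep)
    (l := fun y => List.range ((st y).length + 1)) (z := fun y => .inr (st y))
    (f := fun y σ _ => (I (x y)).stepRound (p y) (l y) σ)
    (B := fun y => ((S y + 1) * (8 * k y + 2 * W y + 6) + 1 + 4) + ((ofList (s y).transcript).size +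
      (S y + 1) * (2 * k y + 3) * (Setting.entryBound (k y) (W y) + 1))) hlen.range
    ((Eff.const _).cons hst) hs (fun Δ d g σ s' b lift hσ hs' _ =>
      h.effRun_stepRound (lift hx) hs' (lift hp) (lift hl) hσ)
    (((bounded_stack (hS.add (.const 1)) hk hW).add (.const 4)).add (hs.bound.add
      (((hS.add (.const 1)).mul (((Bounded.const 2).mul hk).add (.const 3))).mul
      ((bounded_entryBound hk hW).add (.const 1)))))
    fun y l' hl' => ?_) fun σ s' hσ hs' => ?_
  · have hlen := hl'.length_le
    rw [List.length_range] at hlen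
    have hlS : (st y).length ≤ S y := length_stack_le _
    have hbk := hb (x y) (k y) (by simp only [k]; omega)
    have hls := size_le_size_ofNat (l y)
    obtain ⟨h₁, h₂, h₃⟩ := Setting.foldlM_stepRound_grow (k := k y) (W := W y) hbk
      (Nat.le_add_right _ _) (p y) (l := l y) (by simp only [k]; omega) l' (st y).length
      (.inr (st y)) (s y) (fun c hc => small_mono (small_of_mem_stack hc) (Nat.le_add_left _ _)
        (Nat.le_add_left _ _)) (by simp) (by rintro _ ⟨⟩; rfl) fun _ _ => trivial
    have h₄ : l'.length * (2 * k y + 3) * (Setting.entryBound (k y) (W y) + 1) ≤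
      (S y + 1) * (2 * k y + 3) * (Setting.entryBound (k y) (W y) + 1) := by gcongr; omega
    refine add_le_add ?_ (h₃.size_le.trans (by omega))
    have h₅ := size_stack_le hbk.n (h₂.trans (Nat.add_le_add_right hlS 1)) h₁
    revert h₅
    generalize ((l'.foldlM (fun σ _ => (I (x y)).stepRound (p y) (l y) σ) (.inr (st y))).run (s y)).1 = σ
    rcases σ with t | t <;> simp only [encodeStep, Sum.elim_inl, Sum.elim_inr, size_cons, size_nil, id] <;>
      omega
  · refine .pure (α := fun y => List (Claim (I (x y)).n)) (hσ.tl.congr fun y => ?_) hs'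
    rcases σ y with t | t <;> rfl

end Feasible

/-- The transcript of the tournament can be computed in polynomial time. -/
theorem Feasible.eff_transcript {X : Type} {I : X → Setting} {e₀ : X → Data} (h : Feasible I e₀) :
    Eff e₀ fun x => ofList (I x).finalLog.transcript := by
  obtain ⟨K, M, hK, hM, hb⟩ := h.exists_bounds
  have hrange : Eff e₀ fun x => ofList ((List.finRange (I x).n).map fun p : Fin (I x).n => ofNat p) := by
    refine (Eff.map (β := fun _ => ℕ) (enc := fun _ => unary) (f := fun _ => ofNat) h.n.range
      fun _ _ _ _ _ _ hb => hb.bin).congr fun x => ?_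
    rw [← List.map_coe_finRange_eq_range, List.map_map]
    rfl
  let ask : ∀ x, List (Fin (I x).n × ℕ) → Fin (I x).n → StateM Log (List (Fin (I x).n × ℕ)) :=
    fun x acc p => do
      let z ← (do
        let m ← (I x).ask p .size 0 1
        return (p, m.toNat))
      return z :: acc
  have hask : ∀ x (l : List (Fin (I x).n)) acc s, Triple Set.univ s (l.foldlM (ask x) acc)
      fun acc' s' => (∃ new, acc' = new ++ acc ∧ new.length = l.length ∧ ∀ z ∈ new, z.2.size ≤ M (K x)) ∧
        Grow (Setting.entryBound (K x) (M (K x))) l.length s s' := by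
    intro x l
    induction l with
    | nil => exact fun acc s => Triple.pure ⟨⟨[], rfl, rfl, by simp⟩, .refl _ _ _⟩
    | cons p l ih =>
      intro acc s
      rw [List.foldlM_cons]
      refine .bind_univ (Q := fun acc' s' => (∃ m, acc' = (p, m) :: acc ∧ m.size ≤ M (K x)) ∧
        Grow (Setting.entryBound (K x) (M (K x))) 1 s s') ?_ ?_
      · refine .bind_univ (.bind_univ (Setting.ask_grow (hb x _ le_rfl) le_rfl s p 0 (q := .size) trivial
          (.inl (by omega))) fun m s' hm => Triple.pure
          (Q := fun (z : Fin (I x).n × ℕ) s' => (z.1 = p ∧ z.2.size ≤ M (K x)) ∧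
            Grow (Setting.entryBound (K x) (M (K x))) 1 s s')
          ⟨⟨rfl, (size_toNat_le m).trans hm.1⟩, hm.2⟩) fun z s' ⟨⟨h₁, h₂⟩, h₃⟩ =>
          Triple.pure ⟨⟨z.2, by rw [← h₁], h₂⟩, h₃⟩
      · rintro acc' s' ⟨⟨m, rfl, hm⟩, hs'⟩
        refine (ih _ s').mono ?_
        rintro acc'' s'' ⟨⟨new, rfl, h₁, h₂⟩, h₃⟩
        refine ⟨⟨new ++ [(p, m)], by simp, by simp [h₁], ?_⟩, (hs'.trans h₃).of_le (by rw [List.length_cons]; omega)⟩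
        intro z hz
        rcases List.mem_append.1 hz with hz | hz
        · exact h₂ z hz
        · rw [List.mem_singleton.1 hz]
          exact hm
  have hMK := hM.comp_nat hK
  suffices EffRun e₀ (fun _ _ => nil) (fun x => (I x).tournament) fun _ => ⟨[], 0, 0⟩ from this.2
  -- Collecting the claimed sizes is rewritten as a left fold with reversed accumulator, the form to
  -- which `EffRun.foldlM` applies.
  refine EffRun.congr (prog := fun x => do
    let acc ← (List.finRange (I x).n).foldlM (ask x) []
    modify fun s => { s with rounds := s.rounds + 1 }
    let s ← (acc.reverse.insertionSort fun x y => x.2 ≤ y.2).foldlM (fun s z => (I x).step z.1 z.2 s) []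
    return s.head?) ?_ fun x => ?_
  · refine .bind (enc := fun _ acc => ofList (acc.map fun z => cons (ofNat z.1) (ofNat z.2)))
      (.foldlM (τ := fun x => List (Fin (I x).n × ℕ)) (z := fun _ => []) (f := ask)
      (encτ := fun _ acc => ofList (acc.map fun z => cons (ofNat z.1) (ofNat z.2)))
      (B := fun x => (K x * (4 * K x + 4 * M (K x) + 4) + 1) +
        (1 + K x * (Setting.entryBound (K x) (M (K x)) + 1)))
      hrange (.const nil) (.const nil) ?_ ?_ ?_) ?_
    · intro Δ d g acc s' p lift hacc hs' hp
      exact .bind (α := fun z => Fin (I (g z)).n × ℕ)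
        (enc := fun _ z => cons (ofNat z.1) (ofNat z.2)) (.bind
        (h.effRun_ask (lift .self) hs' hp (q := fun _ => .size) (Feasible.eff_tag 0).ofList_one (.const (unary 1))
        fun Δ' d' g' L lift' hL => Feasible.eff_honest_size hL) fun m s'' hm hs'' =>
        .pure (α := fun z => Fin (I (g z)).n × ℕ) (hp.cons hm.toNat) hs'') fun z s'' hz hs'' =>
        .pure (α := fun z => List (Fin (I (g z)).n × ℕ)) (hz.ofList_cons hacc) hs''
    · exact ((hK.mul ((((Bounded.const 4).mul hK).add ((Bounded.const 4).mul hMK)).add (.const 4))).add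
        (.const 1)).add ((Bounded.const 1).add (hK.mul ((Feasible.bounded_entryBound hK hMK).add (.const 1))))
    · intro x l' hl'
      obtain ⟨⟨new, h₁, h₂, h₃⟩, h₄⟩ := hask x l' [] ⟨[], 0, 0⟩ fun _ _ => trivial
      have hn := (hb x _ le_rfl).n
      have hlen := hl'.length_le
      rw [List.length_finRange] at hlen
      have h₅ : l'.length * (Setting.entryBound (K x) (M (K x)) + 1) ≤
        K x * (Setting.entryBound (K x) (M (K x)) + 1) := by gcongr; omega
      refine add_le_add ?_ (h₄.size_le.trans (Nat.add_le_add_left h₅ _))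
      rw [h₁, List.append_nil]
      refine (size_ofList_le (m := 4 * K x + 4 * M (K x) + 3) fun d hd => ?_).trans ?_
      · obtain ⟨z, hz, rfl⟩ := List.mem_map.1 hd
        have h₆ := size_ofNat_le_of_le (z.1.2.le.trans hn)
        have h₇ := size_ofNat_le z.2
        have h₈ := h₃ z hz
        rw [size_cons]
        omega
      · rw [List.length_map, h₂]
        gcongr
        omega
    · intro acc s₁ hacc hs₁
      refine .bind (enc := fun _ _ => nil) ⟨.const nil, hs₁⟩ fun _ s₂ _ hs₂ => ?_
      have hsort := Eff.insertionSort (l := fun x => (acc x).reverse) ((Eff.reverse hacc).congr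
        fun x => by rw [List.map_reverse])
      let xs : ∀ x, List (Fin (I x).n × ℕ) := fun x =>
        (acc x).reverse.insertionSort fun x y => x.2 ≤ y.2
      let S : X → ℕ := fun x => (ofList ((xs x).map fun z => cons (ofNat z.1) (ofNat z.2))).size
      let k : X → ℕ := fun x => K x + S x
      have hS : Bounded e₀ S := hsort.bound
      have hk : Bounded e₀ k := hK.add hS
      have hMk := hM.comp_nat hk
      refine .bind (enc := fun _ st => ofList (st.map Claim.encode)) (.foldlM
        (τ := fun x => List (Claim (I x).n)) (encτ := fun _ st => ofList (st.map Claim.encode))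
        (z := fun _ => []) (f := fun x st z => (I x).step z.1 z.2 st) (l := xs)
        (B := fun x => (S x * (8 * k x + 2 * M (k x) + 6) + 1) + ((ofList (s₂ x).transcript).size +
          S x * ((S x + 1) * (2 * k x + 3)) * (Setting.entryBound (k x) (M (k x)) + 1)))
        hsort (.const nil) hs₂ ?_ ?_ ?_) fun st s₃ _ hs₃ => .pure (.const nil) hs₃
      · intro Δ d g st s' z lift hst hs' hz
        exact h.effRun_step (lift .self) hs' (p := fun y => (z y).1) (l := fun y => (z y).2) hz.hd hz.tl hst
      · exact (Feasible.bounded_stack hS hk hMk).add (hs₂.bound.add ((hS.mul ((hS.add (.const 1)).mul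
          (((Bounded.const 2).mul hk).add (.const 3)))).mul ((Feasible.bounded_entryBound hk hMk).add (.const 1))))
      · intro x l' hl'
        have hlen : l'.length ≤ S x := by
          have h₁ := length_toList_lt (ofList ((xs x).map fun z => cons (ofNat z.1) (ofNat z.2)))
          rw [toList_ofList, List.length_map] at h₁
          exact hl'.length_le.trans h₁.le
        have hbk := hb x (k x) (Nat.le_add_right _ _)
        have hle : ∀ z ∈ l', z.2.size ≤ k x := by
          intro z hz
          have h₁ : cons (ofNat z.1) (ofNat z.2) ∈
              (ofList ((xs x).map fun z => cons (ofNat z.1) (ofNat z.2))).toList := by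
            rw [toList_ofList]
            exact List.mem_map_of_mem (f := fun z : Fin (I x).n × ℕ => cons (ofNat z.1) (ofNat z.2))
              (hl'.subset hz)
          have h₂ := size_le_of_mem_toList h₁
          have h₃ := size_le_size_ofNat z.2
          rw [size_cons] at h₂
          simp only [k, S]
          omega
        -- Bounds that are uniform over all steps are essential: that each step is polynomial in its
        -- own input would still allow stack and transcript to grow exponentially over `n` steps.
        obtain ⟨h₁, h₂, h₃⟩ := Setting.foldlM_step_grow hbk le_rfl (s₂ x) (S x) hle (st := [])
          (by simp) (by simpa using hlen) fun _ _ => trivial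
        have h₄ : l'.length * ((S x + 1) * (2 * k x + 3)) * (Setting.entryBound (k x) (M (k x)) + 1) ≤
          S x * ((S x + 1) * (2 * k x + 3)) * (Setting.entryBound (k x) (M (k x)) + 1) := by gcongr
        exact add_le_add (Feasible.size_stack_le hbk.n h₂ h₁)
          (h₃.size_le.trans (Nat.add_le_add_left h₄ _))
  · rw [Setting.tournament, List.mapM_eq_reverse_foldlM_cons, map_eq_bind_pure_comp, bind_assoc]
    rfl


/-! ### Experiments -/

namespace System

variable {Party : Type} (S : System Party) (A : PPT)

/-- A possible outcome of the experiment. -/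
structure Trial where
  k : ℕ
  world : World Party
  mem : world ∈ (S.setup k).support
  coins : A.Coins k

variable {S A}

namespace Trial

/-- The input of the adversary. -/
def input (x : S.Trial A) : Data := ofList [S.view x.k x.world, encodeCoins x.coins]

/-- The tournament that is played. -/
abbrev setting (x : S.Trial A) : Setting := S.setting A x.k x.world x.coins

theorem eff_view : Eff input fun x : S.Trial A => S.view x.k x.world :=
  (Eff.self.nth 0).congr fun _ => rfl

theorem eff_pub : Eff input fun x : S.Trial A => x.world.pub :=
  (eff_view.nth 6).congr fun _ => rfl

end Trial

/-- All quantities that vary with the security parameter are read off the public view, in unary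
where they bound loops. The window is a constant, as `α`, `u` and `ν` do not vary. -/
theorem feasible (hE : S.Efficient) (hC : S.ConstantSize) :
    Feasible (fun x : S.Trial A => x.setting) Trial.input := by
  have hw : Eff Trial.input fun x : S.Trial A => unary (S.w x.k) :=
    (Trial.eff_view.nth 3).congr fun _ => rfl
  obtain ⟨Fh, hFh, hash⟩ := hE.hash
  obtain ⟨Fδ, hFδ, δ⟩ := hE.δ
  obtain ⟨Fc, hFc, commit⟩ := hE.commit
  obtain ⟨Fs, hFs, sδ⟩ := hE.sδ
  obtain ⟨Fp, hFp, prove⟩ := hE.prove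
  obtain ⟨Fo, hFo, co⟩ := hE.co
  refine ⟨?_, ?_, .const _, ?_, ?_, ?_, ?_, ?_, .const (unary S.window), ?_, ?_, ?_, ?_, ?_, ?_, ?_⟩
  · exact (Eff.comp₁ hFh ((Trial.eff_pub.comp Prod.fst Eff.self.hd).ofList_two Eff.self.tl)).congr
      fun z => hash _ _
  · exact (Eff.comp₁ hFδ (Eff.self.tl.hd.ofList_two Eff.self.tl.tl)).congr fun z => δ _ _
  · exact (Eff.comp₁ hFc ((Trial.eff_pub.comp Prod.fst Eff.self.hd).ofList_two Eff.self.tl)).congr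
      fun z => commit _ _
  · exact (Eff.comp₁ hFs ((Trial.eff_pub.comp Prod.fst Eff.self.hd).ofList_cons
      (Eff.self.tl.hd.ofList_three Eff.self.tl.tl.hd Eff.self.tl.tl.tl))).congr fun z => sδ _ _ _ _
  · exact (Eff.comp₁ hFp ((Trial.eff_pub.comp Prod.fst Eff.self.hd).ofList_three Eff.self.tl.hd
      Eff.self.tl.tl)).congr fun z => prove _ _ _
  · have hr : Eff Trial.input fun x : S.Trial A => unary (S.r x.k) :=
      (Trial.eff_view.nth 2).congr fun _ => rfl
    exact (Eff.comp₁ hFo ((Trial.eff_pub.comp Prod.fst Eff.self.hd).ofList_cons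
      ((hr.comp Prod.fst Eff.self.hd).ofList_cons
      (Eff.self.tl.hd.ofList_three Eff.self.tl.tl.hd Eff.self.tl.tl.tl)))).congr
      fun z => co _ _ _ _ _
  · have hc : Eff Trial.input fun x : S.Trial A => encodeCoins x.coins :=
      (Eff.self.nth 1).congr fun _ => rfl
    have hm : Eff (fun z : S.Trial A × ℕ × Data × Data =>
        cons z.1.input (cons (unary z.2.1) (cons z.2.2.1 z.2.2.2))) fun z =>
        A.next (ofList [S.view z.1.k z.1.world, encodeCoins z.1.coins, z.2.2.1, z.2.2.2]) :=
      Eff.comp₁ A.polyTime ((Trial.eff_view.comp Prod.fst Eff.self.hd).ofList_cons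
        ((hc.comp Prod.fst Eff.self.hd).ofList_three Eff.self.tl.tl.hd Eff.self.tl.tl.tl))
    have h₄ := Eff.unary_add (hw.comp Prod.fst Eff.self.hd)
      (.const (e := fun z : S.Trial A × ℕ × Data × Data =>
        cons z.1.input (cons (unary z.2.1) (cons z.2.2.1 z.2.2.2))) (unary 4))
    exact Eff.ite (hm.unary_size.bin.le (Eff.self.tl.hd.unary_mul h₄).bin) hm (.const nil)
  · exact (Trial.eff_view.nth 4).congr fun _ => rfl
  · exact (Trial.eff_view.nth 5).congr fun _ => rfl
  · exact (Trial.eff_view.nth 1).congr fun _ => rfl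
  · exact (Trial.eff_view.nth 7).congr fun _ => rfl
  · refine ⟨_, hw.bound, fun x d => (hC.hash x.k x.world x.mem d).trans ?_⟩
    rw [size_unary]
    omega
  · obtain ⟨c, hc⟩ := hE.growth
    exact ⟨c, fun x => hc⟩
  · refine ⟨_, hw.bound.add (.const 4), fun x m t q => ?_⟩
    rw [size_unary]
    change (if _ then _ else _ : Data).size ≤ _
    split_ifs with h
    · refine h.trans (Nat.le_succ_of_le (Nat.mul_le_mul_left m ?_))
      omega
    · exact Nat.le_add_left _ _

theorem toOuterMeasure_ne_top {α : Type} (p : PMF α) (s : Set α) : p.toOuterMeasure s ≠ ⊤ := by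
  rw [PMF.toOuterMeasure_apply]
  exact ne_top_of_le_ne_top (p.tsum_coe ▸ ENNReal.one_ne_top)
    (ENNReal.tsum_le_tsum fun a => Set.indicator_le_self' (fun _ _ => zero_le) a)

variable (S A)

/-- Executions outside the support carry no mass, so the implication is needed only where the axioms
stated with `Always` are available. -/
theorem prob_le {k : ℕ} {E E' : World Party → A.Coins k → Prop}
    (h : ∀ ω ∈ (S.setup k).support, ∀ c, E ω c → E' ω c) : S.prob A k E ≤ S.prob A k E' := by
  refine ENNReal.toReal_mono (toOuterMeasure_ne_top _ _) (PMF.toOuterMeasure_mono _ ?_)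
  rintro ⟨ω, c⟩ ⟨h₁, h₂⟩
  refine h ω ?_ c h₁
  rw [experiment, PMF.mem_support_bind_iff] at h₂
  obtain ⟨ω', h', h₂⟩ := h₂
  rw [PMF.mem_support_map_iff] at h₂
  obtain ⟨c', -, h₂⟩ := h₂
  cases h₂
  exact h'

theorem prob_or_le {k : ℕ} (E E' : World Party → A.Coins k → Prop) :
    S.prob A k (fun ω c => E ω c ∨ E' ω c) ≤ S.prob A k E + S.prob A k E' := by
  refine (ENNReal.toReal_mono (ENNReal.add_ne_top.2 ⟨toOuterMeasure_ne_top _ _,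
    toOuterMeasure_ne_top _ _⟩) (MeasureTheory.measure_union_le _ _)).trans
    ENNReal.toReal_add_le

variable {S A}

/-- An event that has negligible probability. -/
def Rare (E : S.Trial A → Prop) : Prop :=
  Negligible fun k => S.prob A k fun ω c => ∃ h, E ⟨k, ω, h, c⟩

theorem negligible_of_le {B : PPT} {E : ∀ k, World Party → A.Coins k → Prop}
    {E' : ∀ k, World Party → B.Coins k → Prop}
    (h' : Negligible fun k => S.prob B k (E' k))
    (h : ∀ k, S.prob A k (E k) ≤ S.prob B k (E' k)) : Negligible fun k => S.prob A k (E k) :=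
  h'.trans_abs_le fun k => abs_le_abs_of_nonneg ENNReal.toReal_nonneg (h k)

namespace Rare

variable {E E' : S.Trial A → Prop}

theorem mono (h' : Rare E') (h : ∀ x, E x → E' x) : Rare E :=
  negligible_of_le h' fun _ => prob_le S A fun _ _ _ => .imp fun _ => h _

theorem or (h : Rare E) (h' : Rare E') : Rare fun x => E x ∨ E' x :=
  (h.add h').trans_abs_le fun _ => abs_le_abs_of_nonneg ENNReal.toReal_nonneg <|
    (prob_le S A fun _ _ _ => fun ⟨hω, h⟩ => h.imp (⟨hω, ·⟩) (⟨hω, ·⟩)).trans (prob_or_le S A _ _)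

/-- A union bound over a fixed number of events. No uniformity in `i` is required, because `m` does
not depend on the security parameter. -/
theorem exists_lt {E : ℕ → S.Trial A → Prop} (h : ∀ i, Rare (E i)) (m : ℕ) :
    Rare fun x => ∃ i < m, E i x := by
  induction m with
  | zero =>
    refine (Asymptotics.superpolynomialDecay_zero _ _).congr fun k => ?_
    simp [prob]
  | succ m ih =>
    refine (ih.or (h m)).mono fun x ⟨i, hi, hE⟩ => ?_
    rcases Nat.lt_succ_iff_lt_or_eq.1 hi with hi | rfl
    · exact .inl ⟨i, hi, hE⟩
    · exact .inr hE

/-- What an efficient search finds does not break a cryptographic assumption. -/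
theorem search {W : ℕ → World Party → Data → Prop}
    (hW : ∀ B : PPT, Negligible fun k => S.prob B k fun ω c => W k ω (S.output B k ω c))
    {l : S.Trial A → List Data} (hl : Eff Trial.input fun x => ofList (l x))
    {p : S.Trial A → Data → Bool}
    (hp : ∀ (Δ : Type) (d : Δ → Data) (g : Δ → S.Trial A) (b : Δ → Data),
      (∀ {w : S.Trial A → Data}, Eff Trial.input w → Eff d fun z => w (g z)) → Eff d b →
      Eff d fun z => ofBool (p (g z) (b z))) :
    Rare fun x : S.Trial A => ∃ d, (l x).find? (p x) = some d ∧ W x.k x.world d := by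
  -- The new adversary runs the search with the coins of `A` and outputs the first hit. Taking the
  -- tail strips the tag of the optional result.
  obtain ⟨F, hF, h⟩ := (Eff.find (β := fun _ => Data) (enc := fun _ d => d) (p := p)
    (hl.congr fun x => by rw [List.map_id']) fun Δ d g b _ => hp Δ d g b).tl
  refine negligible_of_le (hW ⟨F, hF, A.coins⟩) fun k => ?_
  change _ ≤ S.prob A k fun ω c => W k ω (F (ofList [S.view k ω, encodeCoins c]))
  refine prob_le S A fun ω hω c => ?_
  rintro ⟨_, d, h₁, h₂⟩
  have h₃ : F (ofList [S.view k ω, encodeCoins c]) = _ := h ⟨k, ω, hω, c⟩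
  beta_reduce at h₃
  rw [h₁] at h₃
  rw [h₃]
  exact h₂

end Rare

end System


/-! ### Extraction of forgeries -/

theorem pathInputs_eq_map (H : Data → Data) (h : Data) (j : ℕ) (path : List Data) :
    pathInputs H h j path = (List.range path.length).map fun s =>
      joint (pathRoot H h j (path.take s)) (j / 2 ^ s) (path.getD s nil) := by
  induction path generalizing h j with
  | nil => rfl
  | cons d l ih =>
    rw [pathInputs, ih, List.length_cons, List.range_succ_eq_map, List.map_cons, List.map_map]
    congr 1
    · simp [pathRoot]
    · refine List.map_congr_left fun s _ => ?_
      rw [Function.comp_apply, List.take_succ_cons, pathRoot_cons, List.getD_cons_succ, pow_succ',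
        Nat.div_div_eq_div_mul]

theorem mem_subs_of_mem {l : List Data} {d : Data} (h : d ∈ l) : d ∈ (ofList l).subs := by
  induction l with
  | nil => cases h
  | cons a l ih =>
    rcases List.mem_cons.1 h with rfl | h
    · exact hd_mem_subs (self_mem_subs (ofList (d :: l)))
    · exact subs_trans (ih h) (tl_mem_subs (self_mem_subs (ofList (a :: l))))

namespace Setting

variable (I : Setting)

/-- What is sent during the tournament. -/
def messages : List Data := (subtrees (ofList I.finalLog.transcript)).toList

theorem mem_messages {d : Data} : d ∈ I.messages ↔ d ∈ (ofList I.finalLog.transcript).subs :=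
  mem_subtrees

/-- The ledger of the first honest prover. -/
def firstLedger : List Data :=
  (((List.ofFn fun i => ofOption ((I.ledger i).map ofList)).find? fun d => decide (d ≠ nil)).getD
    nil).tl.toList

theorem exists_firstLedger (h : ∃ P, I.ledger P ≠ none) : ∃ P, I.ledger P = some I.firstLedger := by
  have hf : ((List.ofFn fun i => ofOption ((I.ledger i).map ofList)).find?
      fun d => decide (d ≠ nil)).isSome := by
    rw [List.find?_isSome]
    obtain ⟨P, hP⟩ := h
    refine ⟨_, List.mem_ofFn.2 ⟨P, rfl⟩, ?_⟩
    obtain ⟨L, hL⟩ := Option.ne_none_iff_exists'.1 hP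
    simp [hL, ofOption]
  obtain ⟨d, hd⟩ := Option.isSome_iff_exists.1 hf
  obtain ⟨P, hP⟩ := List.mem_ofFn.1 (List.mem_of_find?_eq_some hd)
  have hne := List.find?_some hd
  refine ⟨P, ?_⟩
  rw [firstLedger, hd, Option.getD_some, ← hP]
  rw [← hP] at hne
  cases hL : I.ledger P with
  | none => simp [hL, ofOption] at hne
  | some L => simp [ofOption]

/-- All hash inputs that matter. -/
def hashInputList (L G : List Data) : List Data :=
  G ++ ((List.range (L.length + 1)).map (I.entry L) ++
    ((List.range (L.length + 1)).flatMap (fun a => (List.range (L.length + 2)).map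
      (nodeInput I.hash (I.entry L) a)) ++
    (List.range (L.length + 1)).flatMap fun i => G.flatMap fun z =>
      pathInputs I.hash (I.hash (z.nth 0)) i (z.nth 1).toList))

theorem mem_hashInputList {L G : List Data} {d : Data} (h : d ∈ I.hashInputs L {z | z ∈ G}) :
    d ∈ I.hashInputList L G := by
  simp only [hashInputList, List.mem_append, List.mem_map, List.mem_flatMap, List.mem_range,
    Nat.lt_succ_iff]
  rcases h with h | ⟨i, hi, rfl⟩ | ⟨a, ha, j, rfl⟩ | ⟨i, hi, z, hz, h⟩
  · exact .inl h
  · exact .inr (.inl ⟨i, hi, rfl⟩)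
  · refine .inr (.inr (.inl ⟨a, ha, ?_⟩))
    rcases le_or_gt j (L.length + 1) with hj | hj
    · exact ⟨j, hj, rfl⟩
    -- Positions are unbounded in `hashInputs`, but past the ledger all nodes of a level coincide,
    -- so position `|L| + 1` represents them in the finite list.
    · refine ⟨L.length + 1, le_rfl, ?_⟩
      rw [nodeInput, nodeInput, Feasible.node_eq _ _ _ (by omega : _ ≤ 2 * j),
        Feasible.node_eq _ _ _ (by omega : _ ≤ 2 * j + 1),
        Feasible.node_eq _ _ _ (by omega : _ ≤ 2 * (L.length + 1)),
        Feasible.node_eq _ _ _ (by omega : _ ≤ 2 * (L.length + 1) + 1)]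
  · exact .inr (.inr (.inr ⟨i, hi, z, hz, h⟩))

end Setting

namespace Feasible

variable {X : Type} {I : X → Setting} {e₀ : X → Data} (h : Feasible I e₀)

include h

theorem eff_messages : Eff e₀ fun x => ofList (I x).messages :=
  (Eff.comp₁ (F := subtrees) (by fun_prop) h.eff_transcript).toList

theorem eff_firstLedger : Eff e₀ fun x => ofList (I x).firstLedger := by
  refine ((Eff.find (β := fun _ => Data) (enc := fun _ d => d) (p := fun _ d => decide (d ≠ nil))
    (h.ledger.congr fun x => by rw [List.map_id']) fun Δ d g b _ _ hb =>
      (hb.eq (.const nil)).not).tl.tl.toList).congr fun x => ?_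
  rw [Setting.firstLedger]
  cases (List.ofFn fun i => ofOption (((I x).ledger i).map ofList)).find?
    fun d => decide (d ≠ nil) <;> rfl

variable {Γ : Type} {e : Γ → Data} {x : Γ → X} (hx : Eff e fun y => e₀ (x y))

include hx

theorem eff_pathInputs {i : Γ → ℕ} {v : Γ → Data} {path : Γ → List Data} (hv : Eff e v)
    (hi : Eff e fun y => ofNat (i y)) (hpath : Eff e fun y => ofList (path y)) :
    Eff e fun y => ofList (pathInputs (I (x y)).hash (v y) (i y) (path y)) := by
  refine Eff.congr (Eff.map (β := fun _ => ℕ) (enc := fun _ => unary) hpath.length_list.range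
    fun Δ d g s _ lift hs => ?_) fun y => by rw [pathInputs_eq_map]
  have h₁ := h.eff_pathRoot (lift hx) (lift hv) (lift hi) (hs.take (lift hpath))
  have h₂ := Eff.getD hs (lift hpath) (.const nil)
  exact .ite ((lift hi).div_pow hs).even (h₁.cons h₂) (h₂.cons h₁)

theorem eff_hashInputList {L G : Γ → List Data} (hL : Eff e fun y => ofList (L y))
    (hG : Eff e fun y => ofList (G y)) :
    Eff e fun y => ofList ((I (x y)).hashInputList (L y) (G y)) := by
  have h₁ : Eff e fun y => unary ((L y).length + 1) := ((Eff.const nil).ofList_cons hL).length_list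
  have h₂ : Eff e fun y => unary ((L y).length + 2) := h₁.unary_add (.const (unary 1))
  refine hG.append (.append ?_ (.append ?_ ?_))
  · exact Eff.map (β := fun _ => ℕ) (enc := fun _ => unary) h₁.range fun Δ d g s _ lift hs =>
      h.eff_entry (lift hx) (lift hL) hs.bin
  · refine Eff.flatMap (β := fun _ => ℕ) (enc := fun _ => unary) h₁.range fun Δ d g a _ lift ha => ?_
    refine Eff.map (β := fun _ => ℕ) (enc := fun _ => unary) (lift h₂).range
      fun Δ' d' g' j _ lift' hj => ?_
    exact (h.eff_node (lift' (lift hx)) (lift' (lift hL)) (lift' ha) hj.bin.double).cons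
      (h.eff_node (lift' (lift hx)) (lift' (lift hL)) (lift' ha) hj.bin.double.succ)
  · refine Eff.flatMap (β := fun _ => ℕ) (enc := fun _ => unary) h₁.range fun Δ d g i _ lift hi => ?_
    refine Eff.flatMap (β := fun _ => Data) (enc := fun _ d => d)
      ((lift hG).congr fun x => by rw [List.map_id']) fun Δ' d' g' z _ lift' hz => ?_
    exact h.eff_pathInputs (lift' (lift hx)) (h.eff_hash (lift' (lift hx)) (hz.nth 0))
      (lift' hi).bin (hz.nth 1).toList

end Feasible


/-! ### Ledgers -/

theorem follows_iff {U : List Data} {a b : Data} :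
    Follows U a b ↔ ∃ i, (nil :: U)[i]? = some a ∧ (nil :: U)[i + 1]? = some b := by
  rw [Follows]
  generalize nil :: U = l
  constructor
  · rintro ⟨s, t, rfl⟩
    refine ⟨s.length, ?_, ?_⟩ <;> simp
  · rintro ⟨i, h₁, h₂⟩
    obtain ⟨hi, rfl⟩ := List.getElem?_eq_some_iff.1 h₁
    obtain ⟨hi', rfl⟩ := List.getElem?_eq_some_iff.1 h₂
    refine ⟨l.take i, l.drop (i + 2), ?_⟩
    rw [List.append_assoc, List.cons_append, List.cons_append, List.nil_append,
      List.getElem_cons_drop, List.getElem_cons_drop, List.take_append_drop]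

/-- Without duplicates, `a` occurs at one position only, and so it has at most one successor. -/
theorem getElem?_succ_of_follows {U : List Data} (hU : (nil :: U).Nodup) {i : ℕ} {a b : Data}
    (ha : (nil :: U)[i]? = some a) (h : Follows U a b) : (nil :: U)[i + 1]? = some b := by
  obtain ⟨j, h₁, h₂⟩ := follows_iff.1 h
  obtain ⟨hi, hia⟩ := List.getElem?_eq_some_iff.1 ha
  obtain ⟨hj, hja⟩ := List.getElem?_eq_some_iff.1 h₁
  rwa [hU.getElem_inj_iff.1 (hia.trans hja.symm)]

theorem getElem?_txAt {L U : List Data} (h : L <+: U) {i : ℕ} (hi : i ≤ L.length) :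
    (nil :: U)[i]? = some (Setting.txAt L i) := by
  have h' : nil :: L <+: nil :: U := List.cons_prefix_cons.2 ⟨rfl, h⟩
  have hlt : i < (nil :: L).length := Nat.lt_succ_of_le hi
  rw [Setting.txAt, List.getD_eq_getElem _ _ hlt, ← List.getElem?_eq_getElem hlt]
  exact (List.prefix_iff_getElem?.1 h' i hlt).trans (List.getElem?_eq_getElem hlt).symm

theorem Setting.state_succ' (I : Setting) {L : List Data} {i : ℕ} (hi : i < L.length) :
    I.state L (i + 1) = I.δ (I.state L i) (txAt L (i + 1)) := by
  rw [state, state, txAt, List.getD_cons_succ, List.getD_eq_getElem _ _ hi, List.take_add_one,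
    List.getElem?_eq_getElem hi, List.foldl_append]
  rfl

/-! ### Search spaces for collisions and wrong transitions. -/

namespace Setting

variable (I : Setting)

/-- The pairs of hash inputs. -/
def pairs : List Data :=
  (I.hashInputList I.firstLedger I.messages).flatMap fun y =>
    (I.hashInputList I.firstLedger I.messages).map fun y' => ofList [y, y']

def collides (d : Data) : Bool :=
  decide (d.nth 0 ≠ d.nth 1 ∧ I.hash (d.nth 0) = I.hash (d.nth 1))

/-- The transitions of the ledger with the proofs that have been sent. -/
def transitions : List Data :=
  (List.range I.firstLedger.length).flatMap fun i => I.messages.map fun z =>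
    ofList [I.state I.firstLedger i, txAt I.firstLedger (i + 1), z.nth 2]

def misleads (d : Data) : Bool :=
  decide (¬ ofOption (I.sδ (I.commit (d.nth 0)) (d.nth 1) (d.nth 2)) = nil ∧
    ¬ ofOption (I.sδ (I.commit (d.nth 0)) (d.nth 1) (d.nth 2)) =
      cons nil (I.commit (I.δ (d.nth 0) (d.nth 1))))

theorem misleads_iff {d : Data} : I.misleads d = true ↔
    ∃ com, I.sδ (I.commit (d.nth 0)) (d.nth 1) (d.nth 2) = some com ∧
      com ≠ I.commit (I.δ (d.nth 0) (d.nth 1)) := by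
  rw [misleads, decide_eq_true_iff]
  cases I.sδ (I.commit (d.nth 0)) (d.nth 1) (d.nth 2) <;> simp [ofOption]

end Setting

namespace Feasible

variable {X : Type} {I : X → Setting} {e₀ : X → Data} (h : Feasible I e₀)
  {Γ : Type} {e : Γ → Data} {x : Γ → X} (hx : Eff e fun y => e₀ (x y)) {v : Γ → Data}

include h

theorem eff_pairs : Eff e₀ fun x => ofList (I x).pairs := by
  have hY := h.eff_hashInputList .self h.eff_firstLedger h.eff_messages
  refine Eff.flatMap (β := fun _ => Data) (enc := fun _ d => d)
    (hY.congr fun x => by rw [List.map_id']) fun Δ d g y _ lift hy => ?_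
  refine Eff.map (β := fun _ => Data) (enc := fun _ d => d)
    ((lift hY).congr fun x => by rw [List.map_id']) fun Δ' d' g' y' _ lift' hy' => ?_
  exact (lift' hy).ofList_two hy'

theorem eff_transitions : Eff e₀ fun x => ofList (I x).transitions := by
  refine Eff.flatMap (β := fun _ => ℕ) (enc := fun _ => unary) h.eff_firstLedger.length_list.range
    fun Δ d g i _ lift hi => ?_
  refine Eff.map (β := fun _ => Data) (enc := fun _ d => d)
    ((lift h.eff_messages).congr fun x => by rw [List.map_id']) fun Δ' d' g' z _ lift' hz => ?_
  exact (lift' (h.eff_state (lift .self) (lift h.eff_firstLedger) hi.bin)).ofList_three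
    (lift' (Feasible.eff_txAt (lift h.eff_firstLedger) hi.bin.succ)) (hz.nth 2)

include hx

theorem eff_collides (hv : Eff e v) : Eff e fun y => ofBool ((I (x y)).collides (v y)) :=
  ((hv.nth 0).eq (hv.nth 1)).not.and
    ((h.eff_hash hx (hv.nth 0)).eq (h.eff_hash hx (hv.nth 1)))

theorem eff_misleads (hv : Eff e v) : Eff e fun y => ofBool ((I (x y)).misleads (v y)) := by
  have h₁ := h.eff_sδ hx (h.eff_commit hx (hv.nth 0)) (hv.nth 1) (hv.nth 2)
  exact (h₁.eq (.const nil)).not.and (h₁.eq (.cons (.const nil)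
    (h.eff_commit hx (h.eff_δ hx (hv.nth 0) (hv.nth 1))))).not

end Feasible

/-! ### The longest honest ledger, and why forgeries are rare. -/

namespace System

variable {Party : Type} {S : System Party} {A : PPT}

section Union

variable {k : ℕ} {ω : World Party} (hω : ω ∈ (S.setup k).support) (hS : S.LedgerSafe)

include hω hS

/-- There may be infinitely many parties. A longest ledger exists nevertheless, because by safety
all ledgers of round `r` are prefixes of a single ledger of round `r + 1`. -/
theorem exists_union [Nonempty Party] (r : ℕ) : ∃ P, ω.union r = ω.ledger P r ∧
    ∀ Q, (ω.ledger Q r).length ≤ (ω.ledger P r).length := by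
  have h : ∃ P, ∀ Q, (ω.ledger Q r).length ≤ (ω.ledger P r).length := by
    let Q₀ : Party := Classical.arbitrary _
    have hb : ∀ Q, (ω.ledger Q r).length ≤ (ω.ledger Q₀ (r + 1)).length := fun Q =>
      (hS k ω hω Q Q₀ r (r + 1) (Nat.lt_succ_self r)).length_le
    obtain ⟨m, ⟨P, rfl⟩, hm⟩ := Set.exists_max_image (Set.range fun Q => (ω.ledger Q r).length) id
      ((Set.finite_Iic _).subset (Set.range_subset_iff.2 hb)) (Set.range_nonempty _)
    exact ⟨P, fun Q => hm _ ⟨Q, rfl⟩⟩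
  refine ⟨h.choose, ?_, h.choose_spec⟩
  rw [World.union, dif_pos h]

/-- Safety compares ledgers of different rounds only. Both ledgers are prefixes of one ledger of
round `r + m + 1`, hence comparable, and their lengths decide. -/
theorem prefix_union [Nonempty Party] (P : Party) (r m : ℕ) : ω.ledger P r <+: ω.union (r + m) := by
  obtain ⟨P', h, hmax⟩ := S.exists_union hω hS (r + m)
  have h₁ : (ω.ledger P r).length ≤ (ω.ledger P (r + m)).length := by
    rcases m.eq_zero_or_pos with rfl | hm
    · exact le_rfl
    · exact (hS k ω hω P P r (r + m) (by omega)).length_le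
  rw [h]
  exact List.prefix_of_prefix_length_le (hS k ω hω P P r (r + m + 1) (by omega))
    (hS k ω hω P' P (r + m) (r + m + 1) (by omega)) (h₁.trans (hmax P))

/-- By safety the longest ledger of round `r + ν` is a prefix of the ledger of `P` at the strictly
later round `r + ν + u`, and the latter has gained fewer than `α (u + ν)` transactions since round
`r`. -/
theorem length_union_lt [Nonempty Party] (hlip : S.LedgerLipschitz) (hu : 0 < S.u) (P : Party)
    (r : ℕ) : (ω.union (r + S.ν)).length < (ω.ledger P r).length + S.window := by
  obtain ⟨P', h, -⟩ := S.exists_union hω hS (r + S.ν)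
  have h₁ := (hS k ω hω P' P (r + S.ν) (r + S.ν + S.u) (by omega)).length_le
  have h₂ := hlip k ω hω P r (r + S.ν + S.u) (by omega)
  rw [h, window]
  push_cast at h₂
  zify
  have h₃ : (S.α : ℤ) * (r + S.ν + S.u - r) = S.α * (S.u + S.ν) := by ring
  omega

theorem union_nodup [Nonempty Party] (hN : S.LedgerUnique) (r : ℕ) : (nil :: ω.union r).Nodup := by
  obtain ⟨P, h, -⟩ := S.exists_union hω hS r
  rw [h]
  exact hN k ω hω P r

end Union

/-! ### Forgeries are rare -/

namespace Rare

/-- If the efficient test `p` certifies a break, any hit in the list is as good as the first one.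
This applies to collisions and wrong transitions, but not to the consensus oracle. -/
theorem of_imp {W : ℕ → World Party → Data → Prop}
    (hW : ∀ B : PPT, Negligible fun k => S.prob B k fun ω c => W k ω (S.output B k ω c))
    {l : S.Trial A → List Data} (hl : Eff Trial.input fun x => ofList (l x))
    {p : S.Trial A → Data → Bool}
    (hp : ∀ (Δ : Type) (d : Δ → Data) (g : Δ → S.Trial A) (b : Δ → Data),
      (∀ {w : S.Trial A → Data}, Eff Trial.input w → Eff d fun z => w (g z)) → Eff d b →
      Eff d fun z => ofBool (p (g z) (b z)))
    (h : ∀ x d, p x d = true → W x.k x.world d) :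
    Rare fun x : S.Trial A => ∃ d ∈ l x, p x d = true := by
  refine (search hW hl hp).mono fun x hx => ?_
  obtain ⟨d, hd⟩ := Option.isSome_iff_exists.1 (List.find?_isSome.2 hx)
  exact ⟨d, hd, h x d (List.find?_some hd)⟩

variable (hE : S.Efficient) (hC : S.ConstantSize)

include hE hC

theorem collision (hcr : S.CollisionResistant) : Rare fun x : S.Trial A =>
    ¬ Set.InjOn x.setting.hash (x.setting.hashInputs x.setting.firstLedger
      {z | z ∈ x.setting.messages}) := by
  have h := S.feasible (A := A) hE hC
  refine (of_imp (W := fun _ ω d => d.nth 0 ≠ d.nth 1 ∧ S.hash ω.pub (d.nth 0) = S.hash ω.pub (d.nth 1))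
    hcr h.eff_pairs (p := fun x => x.setting.collides) (fun Δ d g b lift hb =>
    h.eff_collides (lift .self) hb) fun x d => of_decide_eq_true).mono fun x hx => ?_
  simp only [Set.InjOn, not_forall] at hx
  obtain ⟨y, hy, y', hy', heq, hne⟩ := hx
  exact ⟨_, List.mem_flatMap.2 ⟨y, x.setting.mem_hashInputList hy, List.mem_map.2
    ⟨y', x.setting.mem_hashInputList hy', rfl⟩⟩, decide_eq_true ⟨hne, heq⟩⟩

theorem execution (hex : S.ExecutionSound) : Rare fun x : S.Trial A =>
    ¬ ∀ i < x.setting.firstLedger.length, ∀ z ∈ x.setting.messages, ∀ com,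
      x.setting.sδ (x.setting.commit (x.setting.state x.setting.firstLedger i))
          (Setting.txAt x.setting.firstLedger (i + 1)) (z.nth 2) = some com →
        com = x.setting.commit (x.setting.state x.setting.firstLedger (i + 1)) := by
  have h := S.feasible (A := A) hE hC
  refine (of_imp (W := fun _ ω d => ∃ com,
    S.sδ ω.pub (S.commit ω.pub (d.nth 0)) (d.nth 1) (d.nth 2) = some com ∧
      com ≠ S.commit ω.pub (S.δ (d.nth 0) (d.nth 1))) hex h.eff_transitions (p := fun x => x.setting.misleads) (fun Δ d g b lift hb =>
    h.eff_misleads (lift .self) hb) fun x d hd => ?_).mono fun x hx => ?_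
  · exact x.setting.misleads_iff.1 hd
  · push Not at hx
    obtain ⟨i, hi, z, hz, com, hcom, hne⟩ := hx
    rw [Setting.state_succ' _ hi] at hne
    exact ⟨_, List.mem_flatMap.2 ⟨i, List.mem_range.2 hi, List.mem_map.2 ⟨z, hz, rfl⟩⟩,
      x.setting.misleads_iff.2 ⟨com, hcom, hne⟩⟩

end Rare

end System


/-! ### The consensus oracle beyond the honest ledger -/

namespace Setting

variable (I : Setting)

/-- The transactions that were presented as successors of `tx`, together with `tx'`. -/
def links (tx tx' : Data) : List Data :=
  I.messages.map fun z => ofList [tx, (z.nth 0).hd, z.nth 1, tx']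

def accepts (d : Data) : Bool := I.co (d.nth 0) (d.nth 1) (d.nth 2)

/-- Acceptance of a transaction other than a given one. -/
def acceptsOther (d : Data) : Bool := decide (I.accepts d = true ∧ d.nth 1 ≠ d.nth 3)

/-- The first transactions that the consensus oracle accepts after the end of the ledger. -/
def chainTx : ℕ → Data
  | 0 => txAt I.firstLedger I.firstLedger.length
  | i + 1 => (((I.links (chainTx i) nil).find? I.accepts).getD nil).nth 1

def ledgerLinks : List Data :=
  (List.range I.firstLedger.length).flatMap fun i =>
    I.links (txAt I.firstLedger i) (txAt I.firstLedger (i + 1))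

end Setting

namespace Feasible

variable {X : Type} {I : X → Setting} {e₀ : X → Data} (h : Feasible I e₀)
  {Γ : Type} {e : Γ → Data} {x : Γ → X} (hx : Eff e fun y => e₀ (x y)) {v v' : Γ → Data}

include h

section

include hx

theorem eff_links (hv : Eff e v) (hv' : Eff e v') :
    Eff e fun y => ofList ((I (x y)).links (v y) (v' y)) := by
  refine Eff.map (β := fun _ => Data) (enc := fun _ d => d)
    ((h.eff_messages.comp x hx).congr fun x => by rw [List.map_id']) fun Δ d g z _ lift hz => ?_
  exact (lift hv).ofList_cons ((hz.nth 0).hd.ofList_three (hz.nth 1) (lift hv'))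

theorem eff_accepts (hv : Eff e v) : Eff e fun y => ofBool ((I (x y)).accepts (v y)) :=
  h.eff_co hx (hv.nth 0) (hv.nth 1) (hv.nth 2)

theorem eff_acceptsOther (hv : Eff e v) : Eff e fun y => ofBool ((I (x y)).acceptsOther (v y)) :=
  ((h.eff_accepts hx hv).congr fun y => by rw [ofProp, Bool.decide_eq_true]).and
    ((hv.nth 1).eq (hv.nth 3)).not

end

/-- The running time is polynomial for each fixed `i`, possibly with a degree that grows with `i`.
Only the indices below the constant window matter. -/
theorem eff_chainTx (i : ℕ) : Eff e₀ fun x => (I x).chainTx i := by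
  induction i with
  | zero => exact eff_txAt h.eff_firstLedger h.eff_firstLedger.length_list.bin
  | succ i ih =>
    refine ((Eff.find (β := fun _ => Data) (enc := fun _ d => d) (p := fun x => (I x).accepts)
      ((h.eff_links .self ih (.const nil)).congr fun x => by rw [List.map_id'])
      fun Δ d g b _ lift hb => h.eff_accepts (lift .self) hb).tl.nth 1).congr fun x => ?_
    rw [Setting.chainTx]
    cases ((I x).links ((I x).chainTx i) nil).find? (I x).accepts <;> rfl

theorem eff_ledgerLinks : Eff e₀ fun x => ofList (I x).ledgerLinks := by
  have hL := h.eff_firstLedger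
  exact Eff.flatMap (β := fun _ => ℕ) (enc := fun _ => unary) hL.length_list.range
    fun Δ d g i _ lift hi =>
      h.eff_links (lift .self) (eff_txAt (lift hL) hi.bin) (eff_txAt (lift hL) hi.bin.succ)

end Feasible

namespace Setting

/-- The first entry of the list `l` that satisfies `p` is wrongly accepted by the consensus oracle,
where the true ledger is `U`. -/
def Breaks (I : Setting) (U l : List Data) (p : Data → Bool) : Prop :=
  ∃ d, l.find? p = some d ∧ I.accepts d = true ∧ ¬ Follows U (d.nth 0) (d.nth 1)

variable {I : Setting} {U l : List Data} {p : Data → Bool}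

theorem follows_of_find (h : ¬ I.Breaks U l p) {d : Data} (hd : l.find? p = some d)
    (ha : I.accepts d = true) :
    Follows U (d.nth 0) (d.nth 1) :=
  of_not_not fun hn => h ⟨d, hd, ha, hn⟩

/-- Whether a transaction really follows on `U` cannot be tested efficiently, but whether it differs
from the expected one can. If any accepted entry differed, the search would find a first such entry;
as the search breaks nothing, this entry follows on `U` and so is the expected one after all. -/
theorem eq_of_not_breaks (h : ¬ I.Breaks U l I.acceptsOther)
    (hU : ∀ d ∈ l, Follows U (d.nth 0) (d.nth 1) → d.nth 1 = d.nth 3)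
    {d : Data} (hd : d ∈ l) (ha : I.accepts d = true) : d.nth 1 = d.nth 3 := by
  by_contra hne
  obtain ⟨d', hd'⟩ := Option.isSome_iff_exists.1 (List.find?_isSome (p := I.acceptsOther).2
    ⟨d, hd, decide_eq_true ⟨ha, hne⟩⟩)
  have h' : I.acceptsOther d' = true := List.find?_some hd'
  obtain ⟨ha', hne'⟩ := of_decide_eq_true h'
  exact hne' (hU d' (List.mem_of_find?_eq_some hd') (follows_of_find h hd' ha'))

/-- Two searches are combined. The first shows that the first accepted successor is the true next
transaction on `U`; the second, which knows that transaction, shows that every other accepted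
successor equals it. So accepted chains move along `U` one position at a time. -/
theorem chainTx_succ (hU : (nil :: U).Nodup) {i j : ℕ}
    (hi : (nil :: U)[j]? = some (I.chainTx i))
    (h₁ : ¬ I.Breaks U (I.links (I.chainTx i) nil) I.accepts)
    (h₂ : ¬ I.Breaks U (I.links (I.chainTx i) (I.chainTx (i + 1)))
      I.acceptsOther) {z : Data} (hz : z ∈ I.messages)
    (hco : I.co (I.chainTx i) (z.nth 0).hd (z.nth 1) = true) :
    (z.nth 0).hd = I.chainTx (i + 1) ∧
      (nil :: U)[j + 1]? = some (I.chainTx (i + 1)) := by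
  have hlink : ∀ tx, ∀ d ∈ I.links (I.chainTx i) tx,
      d.nth 0 = I.chainTx i ∧ d.nth 3 = tx := by
    intro tx d hd
    obtain ⟨z, -, rfl⟩ := List.mem_map.1 hd
    exact ⟨rfl, rfl⟩
  have hmem : ∀ tx, ofList [I.chainTx i, (z.nth 0).hd, z.nth 1, tx] ∈
      I.links (I.chainTx i) tx := fun tx => List.mem_map.2 ⟨z, hz, rfl⟩
  obtain ⟨d, hd⟩ := Option.isSome_iff_exists.1
    (List.find?_isSome (p := I.accepts).2 ⟨_, hmem nil, hco⟩)
  have hnext : I.chainTx (i + 1) = d.nth 1 := by rw [chainTx, hd]; rfl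
  have hf := follows_of_find h₁ hd (List.find?_some hd)
  rw [(hlink _ d (List.mem_of_find?_eq_some hd)).1] at hf
  have hs := getElem?_succ_of_follows hU hi hf
  rw [← hnext] at hs
  generalize I.chainTx (i + 1) = tx at h₂ hs ⊢
  refine ⟨eq_of_not_breaks h₂ (fun d hd hf => ?_)
    (d := ofList [I.chainTx i, (z.nth 0).hd, z.nth 1, tx]) (hmem _) hco, hs⟩
  rw [(hlink _ d hd).1] at hf
  rw [(hlink _ d hd).2]
  exact Option.some_injective _ ((getElem?_succ_of_follows hU hi hf).symm.trans hs)

theorem sound_of_not_breaks (hU : (nil :: U).Nodup)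
    (hL : I.firstLedger <+: U)
    (h : ¬ I.Breaks U I.ledgerLinks I.acceptsOther)
    {i : ℕ} (hi : i < I.firstLedger.length) {z : Data} (hz : z ∈ I.messages)
    (hco : I.co (txAt I.firstLedger i) (z.nth 0).hd (z.nth 1) = true) :
    (z.nth 0).hd = txAt I.firstLedger (i + 1) := by
  refine eq_of_not_breaks h (fun d hd hf => ?_) (d := ofList [txAt I.firstLedger i,
    (z.nth 0).hd, z.nth 1, txAt I.firstLedger (i + 1)])
    (List.mem_flatMap.2 ⟨i, List.mem_range.2 hi, List.mem_map.2 ⟨z, hz, rfl⟩⟩) hco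
  obtain ⟨i, hi, hd⟩ := List.mem_flatMap.1 hd
  obtain ⟨z, -, rfl⟩ := List.mem_map.1 hd
  rw [List.mem_range] at hi
  exact Option.some_injective _ ((getElem?_succ_of_follows hU (getElem?_txAt hL hi.le) hf).symm.trans
    (getElem?_txAt hL hi))

end Setting

namespace System

variable {Party : Type} {S : System Party} {A : PPT}

theorem rare_breaks (hcon : S.ConsensusSound) {l : S.Trial A → List Data} (hl : Eff Trial.input fun x => ofList (l x))
    {p : S.Trial A → Data → Bool}
    (hp : ∀ (Δ : Type) (d : Δ → Data) (g : Δ → S.Trial A) (b : Δ → Data),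
      (∀ {w : S.Trial A → Data}, Eff Trial.input w → Eff d fun z => w (g z)) → Eff d b →
      Eff d fun z => ofBool (p (g z) (b z))) :
    Rare fun x : S.Trial A => x.setting.Breaks (x.world.union (S.r x.k + S.ν)) (l x) (p x) :=
  Rare.search (W := fun k ω d => S.co ω.pub (S.r k) (d.nth 0) (d.nth 1) (d.nth 2) = true ∧
    ¬ Follows (ω.union (S.r k + S.ν)) (d.nth 0) (d.nth 1)) hcon hl hp

section

variable (hE : S.Efficient) (hC : S.ConstantSize) (hcon : S.ConsensusSound)

include hE hC hcon

theorem rare_breaks_accepts (i : ℕ) : Rare fun x : S.Trial A =>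
    x.setting.Breaks (x.world.union (S.r x.k + S.ν)) (x.setting.links (x.setting.chainTx i) nil) x.setting.accepts :=
  have h := S.feasible (A := A) hE hC
  rare_breaks hcon (h.eff_links .self (h.eff_chainTx i) (.const nil))
    (p := fun x => x.setting.accepts) fun _ _ _ _ lift hb => h.eff_accepts (lift .self) hb

theorem rare_breaks_acceptsOther (i : ℕ) : Rare fun x : S.Trial A =>
    x.setting.Breaks (x.world.union (S.r x.k + S.ν)) (x.setting.links (x.setting.chainTx i) (x.setting.chainTx (i + 1)))
      x.setting.acceptsOther :=
  have h := S.feasible (A := A) hE hC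
  rare_breaks hcon (h.eff_links .self (h.eff_chainTx i) (h.eff_chainTx (i + 1)))
    (p := fun x => x.setting.acceptsOther) fun _ _ _ _ lift hb =>
      h.eff_acceptsOther (lift .self) hb

theorem rare_breaks_ledger : Rare fun x : S.Trial A =>
    x.setting.Breaks (x.world.union (S.r x.k + S.ν)) x.setting.ledgerLinks x.setting.acceptsOther :=
  have h := S.feasible (A := A) hE hC
  rare_breaks hcon h.eff_ledgerLinks (p := fun x => x.setting.acceptsOther)
    fun _ _ _ _ lift hb => h.eff_acceptsOther (lift .self) hb

end

/-- Except with negligible probability, the messages contain no forgeries. -/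
theorem rare_forgery [Nonempty Party] (hsafe : S.LedgerSafe) (hlip : S.LedgerLipschitz)
    (hN : S.LedgerUnique) (hcc : S.ConsensusComplete) (hcon : S.ConsensusSound)
    (hec : S.ExecutionComplete) (hex : S.ExecutionSound) (hcr : S.CollisionResistant)
    (hE : S.Efficient) (hC : S.ConstantSize) (hu : 0 < S.u)
    (hrole : ∀ k, ∃ i, S.role k i ≠ none) :
    Rare fun x : S.Trial A => ¬ ∃ P R, x.setting.firstLedger <+: x.world.union (S.r x.k) ∧
      x.setting.Unforged P x.setting.firstLedger {z | z ∈ x.setting.messages} R := by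
  refine ((((Rare.collision hE hC hcr).or (.execution hE hC hex)).or
    (rare_breaks_ledger hE hC hcon)).or
    ((Rare.exists_lt (rare_breaks_accepts hE hC hcon) S.window).or
    (.exists_lt (rare_breaks_acceptsOther hE hC hcon) S.window))).mono fun x hx => ?_
  by_contra hgood
  refine hx ?_
  simp only [not_or, not_exists, not_and, not_not] at hgood
  obtain ⟨⟨⟨hinj, hexec⟩, hled⟩, hacc, hoth⟩ := hgood
  obtain ⟨P, hP⟩ := x.setting.exists_firstLedger (by
    obtain ⟨i, hi⟩ := hrole x.k
    refine ⟨i, fun h => hi ?_⟩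
    exact Option.map_eq_none_iff.1 h)
  obtain ⟨Q, hQ⟩ : ∃ Q, x.world.ledger Q (S.r x.k) = x.setting.firstLedger := by
    have h : (S.role x.k P).map _ = _ := hP
    obtain ⟨Q, -, hQ⟩ := Option.map_eq_some_iff.1 h
    exact ⟨Q, hQ⟩
  have hU := S.union_nodup x.mem hsafe hN (S.r x.k + S.ν)
  have hL₀ := S.prefix_union x.mem hsafe Q (S.r x.k) 0
  have hL := S.prefix_union x.mem hsafe Q (S.r x.k) S.ν
  have hlt := S.length_union_lt x.mem hsafe hlip hu Q (S.r x.k)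
  rw [hQ] at hL₀ hL hlt
  rw [add_zero] at hL₀
  -- A chain of `i` links ends at position `|L| + i` of `U`, counted with the empty string in front.
  -- The length of `U` is less than `|L| + window`, so `i < window`.
  have hR : ∀ i, (nil :: x.world.union (S.r x.k + S.ν))[x.setting.firstLedger.length + i]? =
      some (x.setting.chainTx i) → i < S.window := fun i hi => by
    obtain ⟨hi, -⟩ := List.getElem?_eq_some_iff.1 hi
    rw [List.length_cons] at hi
    omega
  -- `R` records both the identity of the transaction and its position on `U`: the former ties it to
  -- the reductions, the latter yields the length bound.
  refine ⟨P, fun i tx => tx = x.setting.chainTx i ∧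
    (nil :: x.world.union (S.r x.k + S.ν))[x.setting.firstLedger.length + i]? =
      some (x.setting.chainTx i), hL₀, hP, ?_, ?_, ?_, hinj, ?_, ?_, ?_, ?_, ?_, ?_, ?_⟩
  · rintro tx htx rfl
    have h := hN x.k x.world x.mem Q (S.r x.k)
    rw [hQ] at h
    exact (List.nodup_cons.1 h).1 htx
  · exact fun d hd => x.setting.mem_messages.2 (hd_mem_subs (x.setting.mem_messages.1 hd))
  · exact fun d hd => x.setting.mem_messages.2 (tl_mem_subs (x.setting.mem_messages.1 hd))
  · intro i hi
    rw [Setting.state_succ' _ hi]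
    exact hec x.k x.world x.mem _ _
  · exact hexec
  · intro i hi π
    exact hcc x.k x.world x.mem _ _ π
      (follows_iff.2 ⟨i, getElem?_txAt hL₀ hi.le, getElem?_txAt hL₀ hi⟩)
  · exact fun i hi z hz => Setting.sound_of_not_breaks hU hL hled hi hz
  · exact ⟨rfl, getElem?_txAt hL le_rfl⟩
  · rintro i tx ⟨rfl, hi⟩ z hz hco
    obtain ⟨h₁, h₂⟩ := Setting.chainTx_succ hU hi (hacc i (hR i hi)) (hoth i (hR i hi)) hz hco
    exact ⟨h₁, h₂⟩
  · exact fun i tx h => hR i h.2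

end System

end LightClient

namespace LightClient

/-! ### The bounds of the theorem -/

/-- For `M ≥ 4` the summand `2` is at most `log₂ M`. For `M = 3` rounding helps: the integer
logarithm is `1`, and `3 ≤ 2 log₂ 3` because `2 ^ 3 ≤ 3 ^ 2`. -/
theorem log_add_two_le {N M : ℕ} (h : N ≤ M) (hM : 3 ≤ M) :
    (Nat.log 2 N : ℝ) + 2 ≤ 2 * Real.logb 2 M := by
  have h₀ : (0 : ℝ) < M := by positivity
  have h₁ : Nat.log 2 N ≤ Nat.log 2 M := Nat.log_mono_right h
  have h₂ : (Nat.log 2 M : ℝ) ≤ Real.logb 2 M := by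
    rw [Real.le_logb_iff_rpow_le one_lt_two h₀, Real.rpow_natCast]
    exact_mod_cast Nat.pow_log_le_self 2 (by omega)
  have h₁' : (Nat.log 2 N : ℝ) ≤ Nat.log 2 M := by exact_mod_cast h₁
  rcases hM.eq_or_lt with rfl | hM
  · have h₃ : Nat.log 2 3 = 1 := by decide
    have h₄ : (3 : ℝ) ≤ 2 * Real.logb 2 (3 : ℕ) := by
      rw [← Real.logb_rpow_eq_mul_logb_of_pos h₀ , Real.le_logb_iff_rpow_le one_lt_two (by positivity)]
      norm_num
    rw [h₃] at h₁'
    push_cast at h₁'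
    linarith
  · have h₃ : (2 : ℝ) ≤ Real.logb 2 M := by
      rw [Real.le_logb_iff_rpow_le one_lt_two h₀]
      have : (4 : ℝ) ≤ M := by exact_mod_cast hM
      norm_num
      linarith
    linarith

/-- Here `s` is the cost of a pair of oracle queries and `w` the window. Per prover the left side is
`20 K + 23 + 2 s + 4 w + 2 w s`; with `K ≤ 2 lg - 2` and `s, w ≤ w s` it is at most `40 lg + 8 w s`,
which explains the factor `20`. -/
theorem words_le {n K s w : ℕ} {lg : ℝ} (hK : (K : ℝ) + 2 ≤ 2 * lg) (hs : 1 ≤ s) (hw : 1 ≤ w) :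
    ((n + n * (2 * (10 * K + 11 + s + w * (2 + s))) : ℕ) : ℝ) ≤
      20 * (2 * n * lg + 2 * n * w * s) := by
  have hs' : (1 : ℝ) ≤ s := by exact_mod_cast hs
  have hw' : (1 : ℝ) ≤ w := by exact_mod_cast hw
  have h₁ : (s : ℝ) ≤ w * s := le_mul_of_one_le_left (by positivity) hw'
  have h₂ : (w : ℝ) ≤ w * s := le_mul_of_one_le_right (by positivity) hs'
  have h₃ : 1 + 2 * (10 * K + 11 + s + w * (2 + s) : ℝ) ≤ 20 * (2 * lg + 2 * (w * s)) := by
    rw [mul_add (w : ℝ)]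
    linarith
  have h₄ := mul_le_mul_of_nonneg_left h₃ n.cast_nonneg
  push_cast
  linarith

/-- With all subtrees of the final transcript as `G`, the proviso in `Triple` holds automatically.
-/
theorem Setting.finalLog_le {I : Setting} {P : Fin I.n} {L : List Data} {R : ℕ → Data → Prop}
    (U : I.Unforged P L {z | z ∈ I.messages} R) :
    I.finalLog.rounds ≤ I.n * (Nat.log 2 (I.maxSize L) + 2) ∧
      I.finalLog.words ≤ I.n + I.n * (2 * I.gameWords L) :=
  tournament_spec U fun _ hd => I.mem_messages.2 (mem_subs_of_mem hd)

end LightClient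

theorem mainTheorem3 :
    ∃ C : ℝ, 0 < C ∧
      ∀ (Party : Type) [Nonempty Party] (S : LightClient.System Party),
        S.LedgerSafe → S.LedgerLive → S.LedgerLipschitz → S.LedgerUnique →
        S.ConsensusComplete → S.ConsensusSound →
        S.ExecutionComplete → S.ExecutionSound →
        S.CollisionResistant → S.Efficient → S.ConstantSize →
        0 < S.u →
        S.Always (fun k ω => 3 ≤ (ω.union (S.r k)).length + S.α * (S.u + S.ν)) →
        (∀ k, ∃ i, S.role k i ≠ none) →
        ∀ A : LightClient.PPT,
          LightClient.Negligible fun k => S.prob A k fun ω c =>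
            ¬ (((S.setting A k ω c).finalLog.rounds : ℝ) ≤
                  2 * S.n k *
                    Real.logb 2 ((ω.union (S.r k)).length + S.α * (S.u + S.ν)) ∧
               ((S.setting A k ω c).finalLog.words : ℝ) ≤
                  C * (2 * S.n k *
                        Real.logb 2 ((ω.union (S.r k)).length + S.α * (S.u + S.ν)) +
                      2 * S.n k * (S.α * (S.u + S.ν)) * (S.f (S.r k) + S.g (S.r k)))) := by
  refine ⟨20, by norm_num, fun Party _ S hsafe _ hlip hN hcc hcon hec hex hcr hE hC hu h3 hrole A =>
    LightClient.System.negligible_of_le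
      (LightClient.System.rare_forgery (A := A) hsafe hlip hN hcc hcon hec hex hcr hE hC hu hrole)
      fun k => LightClient.System.prob_le S A fun ω hω c hbad => ⟨hω, fun ⟨P, R, hL, U⟩ => hbad ?_⟩⟩
  have hwindow : 1 ≤ S.window := LightClient.Setting.window_pos U
  obtain ⟨h₁, h₂⟩ := LightClient.Setting.finalLog_le U
  -- The analysis was made relative to the ledger of one honest prover. It is a prefix of the
  -- longest ledger of round `r`, so the bound for claim sizes is at most the quantity in the
  -- theorem.
  have h₃ := LightClient.log_add_two_le (N := (S.setting A k ω c).maxSize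
    (S.setting A k ω c).firstLedger) (Nat.add_le_add_right hL.length_le S.window) (h3 k ω hω)
  have h₄ := LightClient.words_le (n := S.n k) h₃ (hC.query k) hwindow
  simp only [LightClient.System.window] at h₃ h₄
  push_cast at h₃ h₄
  constructor
  · refine (Nat.cast_le.2 h₁).trans ?_
    push_cast
    exact (mul_le_mul_of_nonneg_left h₃ (Nat.cast_nonneg (S.n k))).trans_eq (by ring)
  · have h₅ : (S.setting A k ω c).gameWords (S.setting A k ω c).firstLedger =
        10 * Nat.log 2 ((S.setting A k ω c).maxSize (S.setting A k ω c).firstLedger) + 11 +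
          (S.f (S.r k) + S.g (S.r k)) + S.window * (2 + (S.f (S.r k) + S.g (S.r k))) := by
      rw [LightClient.Setting.gameWords]
      simp only [LightClient.System.setting]
      ring
    rw [h₅] at h₂
    refine (Nat.cast_le.2 h₂).trans ?_
    push_cast [LightClient.System.window]
    exact h₄
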